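/- **Notation.** Let $n\ge 1$, $j\in\{0,\dots,n-1\}$, $p\ge 1$, $s\in\mathbb R$. Let $\omega_k$ be the volume of the unit ball of $\mathbb R^k$, $c_{n,j}=\omega_n/\omega_{n-j}$, and $\nu_{n,k}$ the rotation invariant probability measure on the Grassmannian $G_{n,k}$ of $k$-dimensional linear subspaces of $\mathbb R^n$. $(1-st)_+^{1/s}$ and $[1-st]_+^{1/s-1}$ are read as $e^{-t}$ for $s=0$; $(1-st)_+^{1/s}=0$ for $t=+\infty$, and $[1-st]_+^{1/s-1}=0$ where $1-st\le 0$. $\mathcal F_s(\mathbb R^n)$ is the class of $s$-concave, upper semicontinuous, integrable $f:\mathbb R^n\to[0,\infty)$ with $f(o)=\max f>0$. $C_s(\mathbb R^n)$ is the class of convex, lower semicontinuous $u:\mathbb R^n\to[0,\infty]$ with $u(o)=0$ and $u(x)/\|x\|\to\infty$ as $x\to\infty$. $C^{2,+}(\mathbb R^n)$ is the class of finite $u\in C_s(\mathbb R^n)$ of class $C^2$ with positive definite Hessian everywhere. $u^*(x)=\sup_y[\langle x,y\rangle-u(y)]$ is the Legendre transform. For a subspace $H$ and $x\in H$, $P_Hf(x)=\sup_{y\in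 H^\perp}f(x+y)$ and $u_H(x)=\inf_{y\in H^\perp}u(x+y)$. The quermassintegrals are $$W_j(f)=c_{n,j}\int_{G_{n,n-j}}\int_H P_Hf(x)\,dx\,d\nu_{n,n-j}(H).$$ For $f=(1-su)_+^{1/s}$ and $g=(1-sv)_+^{1/s}$ with base functions $u,v\in C_s(\mathbb R^n)$, let $f\star_{p,s}\varepsilon\cdot_{p,s}g=(1-su_\varepsilon)_+^{1/s}$ with $u_\varepsilon=\big[((u^*)^p+\varepsilon(v^*)^p)^{1/p}\big]^*$, and $$W_{p,j}^s(f,g)=\frac{p}{n-j}\lim_{\varepsilon\to0^+}\frac{W_j(f\star_{p,s}\varepsilon\cdot_{p,s}g)-W_j(f)}{\varepsilon}.$$ For a family of functions $F_H:H\to[0,\infty)$, one for each subspace $H$, let $\langle F\rangle(x)$, $x\neq o$, be the mean of $F_H(x)$ over the uniformly distributed random $(n-j)$-dimensional subspace $H$ containing $x$, that is, $\langle F\rangle(x)=\int_{G_{n,n-j-1}}F_{\mathbb Rx+K}(x)\,d\nu_{n,n-j-1}(K)$. **Statement.** Let $u\in C^{2,+}(\mathbb R^n)$ with $f=(1-su)_+^{1/s}\in\mathcal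 F_s(\mathbb R^n)$ and $\varphi=u^*$. Let $\psi\in C_c^\infty(\mathbb R^n)$ with $\psi\ge0$ and $\psi(o)=0$. (i) If $\psi=v^*$ for some $v\in C_s(\mathbb R^n)$ with $g=(1-sv)_+^{1/s}\in\mathcal F_s(\mathbb R^n)$, then, with $\varphi_H=(u_H)^*$, $\psi_H=(v_H)^*$ and $$F_H(x)=[1-su_H(x)]_+^{\frac1s-1}\,\psi_H(\nabla u_H(x))^p\,\varphi_H(\nabla u_H(x))^{1-p}\qquad(x\in H),$$ the limit defining $W_{p,j}^s(f,g)$ exists, all quermassintegrals in it are finite, and $$W_{p,j}^s(f,g)=\frac{c_{n,j}}{n-j}\int_{G_{n,n-j}}\int_H F_H(x)\,dx\,d\nu_{n,n-j}(H)=\frac1n\int_{\mathbb R^n}\frac{\langle F\rangle(x)}{\|x\|^{j}}\,dx,$$ where both integrals are well defined and finite. For $s=0$ the weight in $F_H$ is $e^{-u_H}$. (ii) For every such $\psi$, whether or not it is a Legendre transform, the same holds for the perturbation $\varphi_\varepsilon=(\varphi^p+\varepsilon\psi^p)^{1/p}$ of $\varphi$: with $f_\varepsilon=(1-s\varphi_\varepsilon^*)_+^{1/s}$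 and $\psi_H=\psi|_H$ in the definition of $F_H$, all $W_j(f)$, $W_j(f_\varepsilon)$, $\varepsilon>0$, are finite and $$\frac{p}{n-j}\lim_{\varepsilon\to0^+}\frac{W_j(f_\varepsilon)-W_j(f)}{\varepsilon}=\frac{c_{n,j}}{n-j}\int_{G_{n,n-j}}\int_H F_H(x)\,dx\,d\nu_{n,n-j}(H)=\frac1n\int_{\mathbb R^n}\frac{\langle F\rangle(x)}{\|x\|^{j}}\,dx,$$ where both integrals are well defined and finite. -/

import Mathlib

open MeasureTheory Filter Topology
open scoped ENNReal ContDiff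

noncomputable section

/-- `ℝⁿ` with its Euclidean structure. -/
abbrev E (n : ℕ) : Type := EuclideanSpace ℝ (Fin n)

/-! ### The Grassmannian with its rotation invariant probability measure -/

/-- The orthogonal group `O(n)`. -/
abbrev OG (n : ℕ) := Matrix.orthogonalGroup (Fin n) ℝ

instance instMeasurableSpaceOG (n : ℕ) : MeasurableSpace (OG n) := borel _

instance instBorelSpaceOG (n : ℕ) : BorelSpace (OG n) := ⟨rfl⟩

instance instCompactSpaceOG (n : ℕ) : CompactSpace (OG n) := by
  have hb : IsCompact (Set.pi Set.univ fun _ : Fin n => Set.pi Set.univ fun _ : Fin n =>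
      Metric.closedBall (0 : ℝ) 1) :=
    isCompact_univ_pi fun _ => isCompact_univ_pi fun _ => isCompact_closedBall 0 1
  have hc : IsClosed ((Matrix.orthogonalGroup (Fin n) ℝ : Set (Matrix (Fin n) (Fin n) ℝ))) := by
    have : (Matrix.orthogonalGroup (Fin n) ℝ : Set (Matrix (Fin n) (Fin n) ℝ)) =
        {A | A * star A = 1} := by
      ext A
      exact Matrix.mem_orthogonalGroup_iff _ _
    rw [this]
    exact isClosed_eq (by fun_prop) continuous_const
  refine isCompact_iff_compactSpace.mp (IsCompact.of_isClosed_subset hb hc ?_)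
  intro A hA i _ j _
  simpa using entry_norm_bound_of_unitary hA i j

/-- The Haar probability measure of `O(n)`. -/
def haarOG (n : ℕ) : Measure (OG n) := Measure.haarMeasure ⊤

/-- The Grassmannian `G_{n,k}` of `k`-dimensional linear subspaces of `ℝⁿ`. -/
structure Gr (n k : ℕ) where
  /-- the subspace -/
  sub : Submodule ℝ (E n)
  finrank_eq : Module.finrank ℝ sub = k

/-- An orthogonal matrix as a linear automorphism of `ℝⁿ`. -/
def OG.toEquiv {n : ℕ} (g : OG n) : E n ≃ₗ[ℝ] E n :=
  LinearEquiv.ofLinearMap (Matrix.toEuclideanLin g.1) (Matrix.toEuclideanLin (star g.1))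
    (by
      rw [← Matrix.toLpLin_mul_same, Unitary.mul_star_self_of_mem g.2, Matrix.toLpLin_one])
    (by
      rw [← Matrix.toLpLin_mul_same, Unitary.star_mul_self_of_mem g.2, Matrix.toLpLin_one])

/-- The rotated subspace `g H`. -/
def Gr.rot {n k : ℕ} (H : Gr n k) (g : OG n) : Gr n k :=
  ⟨H.sub.map (OG.toEquiv g).toLinearMap,
    (LinearEquiv.finrank_map_eq (OG.toEquiv g) H.sub).trans H.finrank_eq⟩

/-- The quotient `σ`-algebra of the homogeneous space `G_{n,k}` of `O(n)`: a set is measurable when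
its preimages under the orbit maps `g ↦ g H` are Borel. -/
instance instMeasurableSpaceGr (n k : ℕ) : MeasurableSpace (Gr n k) :=
  ⨅ H : Gr n k, MeasurableSpace.map H.rot inferInstance

open Classical in
/-- The rotation invariant probability measure `ν_{n,k}` on `G_{n,k}` (for `k ≤ n`): the image of the
Haar probability measure of `O(n)` under an orbit map. -/
def grMeasure (n k : ℕ) : Measure (Gr n k) :=
  if h : Nonempty (Gr n k) then (haarOG n).map h.some.rot else 0

/-- The volume `ω_k` of the unit ball of `ℝᵏ`. -/
def ballVol (k : ℕ) : ℝ := (volume (Metric.ball (0 : E k) 1)).toReal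

/-- The constant `c_{n,j} = ω_n / ω_{n-j}`. -/
def cConst (n j : ℕ) : ℝ := ballVol n / ballVol (n - j)

/-- `∫_{G_{n,k}} ∫_H F_H(x) dx dν_{n,k}(H)`. -/
def grIntegral (n k : ℕ) (F : (H : Submodule ℝ (E n)) → H → ℝ) : ℝ :=
  ∫ H : Gr n k, (∫ x : H.sub, F H.sub x) ∂(grMeasure n k)

/-- The iterated integral `∫_{G_{n,k}} ∫_H F_H(x) dx dν_{n,k}(H)` is well defined and finite. -/
def GrIntegrable (n k : ℕ) (F : (H : Submodule ℝ (E n)) → H → ℝ) : Prop :=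
  (∀ H : Gr n k, Integrable (F H.sub) volume) ∧
    Integrable (fun H : Gr n k => ∫ x : H.sub, F H.sub x) (grMeasure n k)

/-- The value at `x` of the member of the family `F` that belongs to the subspace `ℝx + K`. -/
def atSpan {n : ℕ} (F : (H : Submodule ℝ (E n)) → H → ℝ) (K : Submodule ℝ (E n)) (x : E n) : ℝ :=
  F (Submodule.span ℝ {x} ⊔ K) ⟨x, Submodule.mem_sup_left (Submodule.mem_span_singleton_self x)⟩

/-- The mean of `F_H(x)` over the random `(n-j)`-dimensional subspaces `H` through `x`; a uniform such
subspace is `H = ℝx + K` with `K` uniform in `G_{n,n-j-1}`. -/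
def meanThrough (n j : ℕ) (F : (H : Submodule ℝ (E n)) → H → ℝ) (x : E n) : ℝ :=
  ∫ K : Gr n (n - j - 1), atSpan F K.sub x ∂(grMeasure n (n - j - 1))

/-! ### Base functions, Legendre transform, projections -/

section Legendre

variable {V : Type*} [NormedAddCommGroup V] [InnerProductSpace ℝ V]

/-- The Legendre transform `u*(x) = sup_y (⟨x, y⟩ - u(y))`. -/
def legendre (u : V → EReal) (x : V) : EReal :=
  ⨆ y : V, (((inner ℝ x y : ℝ) : EReal) - u y)

/-- The support function `(α φ^p + β ψ^p)^{1/p}` for nonnegative `φ`, `ψ`. -/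
def lpMean (p α : ℝ) (φ : V → EReal) (β : ℝ) (ψ : V → EReal) (y : V) : EReal :=
  (((ENNReal.ofReal α * (φ y).toENNReal ^ p + ENNReal.ofReal β * (ψ y).toENNReal ^ p) ^ (1 / p) :
    ℝ≥0∞) : EReal)

/-- The `L_p` addition of base functions `(α ⊡_p u) ⊞_p (β ⊡_p v) = ((α (u*)^p + β (v*)^p)^{1/p})*`. -/
def lpAdd (p α : ℝ) (u : V → EReal) (β : ℝ) (v : V → EReal) : V → EReal :=
  legendre (lpMean p α (legendre u) β (legendre v))

end Legendre

/-- The class `C_s(ℝⁿ)` of base functions. -/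
structure IsBase {n : ℕ} (u : E n → EReal) : Prop where
  nonneg : ∀ x, 0 ≤ u x
  convex : Convex ℝ {q : E n × ℝ | u q.1 ≤ (q.2 : EReal)}
  lsc : LowerSemicontinuous u
  zero : u 0 = 0
  /-- `u(x) / ‖x‖ → ∞` as `x → ∞`. -/
  superlinear : ∀ C : ℝ, ∀ᶠ x in cocompact (E n), ((C * ‖x‖ : ℝ) : EReal) ≤ u x

/-- The class `C^{2,+}(ℝⁿ)`. -/
structure IsC2Plus {n : ℕ} (u : E n → ℝ) : Prop where
  base : IsBase fun x => (u x : EReal)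
  contDiff : ContDiff ℝ 2 u
  hess_pos : ∀ x y : E n, y ≠ 0 → 0 < fderiv ℝ (fderiv ℝ u) x y y

open Classical in
/-- `Ω_s(t) = (1 - s t)_+^{1/s}` for `t ∈ [0,∞]`, which is `e^{-t}` for `s = 0`, and `Ω_s(∞) = 0`. -/
def omegaS (s : ℝ) (t : EReal) : ℝ :=
  if t = ⊤ then 0
  else if s = 0 then Real.exp (-t.toReal)
  else max (1 - s * t.toReal) 0 ^ (1 / s)

open Classical in
/-- `(1 - s t)_+^{1/s - 1}`, which is `e^{-t}` for `s = 0`. This weight is `-Ω_s'(t)`, so it is `0`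
where `1 - s t ≤ 0`, also when the exponent is not positive. -/
def weightS (s t : ℝ) : ℝ :=
  if s = 0 then Real.exp (-t)
  else if 0 < 1 - s * t then (1 - s * t) ^ (1 / s - 1) else 0

/-- The function `(1 - s u)_+^{1/s}` with base function `u`. -/
def ofBase {n : ℕ} (s : ℝ) (u : E n → EReal) (x : E n) : ℝ := omegaS s (u x)

open Classical in
/-- `s`-concavity of a nonnegative function, for real `s`. -/
def IsSConcave {n : ℕ} (s : ℝ) (f : E n → ℝ) : Prop :=
  ∀ x y : E n, ∀ t ∈ Set.Icc (0 : ℝ) 1, 0 < f x → 0 < f y →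
    (if s = 0 then f x ^ (1 - t) * f y ^ t
      else ((1 - t) * f x ^ s + t * f y ^ s) ^ (1 / s)) ≤ f ((1 - t) • x + t • y)

/-- The class `F_s(ℝⁿ)`. -/
structure IsF {n : ℕ} (s : ℝ) (f : E n → ℝ) : Prop where
  nonneg : ∀ x, 0 ≤ f x
  sConcave : IsSConcave s f
  usc : UpperSemicontinuous f
  integrable : Integrable f volume
  max_zero : ∀ x, f x ≤ f 0
  pos : 0 < f 0

/-- The projection `(P_H f)(x) = sup_{y ∈ H^⊥} f(x + y)` of a function. -/
def projSup {n : ℕ} (f : E n → ℝ) (H : Submodule ℝ (E n)) (x : H) : ℝ :=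
  ⨆ y : Hᗮ, f ((x : E n) + (y : E n))

/-- The projection `u_H(x) = inf_{y ∈ H^⊥} u(x + y)` of a base function. -/
def projInf {n : ℕ} (u : E n → EReal) (H : Submodule ℝ (E n)) (x : H) : EReal :=
  ⨅ y : Hᗮ, u ((x : E n) + (y : E n))

/-- The `L_{p,s}` Asplund sum `(α ·_{p,s} f) ⋆_{p,s} (β ·_{p,s} g)` of the functions `f`, `g` with base
functions `u`, `v`. -/
def asplund {n : ℕ} (p s α : ℝ) (u : E n → EReal) (β : ℝ) (v : E n → EReal) : E n → ℝ :=
  ofBase s (lpAdd p α u β v)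

/-! ### Quermassintegrals and their first variation -/

/-- The quermassintegral `W_j(f)`. -/
def quermass (n j : ℕ) (f : E n → ℝ) : ℝ := cConst n j * grIntegral n (n - j) (projSup f)

/-- `W = (p/(n-j)) lim_{ε → 0+} (W_j(F_ε) - W_j(f)) / ε`, all quermassintegrals being finite. -/
def IsFirstVariation (n j : ℕ) (p : ℝ) (f : E n → ℝ) (F : ℝ → E n → ℝ) (W : ℝ) : Prop :=
  GrIntegrable n (n - j) (projSup f) ∧
  (∀ ε : ℝ, 0 < ε → GrIntegrable n (n - j) (projSup (F ε))) ∧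
  Tendsto (fun ε : ℝ => p / ((n : ℝ) - j) * ((quermass n j (F ε) - quermass n j f) / ε))
    (𝓝[>] 0) (𝓝 W)

/-- `W` is the `L_{p,s}` mixed quermassintegral `W_{p,j}^s(f, g)` of the functions `f`, `g` with base
functions `u`, `v`. -/
def IsMixedQuermass (n j : ℕ) (p s : ℝ) (u v : E n → EReal) (W : ℝ) : Prop :=
  IsFirstVariation n j p (ofBase s u) (fun ε => asplund p s 1 u ε v) W

/-- The integrand `[1 - s u_H]_+^{1/s-1} ψ_H(∇u_H)^p φ_H(∇u_H)^{1-p}` on `H`, with `φ_H = (u_H)*`. -/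
def mixedIntegrand {n : ℕ} (p s : ℝ) (u : E n → EReal)
    (ψ : (H : Submodule ℝ (E n)) → H → EReal) (H : Submodule ℝ (E n)) (x : H) : ℝ :=
  weightS s (projInf u H x).toReal *
    (ψ H (gradient (fun z : H => (projInf u H z).toReal) x)).toReal ^ p *
    (legendre (projInf u H) (gradient (fun z : H => (projInf u H z).toReal) x)).toReal ^ (1 - p)

/-- The integral `∫_{ℝⁿ} F_H(x) / ‖x‖^j dx` of a family `F`, averaged over the subspaces `H ∋ x`. -/
def weightedIntegral (n j : ℕ) (F : (H : Submodule ℝ (E n)) → H → ℝ) : ℝ :=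
  ∫ x : E n, meanThrough n j F x / ‖x‖ ^ j

/-- The integral `∫_{ℝⁿ} F_H(x) / ‖x‖^j dx` is well defined and finite. -/
def WeightedIntegrable (n j : ℕ) (F : (H : Submodule ℝ (E n)) → H → ℝ) : Prop :=
  (∀ᵐ x : E n, Integrable (fun K : Gr n (n - j - 1) => atSpan F K.sub x)
    (grMeasure n (n - j - 1))) ∧
  Integrable (fun x : E n => meanThrough n j F x / ‖x‖ ^ j) volume

/-- The integral representation
`W = (c_{n,j}/(n-j)) ∫_{G_{n,n-j}} ∫_H F_H(x) dx dν(H) = (1/n) ∫_{ℝⁿ} F_H(x) / ‖x‖^j dx`,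
both integrals being well defined and finite. -/
def IsRepresentedBy (n j : ℕ) (F : (H : Submodule ℝ (E n)) → H → ℝ) (W : ℝ) : Prop :=
  (GrIntegrable n (n - j) F ∧ W = cConst n j / ((n : ℝ) - j) * grIntegral n (n - j) F) ∧
  (WeightedIntegrable n j F ∧ W = 1 / (n : ℝ) * weightedIntegral n j F)

end

/-! Everything on a subspace `H` is transported to a point of the whole space. For `x ∈ H` the
function `u` has exactly one minimum point `w = minPt u P x` on the fibre `x + Hᗮ`, where `P` is the
projection onto `H`; it is characterised by `w - x ∈ Hᗮ` and `∇u(w) ∈ H`. Hence `u_H(x) = u(w)`,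
`∇u_H(x) = ∇u(w)` (`gradient_projInf`), and `(u_H)* = u*|_H` (`legendre_projInf`).

Write `φ = u*` and `h = (1/p) ψ^p φ^(1-p)`. For fixed `y` the number `φ_ε(y)` is concave in `ε` with
right derivative `h(y)` at `0`. A Danskin type argument gives `φ_ε*(w) = u(w) - ε h(∇u(w)) + o(ε)`
(`tendsto_legendreReal_perturb`), whether or not `φ_ε` is convex. Testing the conjugate with the
single slope `∇u(w) ∈ H` gives `φ_ε* ≥ u(w) - ε h(∇u(w))` on the whole fibre
(`sub_le_legendreReal_perturb`). So `P_H f_ε(x)` is squeezed between two quantities with the same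
derivative, and its derivative is the weight times `h(∇u(w))`, which is `F_H(x)/p`.

To pass to the limit under the integral over `H`, one needs that `h` is bounded (`ψ ≤ Cφ`, since `φ`
grows at least quadratically at the origin) and that `h ∘ ∇u` has bounded support. For `s > 1` the
weight is unbounded near the edge of the support of `f`; there `t · (-Ω_s'(t))` is controlled by
differentiating the scaling identity of the integral (`lintegral_mul_weightS_le`). Where `f`
vanishes but `f_ε` does not, only a thin shell matters, and it contributes `O(ε^(1/s))`
(`lintegral_outside_le`). All bounds are uniform in `H` because the integral of `P_H f` over `H` is
bounded by a constant times the integral of `f` (`exists_lintegral_projection_le`), so dominated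
convergence applies on the Grassmannian as well.

The second formula is integral geometry. Rotations act transitively on pairs `(H, x)` with given
dimension and norm, so the rotation mean of `F` depends on `‖x‖` only (`rotMean_eq`). Polar
coordinates in `H` and in `ℝⁿ` turn both sides into the same radial integral, because `r^(n-1) / r^j
= r^(n-j-1)`; the constants `(n-j) ω_{n-j}` and `n ω_n` are balanced by `c_{n,j}`.

Measurability is handled by regarding a family `F_H(x)` as a function of the pair (projection onto
`H`, `x`). -/

noncomputable section

/-! ### Rotations and projections -/

namespace OG

variable {n : ℕ}

/-- An orthogonal matrix as a continuous linear map. -/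
def toCLM (g : OG n) : E n →L[ℝ] E n := Matrix.toEuclideanCLM (𝕜 := ℝ) g.1

theorem toCLM_mul (g h : OG n) : toCLM (g * h) = toCLM g ∘L toCLM h := by
  unfold toCLM
  rw [show (g * h).1 = g.1 * h.1 from rfl, map_mul]
  rfl

theorem toCLM_one : toCLM (1 : OG n) = ContinuousLinearMap.id ℝ (E n) := by
  unfold toCLM
  rw [show (1 : OG n).1 = 1 from rfl, map_one]
  rfl

theorem toCLM_mul_apply (g h : OG n) (x : E n) : toCLM (g * h) x = toCLM g (toCLM h x) := by
  rw [toCLM_mul]; rfl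

theorem toCLM_inv_apply (g : OG n) (x : E n) : toCLM g⁻¹ (toCLM g x) = x := by
  rw [← toCLM_mul_apply, inv_mul_cancel, toCLM_one]; rfl

theorem toCLM_apply_inv (g : OG n) (x : E n) : toCLM g (toCLM g⁻¹ x) = x := by
  rw [← toCLM_mul_apply, mul_inv_cancel, toCLM_one]; rfl

theorem adjoint_toCLM (g : OG n) : ContinuousLinearMap.adjoint (toCLM g) = toCLM g⁻¹ := by
  unfold toCLM
  rw [← ContinuousLinearMap.star_eq_adjoint, ← map_star]
  rfl

theorem inner_toCLM (g : OG n) (x y : E n) : inner ℝ (toCLM g x) (toCLM g y) = inner ℝ x y := by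
  rw [← ContinuousLinearMap.adjoint_inner_right, adjoint_toCLM, toCLM_inv_apply]

theorem norm_toCLM (g : OG n) (x : E n) : ‖toCLM g x‖ = ‖x‖ := by
  rw [norm_eq_sqrt_real_inner, inner_toCLM, ← norm_eq_sqrt_real_inner]

theorem continuous_toCLM : Continuous (toCLM : OG n → E n →L[ℝ] E n) := by
  let L : Matrix (Fin n) (Fin n) ℝ →ₗ[ℝ] E n →L[ℝ] E n :=
    { toFun := Matrix.toEuclideanCLM (n := Fin n) (𝕜 := ℝ)
      map_add' := map_add _
      map_smul' := map_smul _ }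
  exact L.continuous_of_finiteDimensional.comp continuous_subtype_val

/-- An orthogonal matrix as a linear isometry. -/
def toIso (g : OG n) : E n ≃ₗᵢ[ℝ] E n where
  toLinearEquiv := OG.toEquiv g
  norm_map' := norm_toCLM g

theorem toIso_apply (g : OG n) (x : E n) : toIso g x = toCLM g x := rfl

theorem toIso_symm_apply (g : OG n) (x : E n) : (toIso g).symm x = toCLM g⁻¹ x := by
  rw [LinearIsometryEquiv.symm_apply_eq, toIso_apply, toCLM_apply_inv]

theorem exists_toCLM_eq (m : E n ≃ₗᵢ[ℝ] E n) : ∃ g : OG n, ∀ x, toCLM g x = m x := by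
  let T : E n →L[ℝ] E n := m.toContinuousLinearEquiv
  have h1 : T * star T = 1 := by
    ext1 x
    have h2 : ContinuousLinearMap.adjoint T = (m.symm.toContinuousLinearEquiv : E n →L[ℝ] E n) := by
      symm
      rw [ContinuousLinearMap.eq_adjoint_iff]
      intro x y
      have := m.inner_map_map (m.symm x) y
      rw [LinearIsometryEquiv.apply_symm_apply] at this
      exact this.symm
    rw [ContinuousLinearMap.star_eq_adjoint, h2]
    simp [T]
  refine ⟨⟨(Matrix.toEuclideanCLM (n := Fin n) (𝕜 := ℝ)).symm T, ?_⟩, fun x => ?_⟩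
  · rw [Matrix.mem_unitaryGroup_iff]
    refine EquivLike.injective (Matrix.toEuclideanCLM (n := Fin n) (𝕜 := ℝ)) ?_
    rw [map_mul, map_star, StarAlgEquiv.apply_symm_apply, map_one]
    exact h1
  · change (Matrix.toEuclideanCLM (n := Fin n) (𝕜 := ℝ))
      ((Matrix.toEuclideanCLM (n := Fin n) (𝕜 := ℝ)).symm T) x = m x
    rw [StarAlgEquiv.apply_symm_apply]
    rfl

/-- The projection `g P g⁻¹`. -/
def conj (g : OG n) (P : E n →L[ℝ] E n) : E n →L[ℝ] E n := toCLM g ∘L P ∘L toCLM g⁻¹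

theorem conj_mul (g h : OG n) (P : E n →L[ℝ] E n) : conj (g * h) P = conj g (conj h P) := by
  ext1 x
  simp [conj, toCLM_mul_apply]

theorem continuous_conj : Continuous fun q : OG n × (E n →L[ℝ] E n) => conj q.1 q.2 := by
  unfold conj
  exact (continuous_toCLM.comp continuous_fst).clm_comp
    (continuous_snd.clm_comp (continuous_toCLM.comp (continuous_inv.comp continuous_fst)))

section

variable {α : Type*} [TopologicalSpace α] {g : α → OG n} {P : α → E n →L[ℝ] E n} {x : α → E n}

theorem _root_.Continuous.conj (hg : Continuous g) (hP : Continuous P) :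
    Continuous fun a => conj (g a) (P a) := by
  have h := continuous_conj.comp (hg.prodMk hP)
  exact h

theorem _root_.Continuous.toCLM_apply (hg : Continuous g) (hx : Continuous x) :
    Continuous fun a => toCLM (g a) (x a) := by
  have h := (continuous_toCLM.comp hg).clm_apply hx
  exact h

end

/-- The rotated subspace `g H`. -/
abbrev map (g : OG n) (H : Submodule ℝ (E n)) : Submodule ℝ (E n) :=
  H.map (OG.toEquiv g).toLinearMap

theorem starProjection_map (g : OG n) (H : Submodule ℝ (E n)) :
    (map g H).starProjection = conj g H.starProjection := by
  ext1 x
  have := Submodule.starProjection_map_apply (toIso g) H x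
  rw [toIso_symm_apply] at this
  exact this

/-- The restriction of a rotation to a subspace. -/
def mapIso (g : OG n) (H : Submodule ℝ (E n)) : H ≃ₗᵢ[ℝ] map g H where
  toLinearEquiv := (OG.toEquiv g).submoduleMap H
  norm_map' x := norm_toCLM g x

end OG

/-- One Gram–Schmidt step. It expresses the projection onto `ℝx + K` as an explicit function of the
projection onto `K` and of `x`, which is what measurability needs. If `x ∈ K`, then `0⁻¹ = 0` makes
the correction vanish, as it should. -/
theorem starProjection_span_singleton_sup {n : ℕ} (x : E n) (K : Submodule ℝ (E n)) :
    (Submodule.span ℝ {x} ⊔ K).starProjection = K.starProjection +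
      (‖x - K.starProjection x‖ ^ 2)⁻¹ •
        (innerSL ℝ (x - K.starProjection x)).smulRight (x - K.starProjection x) := by
  set q := x - K.starProjection x with hq
  have hqK : q ∈ Kᗮ := K.sub_starProjection_mem_orthogonal x
  have hKle : K ≤ Submodule.span ℝ {x} ⊔ K := le_sup_right
  have hx : x ∈ Submodule.span ℝ {x} ⊔ K :=
    Submodule.mem_sup_left (Submodule.mem_span_singleton_self x)
  have hqm : q ∈ Submodule.span ℝ {x} ⊔ K :=
    Submodule.sub_mem _ hx (hKle (K.starProjection_apply_mem x))
  ext1 y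
  refine Submodule.eq_starProjection_of_mem_orthogonal ?_ ?_
  · exact Submodule.add_mem _ (hKle (K.starProjection_apply_mem y))
      (Submodule.smul_mem _ _ (Submodule.smul_mem _ _ hqm))
  · set z := y - (K.starProjection + (‖q‖ ^ 2)⁻¹ • (innerSL ℝ q).smulRight q) y with hz
    have hz' : z = (y - K.starProjection y) - ((‖q‖ ^ 2)⁻¹ * inner ℝ q y) • q := by
      rw [hz]; simp [mul_smul, sub_sub]
    have hzK : z ∈ Kᗮ := by
      rw [hz']
      exact Submodule.sub_mem _ (K.sub_starProjection_mem_orthogonal y)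
        (Submodule.smul_mem _ _ hqK)
    have hzq : inner ℝ q z = 0 := by
      have h1 : inner ℝ q (K.starProjection y) = 0 :=
        Submodule.inner_left_of_mem_orthogonal (K.starProjection_apply_mem y) hqK
      rw [hz', inner_sub_right, inner_sub_right, h1, inner_smul_right, real_inner_self_eq_norm_sq]
      rcases eq_or_ne q 0 with h0 | h0
      · simp [h0]
      · have : ‖q‖ ^ 2 ≠ 0 := by positivity
        field_simp
        ring
    rw [← Submodule.inf_orthogonal]
    refine ⟨?_, hzK⟩
    rw [SetLike.mem_coe, Submodule.mem_orthogonal_singleton_iff_inner_right]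
    have hxq : x = q + K.starProjection x := by rw [hq]; abel
    rw [hxq, inner_add_left, hzq,
      Submodule.inner_right_of_mem_orthogonal (K.starProjection_apply_mem x) hzK, add_zero]

/-- Measurable is the most one can ask for: the projection jumps where `x` enters `K`. -/
theorem measurable_add_rankOne {n : ℕ} :
    Measurable fun q : (E n →L[ℝ] E n) × E n => q.1 + (‖q.2 - q.1 q.2‖ ^ 2)⁻¹ •
        (innerSL ℝ (q.2 - q.1 q.2)).smulRight (q.2 - q.1 q.2) := by
  have h1 : Continuous fun q : (E n →L[ℝ] E n) × E n => q.2 - q.1 q.2 := by fun_prop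
  have h2 : Continuous fun q : (E n →L[ℝ] E n) × E n =>
      (innerSL ℝ (q.2 - q.1 q.2)).smulRight (q.2 - q.1 q.2) := by
    have := (ContinuousLinearMap.smulRightL ℝ (E n) (E n)).continuous₂
    exact this.comp (((innerSL ℝ).continuous.comp h1).prodMk h1)
  exact measurable_fst.add (((h1.norm.pow 2).measurable.inv).smul h2.measurable)

/-! ### The Haar measure of the orthogonal group -/

instance instSecondCountableTopologyOG (n : ℕ) : SecondCountableTopology (OG n) := by
  have : SecondCountableTopology (Matrix (Fin n) (Fin n) ℝ) :=
    inferInstanceAs (SecondCountableTopology (Fin n → Fin n → ℝ))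
  exact TopologicalSpace.Subtype.secondCountableTopology _

instance instIsHaarMeasureHaarOG (n : ℕ) : (haarOG n).IsHaarMeasure := by
  unfold haarOG; infer_instance

instance instIsProbabilityMeasureHaarOG (n : ℕ) : IsProbabilityMeasure (haarOG n) :=
  ⟨by
    have := Measure.haarMeasure_self (G := OG n) (K₀ := ⊤)
    simpa [haarOG] using this⟩

/-- Unimodularity of a compact group: a right translate of Haar measure is again left invariant,
hence a multiple of it, and the factor is 1 by comparing total masses. -/
instance instIsMulRightInvariantHaarOG (n : ℕ) : (haarOG n).IsMulRightInvariant := by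
  refine ⟨fun g => ?_⟩
  have : IsProbabilityMeasure ((haarOG n).map (· * g)) :=
    Measure.isProbabilityMeasure_map (measurable_mul_const g).aemeasurable
  have h := Measure.isMulInvariant_eq_smul_of_compactSpace ((haarOG n).map (· * g)) (haarOG n)
  have h1 := congrArg (fun μ => μ Set.univ) h
  simp only [measure_univ, Measure.smul_apply] at h1
  have h2 : Measure.haarScalarFactor ((haarOG n).map (· * g)) (haarOG n) = 1 := by
    have h3 : ((Measure.haarScalarFactor ((haarOG n).map (· * g)) (haarOG n) : NNReal) : ℝ≥0∞)
        = 1 := by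
      simpa [ENNReal.smul_def] using h1.symm
    exact_mod_cast h3
  rw [h2, one_smul] at h
  exact h

/-! ### Integration over the Grassmannian -/

theorem Gr.measurable_rot {n k : ℕ} (H : Gr n k) : Measurable H.rot := by
  rw [measurable_iff_le_map]
  exact iInf_le _ H

theorem Gr.measurable_of_comp_rot {n k : ℕ} {β : Type*} [MeasurableSpace β] {f : Gr n k → β}
    (hf : ∀ H : Gr n k, Measurable fun g => f (H.rot g)) : Measurable f := by
  intro s hs
  rw [instMeasurableSpaceGr, MeasurableSpace.measurableSet_iInf]
  exact fun H => hf H hs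

theorem Gr.nonempty {n k : ℕ} (hk : k ≤ n) : Nonempty (Gr n k) := by
  let b := EuclideanSpace.basisFun (Fin n) ℝ
  have hb : LinearIndependent ℝ (b ∘ Fin.castLE hk) :=
    b.orthonormal.linearIndependent.comp _ (Fin.castLE_injective hk)
  exact ⟨⟨Submodule.span ℝ (Set.range (b ∘ Fin.castLE hk)),
    by rw [finrank_span_eq_card hb, Fintype.card_fin]⟩⟩

theorem grMeasure_eq {n k : ℕ} (hk : k ≤ n) :
    ∃ H : Gr n k, grMeasure n k = (haarOG n).map H.rot :=
  ⟨_, dif_pos (Gr.nonempty hk)⟩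

theorem isProbabilityMeasure_grMeasure {n k : ℕ} (hk : k ≤ n) :
    IsProbabilityMeasure (grMeasure n k) := by
  obtain ⟨H, hH⟩ := grMeasure_eq hk
  rw [hH]
  exact Measure.isProbabilityMeasure_map H.measurable_rot.aemeasurable

/-! ### Transitivity -/

/-- Any isometry `H₁ → H₂` is corrected by a reflection of `H₂` that carries the image of `x₁` to
`x₂`; the result extends to the whole space. -/
theorem exists_rotation {n : ℕ} {H₁ H₂ : Submodule ℝ (E n)}
    (hd : Module.finrank ℝ H₁ = Module.finrank ℝ H₂) {x₁ x₂ : E n} (h₁ : x₁ ∈ H₁) (h₂ : x₂ ∈ H₂)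
    (hx : ‖x₁‖ = ‖x₂‖) : ∃ g : OG n, OG.map g H₁ = H₂ ∧ OG.toCLM g x₁ = x₂ := by
  let T : H₁ ≃ₗᵢ[ℝ] H₂ := 
    (stdOrthonormalBasis ℝ H₁).equiv (stdOrthonormalBasis ℝ H₂) (finCongr hd)
  let y : H₂ := T ⟨x₁, h₁⟩
  have hy : ‖y‖ = ‖(⟨x₂, h₂⟩ : H₂)‖ := by
    simp only [y, LinearIsometryEquiv.norm_map]
    exact hx
  let S : H₁ ≃ₗᵢ[ℝ] H₂ := T.trans (Submodule.span ℝ {y - ⟨x₂, h₂⟩})ᗮ.reflection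
  have hS : S ⟨x₁, h₁⟩ = ⟨x₂, h₂⟩ := by
    simpa [S] using Submodule.reflection_sub hy
  let L : H₁ →ₗᵢ[ℝ] E n := H₂.subtypeₗᵢ.comp S.toLinearIsometry
  obtain ⟨g, hg⟩ := OG.exists_toCLM_eq (L.extend.toLinearIsometryEquiv rfl)
  have hgL : ∀ z : H₁, OG.toCLM g z = S z := fun z => by
    rw [hg]
    exact L.extend_apply z
  refine ⟨g, ?_, ?_⟩
  · apply Submodule.eq_of_le_of_finrank_eq
    · rintro _ ⟨z, hz, rfl⟩
      have := hgL ⟨z, hz⟩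
      change OG.toCLM g z ∈ H₂
      rw [this]
      exact (S _).2
    · rw [LinearEquiv.finrank_map_eq (OG.toEquiv g) H₁, hd]
  · rw [hgL ⟨x₁, h₁⟩, hS]

/-! ### Polar coordinates -/

theorem lintegral_fun_norm {V : Type*} [NormedAddCommGroup V] [InnerProductSpace ℝ V]
    [FiniteDimensional ℝ V] [MeasurableSpace V] [BorelSpace V] [Nontrivial V]
    {f : ℝ → ℝ≥0∞} (hf : Measurable f) :
    ∫⁻ x : V, f ‖x‖ = (Module.finrank ℝ V : ℝ≥0∞) * volume (Metric.ball (0 : V) 1) *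
      ∫⁻ r in Set.Ioi (0 : ℝ), ENNReal.ofReal (r ^ (Module.finrank ℝ V - 1)) * f r := by
  have h1 : ∫⁻ x : V, f ‖x‖ = ∫⁻ x : ({(0 : V)}ᶜ : Set V), f ‖x.1‖ ∂(volume.comap Subtype.val) := by
    rw [lintegral_subtype_comap (measurableSet_singleton _).compl fun x : V => f ‖x‖,
      restrict_compl_singleton]
  have h2 := (Measure.measurePreserving_homeomorphUnitSphereProd
    (volume : Measure V)).lintegral_comp_emb (Homeomorph.measurableEmbedding _)
      (f ∘ Subtype.val ∘ Prod.snd)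
  simp only [Function.comp_def, homeomorphUnitSphereProd_apply_snd_coe] at h2
  rw [h1, h2, lintegral_prod _ (by fun_prop)]
  simp only [lintegral_const]
  rw [Measure.toSphere_apply_univ, mul_comm, Measure.volumeIoiPow,
    lintegral_withDensity_eq_lintegral_mul _ (by fun_prop) (by fun_prop)]
  congr 1
  rw [← lintegral_subtype_comap measurableSet_Ioi]
  rfl

theorem volume_ball_eq_of_finrank_eq {V W : Type*} [NormedAddCommGroup V] [InnerProductSpace ℝ V]
    [FiniteDimensional ℝ V] [MeasurableSpace V] [BorelSpace V]
    [NormedAddCommGroup W] [InnerProductSpace ℝ W]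
    [FiniteDimensional ℝ W] [MeasurableSpace W] [BorelSpace W]
    (h : Module.finrank ℝ V = Module.finrank ℝ W) (r : ℝ) :
    volume (Metric.ball (0 : V) r) = volume (Metric.ball (0 : W) r) := by
  let T : V ≃ₗᵢ[ℝ] W := (stdOrthonormalBasis ℝ V).equiv (stdOrthonormalBasis ℝ W) (finCongr h)
  rw [← T.measurePreserving.measure_preimage measurableSet_ball.nullMeasurableSet]
  congr 1
  ext x
  simp

theorem ofReal_ballVol (k : ℕ) : ENNReal.ofReal (ballVol k) = volume (Metric.ball (0 : E k) 1) :=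
  ENNReal.ofReal_toReal measure_ball_lt_top.ne

theorem ballVol_pos (k : ℕ) : 0 < ballVol k :=
  ENNReal.toReal_pos (Metric.measure_ball_pos volume _ one_pos).ne' measure_ball_lt_top.ne

/-! ### Averages over rotations -/

section Rotation

variable {n : ℕ}

/-- The mean of `Ψ (h P h⁻¹, h x)` over all rotations `h`. -/
def rotMean (Ψ : (E n →L[ℝ] E n) × E n → ℝ≥0∞) (q : (E n →L[ℝ] E n) × E n) : ℝ≥0∞ :=
  ∫⁻ h, Ψ (OG.conj h q.1, OG.toCLM h q.2) ∂(haarOG n)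

section

variable {α : Type*} [MeasurableSpace α] {g : α → OG n} {P : α → E n →L[ℝ] E n} {x : α → E n}

theorem OG.continuous_act :
    Continuous fun z : OG n × (E n →L[ℝ] E n) × E n => (OG.conj z.1 z.2.1, OG.toCLM z.1 z.2.2) := by
  have h1 : Continuous fun z : OG n × (E n →L[ℝ] E n) × E n => OG.conj z.1 z.2.1 :=
    Continuous.conj continuous_fst (continuous_fst.comp continuous_snd)
  have h2 : Continuous fun z : OG n × (E n →L[ℝ] E n) × E n => OG.toCLM z.1 z.2.2 :=
    Continuous.toCLM_apply continuous_fst (continuous_snd.comp continuous_snd)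
  exact h1.prodMk h2

theorem Measurable.act (hg : Measurable g) (hP : Measurable P) (hx : Measurable x) :
    Measurable fun a => (OG.conj (g a) (P a), OG.toCLM (g a) (x a)) := by
  have h := OG.continuous_act.measurable.comp (hg.prodMk (hP.prodMk hx))
  exact h

theorem Measurable.conj (hg : Measurable g) (P : E n →L[ℝ] E n) :
    Measurable fun a => OG.conj (g a) P := by
  have h : Continuous fun g : OG n => OG.conj g P := Continuous.conj continuous_id continuous_const
  have h2 := h.measurable.comp hg
  exact h2

theorem Measurable.spanProj_conj (hg : Measurable g) (hx : Measurable x)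
    (K : Submodule ℝ (E n)) : Measurable fun a =>
      ((Submodule.span ℝ {x a} ⊔ OG.map (g a) K).starProjection, x a) := by
  have h1 := measurable_add_rankOne.comp ((Measurable.conj hg K.starProjection).prodMk hx)
  simp only [starProjection_span_singleton_sup, OG.starProjection_map]
  exact h1.prodMk hx

end

theorem measurable_rotMean {Ψ : (E n →L[ℝ] E n) × E n → ℝ≥0∞} (hΨ : Measurable Ψ) :
    Measurable (rotMean Ψ) := by
  have h : Measurable fun z : ((E n →L[ℝ] E n) × E n) × OG n =>
      Ψ (OG.conj z.2 z.1.1, OG.toCLM z.2 z.1.2) :=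
    hΨ.comp (Measurable.act measurable_snd (measurable_fst.comp measurable_fst)
      (measurable_snd.comp measurable_fst))
  exact h.lintegral_prod_right'

theorem rotMean_rotate (Ψ : (E n →L[ℝ] E n) × E n → ℝ≥0∞) (g : OG n) (P : E n →L[ℝ] E n)
    (x : E n) : rotMean Ψ (OG.conj g P, OG.toCLM g x) = rotMean Ψ (P, x) := by
  have h := lintegral_mul_right_eq_self (μ := haarOG n)
    (fun h => Ψ (OG.conj h P, OG.toCLM h x)) g
  simp only [OG.conj_mul, OG.toCLM_mul_apply] at h
  exact h

/-- Right invariance of Haar measure together with transitivity on pairs `x ∈ H`. This reduces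
integrals over subspaces to radial ones. -/
theorem rotMean_eq (Ψ : (E n →L[ℝ] E n) × E n → ℝ≥0∞) {H₁ H₂ : Submodule ℝ (E n)}
    (hd : Module.finrank ℝ H₁ = Module.finrank ℝ H₂) {x₁ x₂ : E n} (h₁ : x₁ ∈ H₁) (h₂ : x₂ ∈ H₂)
    (hx : ‖x₁‖ = ‖x₂‖) :
    rotMean Ψ (H₁.starProjection, x₁) = rotMean Ψ (H₂.starProjection, x₂) := by
  obtain ⟨g, rfl, rfl⟩ := exists_rotation hd h₁ h₂ hx
  rw [OG.starProjection_map, rotMean_rotate]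

theorem lintegral_rot {k : ℕ} (Ψ : (E n →L[ℝ] E n) × E n → ℝ≥0∞)
    (H : Gr n k) (g : OG n) : ∫⁻ x : (H.rot g).sub, Ψ ((H.rot g).sub.starProjection, x) =
      ∫⁻ x : H.sub, Ψ (OG.conj g H.sub.starProjection, OG.toCLM g x) := by
  have h := (OG.mapIso g H.sub).measurePreserving.lintegral_comp_emb
    (OG.mapIso g H.sub).toHomeomorph.measurableEmbedding
    (fun x => Ψ ((H.rot g).sub.starProjection, x))
  rw [← OG.starProjection_map]
  exact h.symm

theorem measurable_act_sub {k : ℕ} {Ψ : (E n →L[ℝ] E n) × E n → ℝ≥0∞} (hΨ : Measurable Ψ)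
    (H : Gr n k) : Measurable fun z : OG n × H.sub =>
      Ψ (OG.conj z.1 H.sub.starProjection, OG.toCLM z.1 (z.2 : E n)) :=
  hΨ.comp (Measurable.act measurable_fst measurable_const
    (measurable_subtype_coe.comp measurable_snd))

theorem measurable_lintegral_gr {k : ℕ} {Ψ : (E n →L[ℝ] E n) × E n → ℝ≥0∞} (hΨ : Measurable Ψ) :
    Measurable fun H : Gr n k => ∫⁻ x : H.sub, Ψ (H.sub.starProjection, x) := by
  refine Gr.measurable_of_comp_rot fun H => ?_
  simp only [lintegral_rot]
  exact (measurable_act_sub hΨ H).lintegral_prod_right'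

/-- All subspaces are rotations of one `H`. After exchanging the integrals over `O(n)` and `H`, the
inner integral is a radial function on `H`, and polar coordinates apply. -/
theorem lintegral_gr {k : ℕ} (hk : 1 ≤ k) (hkn : k ≤ n) {Ψ : (E n →L[ℝ] E n) × E n → ℝ≥0∞}
    (hΨ : Measurable Ψ) {H₀ : Submodule ℝ (E n)} (hH₀ : Module.finrank ℝ H₀ = k) {e : E n}
    (he : e ∈ H₀) (he1 : ‖e‖ = 1) :
    ∫⁻ H : Gr n k, (∫⁻ x : H.sub, Ψ (H.sub.starProjection, x)) ∂(grMeasure n k) =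
      (k : ℝ≥0∞) * ENNReal.ofReal (ballVol k) * ∫⁻ r in Set.Ioi (0 : ℝ),
        ENNReal.ofReal (r ^ (k - 1)) * rotMean Ψ (H₀.starProjection, r • e) := by
  obtain ⟨H, hH⟩ := grMeasure_eq hkn
  have hnt : Nontrivial H.sub := Module.nontrivial_of_finrank_pos (R := ℝ) (by rw [H.finrank_eq]; omega)
  rw [hH, lintegral_map (measurable_lintegral_gr hΨ) H.measurable_rot]
  simp only [lintegral_rot]
  rw [lintegral_lintegral_swap]
  swap
  · exact (measurable_act_sub hΨ H).aemeasurable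
  have h1 : ∀ x : H.sub, ∫⁻ g, Ψ (OG.conj g H.sub.starProjection, OG.toCLM g (x : E n)) ∂(haarOG n)
      = rotMean Ψ (H₀.starProjection, ‖x‖ • e) := fun x =>
    rotMean_eq Ψ (H.finrank_eq.trans hH₀.symm) x.2 (H₀.smul_mem _ he) (by simp [norm_smul, he1])
  simp only [h1]
  have hm : Measurable fun r : ℝ => rotMean Ψ (H₀.starProjection, r • e) :=
    (measurable_rotMean hΨ).comp (measurable_const.prodMk (measurable_id.smul_const e))
  rw [lintegral_fun_norm hm, H.finrank_eq, ofReal_ballVol,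
    volume_ball_eq_of_finrank_eq (W := E k) (by rw [H.finrank_eq]; simp)]

theorem OG.map_span_sup (g : OG n) (x : E n) (K : Submodule ℝ (E n)) :
    OG.map g (Submodule.span ℝ {x} ⊔ K) = Submodule.span ℝ {OG.toCLM g x} ⊔ OG.map g K := by
  rw [OG.map, Submodule.map_sup, Submodule.map_span, Set.image_singleton]
  rfl

/-- The mean over the Grassmannian is pulled back to `O(n)`, where joint measurability in the point
and the rotation is available for Tonelli. -/
theorem measurable_lintegral_span {k : ℕ} (hk : k ≤ n) {Ψ : (E n →L[ℝ] E n) × E n → ℝ≥0∞}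
    (hΨ : Measurable Ψ) : ∃ K : Gr n k, (Measurable fun q : E n × OG n =>
        Ψ ((Submodule.span ℝ {q.1} ⊔ OG.map q.2 K.sub).starProjection, q.1)) ∧
      ∀ x, ∫⁻ L : Gr n k, Ψ ((Submodule.span ℝ {x} ⊔ L.sub).starProjection, x) ∂(grMeasure n k) =
        ∫⁻ g, Ψ ((Submodule.span ℝ {x} ⊔ OG.map g K.sub).starProjection, x) ∂(haarOG n) := by
  obtain ⟨K, hK⟩ := grMeasure_eq hk
  have key : ∀ L : Gr n k, Measurable fun q : E n × OG n =>
      Ψ ((Submodule.span ℝ {q.1} ⊔ OG.map q.2 L.sub).starProjection, q.1) := fun L =>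
    hΨ.comp (Measurable.spanProj_conj measurable_snd measurable_fst L.sub)
  refine ⟨K, key K, fun x => ?_⟩
  rw [hK, lintegral_map _ K.measurable_rot]
  · rfl
  · refine Gr.measurable_of_comp_rot fun L => ?_
    have h := (key L).comp (measurable_prodMk_left (x := x))
    exact h

theorem measurable_span_gr {k : ℕ} {β : Type*} [MeasurableSpace β]
    {Φ : (E n →L[ℝ] E n) × E n → β}
    (hΦ : Measurable Φ) (x : E n) : Measurable fun L : Gr n k =>
      Φ ((Submodule.span ℝ {x} ⊔ L.sub).starProjection, x) := by
  refine Gr.measurable_of_comp_rot fun L => ?_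
  exact hΦ.comp (Measurable.spanProj_conj measurable_id measurable_const L.sub)

/-- Excludes the degenerate pairs for which `ℝx + gK` does not gain a dimension: for each `g` they
fill a proper subspace, which is a null set. -/
theorem ae_notMem_map {k : ℕ} (hk : k < n) (K : Gr n k) :
    ∀ᵐ q : E n × OG n ∂(volume.prod (haarOG n)), q.1 ∉ OG.map q.2 K.sub := by
  have hs : MeasurableSet {q : E n × OG n | q.1 ∈ OG.map q.2 K.sub} := by
    have : {q : E n × OG n | q.1 ∈ OG.map q.2 K.sub} =
        {q | OG.conj q.2 K.sub.starProjection q.1 = q.1} := by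
      ext q
      rw [Set.mem_ofPred_eq, Set.mem_ofPred_eq, ← OG.starProjection_map,
        Submodule.starProjection_eq_self_iff]
    rw [this]
    refine (isClosed_eq ?_ continuous_fst).measurableSet
    exact (Continuous.conj continuous_snd continuous_const).clm_apply continuous_fst
  rw [ae_iff]
  simp only [not_not]
  rw [Measure.prod_apply_symm hs, lintegral_eq_zero_iff (measurable_measure_prodMk_right hs)]
  refine Eventually.of_forall fun g => ?_
  refine Measure.addHaar_submodule volume (OG.map g K.sub) fun h => ?_
  have h2 := (LinearEquiv.finrank_map_eq (OG.toEquiv g) K.sub).trans K.finrank_eq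
  change Module.finrank ℝ (OG.map g K.sub) = k at h2
  rw [h, finrank_top, finrank_euclideanSpace_fin] at h2
  omega

theorem finrank_span_sup {K : Submodule ℝ (E n)} {x : E n} (hx : x ∉ K) :
    Module.finrank ℝ (Submodule.span ℝ {x} ⊔ K : Submodule ℝ (E n)) = Module.finrank ℝ K + 1 := by
  have hx0 : x ≠ 0 := fun h => hx (h ▸ K.zero_mem)
  have h := Submodule.finrank_sup_add_finrank_inf_eq (Submodule.span ℝ {x}) K
  have h2 : Submodule.span ℝ {x} ⊓ K = ⊥ := by
    rw [← disjoint_iff, disjoint_comm, Submodule.disjoint_span_singleton' hx0]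
    exact hx
  rw [h2, finrank_bot, finrank_span_singleton hx0] at h
  omega

/-- The product measure on pairs `(x, g)` is invariant under the joint rotation `(hx, hg)`, which
moves `ℝx + gK` to its image under `h`. Averaging over `h` therefore replaces `Ψ` by its rotation
mean, which is radial. -/
theorem lintegral_weighted {j : ℕ} (hj : j < n) {Ψ : (E n →L[ℝ] E n) × E n → ℝ≥0∞}
    (hΨ : Measurable Ψ) {H₀ : Submodule ℝ (E n)} (hH₀ : Module.finrank ℝ H₀ = n - j) {e : E n}
    (he : e ∈ H₀) (he1 : ‖e‖ = 1) :
    ∫⁻ x : E n, ENNReal.ofReal (1 / ‖x‖ ^ j) * ∫⁻ L : Gr n (n - j - 1),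
        Ψ ((Submodule.span ℝ {x} ⊔ L.sub).starProjection, x) ∂(grMeasure n (n - j - 1)) =
      (n : ℝ≥0∞) * ENNReal.ofReal (ballVol n) * ∫⁻ r in Set.Ioi (0 : ℝ),
        ENNReal.ofReal (r ^ (n - j - 1)) * rotMean Ψ (H₀.starProjection, r • e) := by
  obtain ⟨K, hKm, hK⟩ := measurable_lintegral_span (by omega : n - j - 1 ≤ n) hΨ
  have hnt : Nontrivial (E n) :=
    Module.nontrivial_of_finrank_pos (R := ℝ) (by rw [finrank_euclideanSpace_fin]; omega)
  set B : E n × OG n → ℝ≥0∞ := fun q => ENNReal.ofReal (1 / ‖q.1‖ ^ j) *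
    Ψ ((Submodule.span ℝ {q.1} ⊔ OG.map q.2 K.sub).starProjection, q.1) with hB
  have hBm : Measurable B := by
    refine Measurable.mul ?_ hKm
    fun_prop
  have hI : ∫⁻ x : E n, ENNReal.ofReal (1 / ‖x‖ ^ j) * ∫⁻ L : Gr n (n - j - 1),
        Ψ ((Submodule.span ℝ {x} ⊔ L.sub).starProjection, x) ∂(grMeasure n (n - j - 1)) =
      ∫⁻ q, B q ∂(volume.prod (haarOG n)) := by
    rw [lintegral_prod _ hBm.aemeasurable]
    refine lintegral_congr fun x => ?_
    rw [hK, ← lintegral_const_mul]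
    have h := hKm.comp (measurable_prodMk_left (x := x))
    exact h
  have hrot : ∀ h : OG n, ∫⁻ q, B q ∂(volume.prod (haarOG n)) =
      ∫⁻ q, B (OG.toCLM h q.1, h * q.2) ∂(volume.prod (haarOG n)) := fun h => by
    have hmp : MeasurePreserving (Prod.map (OG.toIso h) (h * ·))
        (volume.prod (haarOG n)) (volume.prod (haarOG n)) :=
      (OG.toIso h).measurePreserving.prod (measurePreserving_mul_left (haarOG n) h)
    exact (hmp.lintegral_comp hBm).symm
  have hBact : ∀ (h : OG n) (q : E n × OG n), B (OG.toCLM h q.1, h * q.2) =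
      ENNReal.ofReal (1 / ‖q.1‖ ^ j) *
        Ψ (OG.conj h (Submodule.span ℝ {q.1} ⊔ OG.map q.2 K.sub).starProjection,
          OG.toCLM h q.1) := fun h q => by
    have h1 : OG.map (h * q.2) K.sub = OG.map h (OG.map q.2 K.sub) := by
      ext y
      simp only [OG.map, Submodule.mem_map]
      constructor
      · rintro ⟨z, hz, rfl⟩
        exact ⟨_, ⟨z, hz, rfl⟩, (OG.toCLM_mul_apply h q.2 z).symm⟩
      · rintro ⟨_, ⟨z, hz, rfl⟩, rfl⟩
        exact ⟨z, hz, OG.toCLM_mul_apply h q.2 z⟩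
    simp only [hB, OG.norm_toCLM, h1, ← OG.map_span_sup, OG.starProjection_map]
  have hswap : ∫⁻ q, B q ∂(volume.prod (haarOG n)) = ∫⁻ q : E n × OG n,
      ENNReal.ofReal (1 / ‖q.1‖ ^ j) * rotMean Ψ (H₀.starProjection, ‖q.1‖ • e)
        ∂(volume.prod (haarOG n)) := by
    -- The integral is first averaged over a dummy rotation `h`, at no cost because Haar measure has
    -- mass 1.
    calc ∫⁻ q, B q ∂(volume.prod (haarOG n))
        = ∫⁻ _ : OG n, (∫⁻ q, B q ∂(volume.prod (haarOG n))) ∂(haarOG n) := by simp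
      _ = ∫⁻ h : OG n, (∫⁻ q, B (OG.toCLM h q.1, h * q.2) ∂(volume.prod (haarOG n)))
            ∂(haarOG n) := lintegral_congr fun h => hrot h
      _ = ∫⁻ q, (∫⁻ h : OG n, B (OG.toCLM h q.1, h * q.2) ∂(haarOG n))
            ∂(volume.prod (haarOG n)) := by
          refine lintegral_lintegral_swap (Measurable.aemeasurable ?_)
          refine hBm.comp (Measurable.prodMk ?_ ?_)
          · exact (Continuous.toCLM_apply continuous_fst
              (continuous_fst.comp continuous_snd)).measurable
          · exact (continuous_fst.mul (continuous_snd.comp continuous_snd)).measurable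
      _ = _ := by
          refine lintegral_congr_ae ?_
          filter_upwards [ae_notMem_map (by omega) K] with q hq
          simp only [hBact]
          rw [lintegral_const_mul]
          · congr 1
            refine rotMean_eq Ψ ?_ (Submodule.mem_sup_left (Submodule.mem_span_singleton_self _))
              (H₀.smul_mem _ he) (by simp [norm_smul, he1])
            rw [finrank_span_sup hq, hH₀,
              (LinearEquiv.finrank_map_eq (OG.toEquiv q.2) K.sub).trans K.finrank_eq]
            omega
          · exact hΨ.comp (Measurable.act measurable_id measurable_const measurable_const)
  have hm : Measurable fun r : ℝ => ENNReal.ofReal (1 / r ^ j) *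
      rotMean Ψ (H₀.starProjection, r • e) := by
    refine Measurable.mul (by fun_prop) ?_
    exact (measurable_rotMean hΨ).comp (measurable_const.prodMk (measurable_id.smul_const e))
  rw [hI, hswap, lintegral_prod _ (by
    exact (hm.comp (measurable_norm.comp measurable_fst)).aemeasurable)]
  simp only [lintegral_const, measure_univ, mul_one]
  rw [lintegral_fun_norm hm, finrank_euclideanSpace_fin, ofReal_ballVol]
  congr 1
  refine setLIntegral_congr_fun measurableSet_Ioi fun r hr => ?_
  have hr0 : (0 : ℝ) < r := hr
  rw [← mul_assoc, ← ENNReal.ofReal_mul (by positivity)]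
  congr 2
  -- The factor `‖x‖^(-j)` lowers the Jacobian of `ℝⁿ` to that of an `(n-j)`-dimensional subspace.
  have : n - 1 = (n - j - 1) + j := by omega
  rw [this, pow_add]
  field_simp

end Rotation

/-! ### Families of functions on the subspaces -/

/-- The members of the family depend measurably on the subspace and the point. -/
def IsMeasFamily {n : ℕ} (F : (H : Submodule ℝ (E n)) → H → ℝ) : Prop :=
  ∃ Φ : (E n →L[ℝ] E n) × E n → ℝ, Measurable Φ ∧
    ∀ (H : Submodule ℝ (E n)) (x : H), F H x = Φ (H.starProjection, x)

namespace IsMeasFamily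

variable {n : ℕ} {F : (H : Submodule ℝ (E n)) → H → ℝ}

theorem measurable (hF : IsMeasFamily F) (H : Submodule ℝ (E n)) : Measurable (F H) := by
  obtain ⟨Φ, hΦ, h⟩ := hF
  have : F H = fun x : H => Φ (H.starProjection, (x : E n)) := funext (h H)
  rw [this]
  exact hΦ.comp (measurable_const.prodMk measurable_subtype_coe)

/-- A bound uniform in `H` settles integrability over the Grassmannian, whose measure is finite. -/
theorem grIntegrable (hF : IsMeasFamily F) {k : ℕ} (hk : k ≤ n) (h0 : ∀ H x, 0 ≤ F H x) {C : ℝ≥0∞}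
    (hC : C ≠ ⊤) (hb : ∀ H : Gr n k, ∫⁻ x : H.sub, ENNReal.ofReal (F H.sub x) ≤ C) :
    GrIntegrable n k F ∧ ENNReal.ofReal (grIntegral n k F) =
      ∫⁻ H : Gr n k, (∫⁻ x : H.sub, ENNReal.ofReal (F H.sub x)) ∂(grMeasure n k) := by
  have hprob := isProbabilityMeasure_grMeasure hk
  have hmeas : Measurable fun H : Gr n k => ∫⁻ x : H.sub, ENNReal.ofReal (F H.sub x) := by
    obtain ⟨Φ, hΦ, h⟩ := hF
    simp only [h]
    exact measurable_lintegral_gr (Ψ := fun q => ENNReal.ofReal (Φ q)) hΦ.ennreal_ofReal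
  have heq : ∀ H : Gr n k, ∫ x : H.sub, F H.sub x =
      (∫⁻ x : H.sub, ENNReal.ofReal (F H.sub x)).toReal := fun H =>
    integral_eq_lintegral_of_nonneg_ae (Eventually.of_forall (h0 _))
      (hF.measurable _).aestronglyMeasurable
  have hint : Integrable (fun H : Gr n k => ∫ x : H.sub, F H.sub x) (grMeasure n k) := by
    simp only [heq]
    refine Integrable.of_bound hmeas.ennreal_toReal.aestronglyMeasurable C.toReal
      (Eventually.of_forall fun H => ?_)
    rw [Real.norm_of_nonneg ENNReal.toReal_nonneg]
    exact ENNReal.toReal_mono hC (hb H)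
  refine ⟨⟨fun H => ⟨(hF.measurable _).aestronglyMeasurable, ?_⟩, hint⟩, ?_⟩
  · rw [hasFiniteIntegral_iff_ofReal (Eventually.of_forall (h0 _))]
    exact (hb H).trans_lt hC.lt_top
  · unfold grIntegral
    rw [ofReal_integral_eq_lintegral_ofReal hint
      (Eventually.of_forall fun H => integral_nonneg (h0 _))]
    refine lintegral_congr fun H => ?_
    rw [heq, ENNReal.ofReal_toReal ((hb H).trans_lt hC.lt_top).ne]

/-- Both integrals are multiples of one radial integral `A`, with factors `(n-j) ω_{n-j}` and `n
ω_n`. -/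
theorem isRepresentedBy (hF : IsMeasFamily F) {j : ℕ} (hj : j < n) (h0 : ∀ H x, 0 ≤ F H x)
    {C : ℝ≥0∞} (hC : C ≠ ⊤)
    (hb : ∀ H : Gr n (n - j), ∫⁻ x : H.sub, ENNReal.ofReal (F H.sub x) ≤ C) :
    IsRepresentedBy n j F (cConst n j / ((n : ℝ) - j) * grIntegral n (n - j) F) := by
  obtain ⟨hgr, hgr2⟩ := hF.grIntegrable (Nat.sub_le n j) h0 hC hb
  refine ⟨⟨hgr, rfl⟩, ?_⟩
  obtain ⟨Φ, hΦ, hFΦ⟩ := hF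
  set Ψ : (E n →L[ℝ] E n) × E n → ℝ≥0∞ := fun q => ENNReal.ofReal (Φ q) with hΨdef
  have hΨ : Measurable Ψ := hΦ.ennreal_ofReal
  obtain ⟨H₀⟩ := Gr.nonempty (Nat.sub_le n j)
  have hnt : Nontrivial H₀.sub :=
    Module.nontrivial_of_finrank_pos (R := ℝ) (by rw [H₀.finrank_eq]; omega)
  obtain ⟨e', he'⟩ := exists_norm_eq H₀.sub zero_le_one
  set e : E n := (e' : E n)
  have he1 : ‖e‖ = 1 := he'
  have hA := lintegral_gr (by omega : 1 ≤ n - j) (Nat.sub_le n j) hΨ H₀.finrank_eq e'.2 he1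
  have hW := lintegral_weighted hj hΨ H₀.finrank_eq e'.2 he1
  set A : ℝ≥0∞ := ∫⁻ r in Set.Ioi (0 : ℝ),
        ENNReal.ofReal (r ^ (n - j - 1)) * rotMean Ψ (H₀.sub.starProjection, r • e) with hAdef
  have hgr3 : ENNReal.ofReal (grIntegral n (n - j) F) =
      ((n - j : ℕ) : ℝ≥0∞) * ENNReal.ofReal (ballVol (n - j)) * A := by
    rw [hgr2, ← hA]
    simp only [hFΦ, hΨdef]
  have hk0 : ((n - j : ℕ) : ℝ≥0∞) ≠ 0 := by
    have : n - j ≠ 0 := by omega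
    exact_mod_cast this
  -- Finiteness passes from the Grassmannian side to `A`, and from there to the weighted integral
  -- over `ℝⁿ`.
  have hAfin : A ≠ ⊤ := by
    intro hA
    rw [hA, ENNReal.mul_top] at hgr3
    · exact ENNReal.ofReal_ne_top hgr3
    · exact mul_ne_zero hk0 (ENNReal.ofReal_pos.2 (ballVol_pos _)).ne'
  have hgrR : grIntegral n (n - j) F = ((n : ℝ) - j) * ballVol (n - j) * A.toReal := by
    have hn : 0 ≤ grIntegral n (n - j) F :=
      integral_nonneg fun H => integral_nonneg (h0 _)
    have := congrArg ENNReal.toReal hgr3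
    rw [ENNReal.toReal_ofReal hn, ENNReal.toReal_mul, ENNReal.toReal_mul,
      ENNReal.toReal_ofReal (ballVol_pos _).le, ENNReal.toReal_natCast, Nat.cast_sub hj.le] at this
    exact this
  have hspan : ∀ (x : E n) (L : Gr n (n - j - 1)), atSpan F L.sub x =
      Φ ((Submodule.span ℝ {x} ⊔ L.sub).starProjection, x) := fun x L => hFΦ _ _
  have hmean : ∀ x, meanThrough n j F x = (∫⁻ L : Gr n (n - j - 1),
      Ψ ((Submodule.span ℝ {x} ⊔ L.sub).starProjection, x) ∂(grMeasure n (n - j - 1))).toReal := by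
    intro x
    unfold meanThrough
    have hnn : ∀ L : Gr n (n - j - 1), 0 ≤ atSpan F L.sub x := fun L => h0 _ _
    rw [integral_eq_lintegral_of_nonneg_ae (Eventually.of_forall hnn)]
    · simp only [hspan, hΨdef]
    · simp only [hspan]
      exact (measurable_span_gr hΦ x).aestronglyMeasurable
  set J : E n → ℝ≥0∞ := fun x => ∫⁻ L : Gr n (n - j - 1),
      Ψ ((Submodule.span ℝ {x} ⊔ L.sub).starProjection, x) ∂(grMeasure n (n - j - 1)) with hJ
  have hJm : Measurable J := by
    obtain ⟨K, hKm, hK⟩ := measurable_lintegral_span (by omega : n - j - 1 ≤ n) hΨ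
    have : J = fun x => ∫⁻ g, Ψ ((Submodule.span ℝ {x} ⊔ OG.map g K.sub).starProjection, x)
        ∂(haarOG n) := funext hK
    rw [this]
    exact hKm.lintegral_prod_right'
  have hWfin : (n : ℝ≥0∞) * ENNReal.ofReal (ballVol n) * A ≠ ⊤ :=
    ENNReal.mul_ne_top (ENNReal.mul_ne_top (ENNReal.natCast_ne_top n) ENNReal.ofReal_ne_top) hAfin
  have hwm : Measurable fun x : E n => ENNReal.ofReal (1 / ‖x‖ ^ j) * J x := by
    refine Measurable.mul (by fun_prop) hJm
  have hae : ∀ᵐ x : E n, J x < ⊤ := by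
    have hnt : Nontrivial (E n) :=
      Module.nontrivial_of_finrank_pos (R := ℝ) (by rw [finrank_euclideanSpace_fin]; omega)
    have h1 : ∀ᵐ x : E n, ENNReal.ofReal (1 / ‖x‖ ^ j) * J x < ⊤ :=
      ae_lt_top hwm (by rw [hW]; exact hWfin)
    have h2 : ∀ᵐ x : E n, x ≠ 0 := by
      simp [ae_iff]
    filter_upwards [h1, h2] with x hx hx0
    refine lt_top_iff_ne_top.2 fun h => ?_
    rw [h, ENNReal.mul_top] at hx
    · exact lt_irrefl _ hx
    · have : 0 < ‖x‖ := norm_pos_iff.2 hx0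
      exact (ENNReal.ofReal_pos.2 (by positivity)).ne'
  have hfun : ∀ᵐ x : E n, ENNReal.ofReal (meanThrough n j F x / ‖x‖ ^ j) =
      ENNReal.ofReal (1 / ‖x‖ ^ j) * J x := by
    filter_upwards [hae] with x hx
    rw [hmean, div_eq_mul_one_div, mul_comm, ENNReal.ofReal_mul (by positivity),
      ENNReal.ofReal_toReal hx.ne]
  have hnn : ∀ x, 0 ≤ meanThrough n j F x / ‖x‖ ^ j := fun x =>
    div_nonneg (integral_nonneg fun L => h0 _ _) (by positivity)
  have hmm : Measurable fun x => meanThrough n j F x / ‖x‖ ^ j := by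
    simp only [hmean]
    exact hJm.ennreal_toReal.div (by fun_prop)
  have hlint : ∫⁻ x, ENNReal.ofReal (meanThrough n j F x / ‖x‖ ^ j) =
      (n : ℝ≥0∞) * ENNReal.ofReal (ballVol n) * A := by
    rw [lintegral_congr_ae hfun, hW]
  refine ⟨⟨?_, hmm.aestronglyMeasurable, ?_⟩, ?_⟩
  · filter_upwards [hae] with x hx
    simp only [hspan]
    refine ⟨(measurable_span_gr hΦ x).aestronglyMeasurable, ?_⟩
    rw [hasFiniteIntegral_iff_ofReal (Eventually.of_forall fun L => by
      rw [← hspan]; exact h0 _ _)]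
    exact hx
  · rw [hasFiniteIntegral_iff_ofReal (Eventually.of_forall hnn), hlint]
    exact hWfin.lt_top
  · unfold weightedIntegral
    rw [integral_eq_lintegral_of_nonneg_ae (Eventually.of_forall hnn) hmm.aestronglyMeasurable,
      hlint, hgrR, ENNReal.toReal_mul, ENNReal.toReal_mul, ENNReal.toReal_natCast,
      ENNReal.toReal_ofReal (ballVol_pos _).le, cConst]
    have h1 : (n : ℝ) - j ≠ 0 := by
      have : (j : ℝ) < n := by exact_mod_cast hj
      linarith
    have h2 : (n : ℝ) ≠ 0 := by
      have : n ≠ 0 := by omega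
      exact_mod_cast this
    have h3 := (ballVol_pos (n - j)).ne'
    field_simp

end IsMeasFamily

/-! ### Smooth strictly convex base functions -/

namespace IsC2Plus

variable {n : ℕ} {u : E n → ℝ}

theorem nonneg (hu : IsC2Plus u) (x : E n) : 0 ≤ u x := by exact_mod_cast hu.base.nonneg x

theorem map_zero (hu : IsC2Plus u) : u 0 = 0 := by exact_mod_cast hu.base.zero

theorem convexOn (hu : IsC2Plus u) : ConvexOn ℝ Set.univ u := by
  rw [convexOn_iff_convex_epigraph]
  have h := hu.base.convex
  simpa using h

/-- Trades growth at infinity for a global bound: on the compact exceptional set `u ≥ 0` suffices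
once `B` is large. -/
theorem superlinear (hu : IsC2Plus u) (C : ℝ) : ∃ B, ∀ x, C * ‖x‖ - B ≤ u x := by
  have h := hu.base.superlinear C
  rw [Filter.eventually_iff, Filter.mem_cocompact] at h
  obtain ⟨K, hK, hKs⟩ := h
  obtain ⟨R, hR⟩ := hK.isBounded.subset_closedBall 0
  refine ⟨|C| * |R|, fun x => ?_⟩
  by_cases hx : x ∈ K
  · have h1 : ‖x‖ ≤ |R| := by
      have := hR hx
      rw [mem_closedBall_zero_iff] at this
      exact this.trans (le_abs_self R)
    have h2 : C * ‖x‖ ≤ |C| * |R| :=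
      (mul_le_mul_of_nonneg_right (le_abs_self C) (norm_nonneg x)).trans
        (mul_le_mul_of_nonneg_left h1 (abs_nonneg C))
    linarith [hu.nonneg x]
  · have h1 : ((C * ‖x‖ : ℝ) : EReal) ≤ u x := hKs hx
    have h2 : C * ‖x‖ ≤ u x := by exact_mod_cast h1
    have h3 : 0 ≤ |C| * |R| := by positivity
    linarith

theorem continuous (hu : IsC2Plus u) : Continuous u := hu.contDiff.continuous

theorem hasGradientAt (hu : IsC2Plus u) (x : E n) : HasGradientAt u (gradient u x) x :=
  ((hu.contDiff.differentiable (by norm_num)) x).hasGradientAt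

theorem fderiv_apply (hu : IsC2Plus u) (x v : E n) : fderiv ℝ u x v = inner ℝ (gradient u x) v := by
  have := (hu.hasGradientAt x).hasFDerivAt.fderiv
  rw [this]
  simp

theorem continuous_gradient (hu : IsC2Plus u) : Continuous (gradient u) := by
  unfold gradient
  exact (LinearIsometryEquiv.continuous _).comp (hu.contDiff.continuous_fderiv (by norm_num))

theorem hasDerivAt_line (hu : IsC2Plus u) (x v : E n) (t : ℝ) :
    HasDerivAt (fun t : ℝ => u (x + t • v)) (inner ℝ (gradient u (x + t • v)) v) t := by
  have h1 : HasDerivAt (fun t : ℝ => x + t • v) v t := by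
    simpa using ((hasDerivAt_id t).smul_const v).const_add x
  rw [← hu.fderiv_apply]
  exact ((hu.contDiff.differentiable (by norm_num)) (x + t • v)).hasFDerivAt.comp_hasDerivAt t h1

theorem gradient_le (hu : IsC2Plus u) (x y : E n) :
    u x + inner ℝ (gradient u x) (y - x) ≤ u y := by
  have h1 := hu.hasDerivAt_line x (y - x) 0
  simp only [zero_smul, add_zero] at h1
  have h2 := h1.hasDerivWithinAt (s := Set.Ioi 0)
  rw [hasDerivWithinAt_iff_tendsto_slope' (by simp)] at h2
  have h3 : inner ℝ (gradient u x) (y - x) ≤ u y - u x := by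
    refine le_of_tendsto h2 ?_
    filter_upwards [Ioo_mem_nhdsGT (zero_lt_one (α := ℝ))] with t ht
    have h4 := hu.convexOn.2 (Set.mem_univ x) (Set.mem_univ y) (by linarith [ht.2] : 0 ≤ 1 - t)
      ht.1.le (by ring)
    have h5 : (1 - t) • x + t • y = x + t • (y - x) := by module
    rw [h5, smul_eq_mul, smul_eq_mul] at h4
    rw [slope_def_field]
    simp only [zero_smul, add_zero, sub_zero]
    rw [div_le_iff₀ ht.1]
    linarith
  linarith

theorem gradient_zero (hu : IsC2Plus u) : gradient u 0 = 0 := by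
  have h : IsLocalMin u 0 := Eventually.of_forall fun x => by
    rw [hu.map_zero]; exact hu.nonneg x
  unfold gradient
  rw [h.fderiv_eq_zero, _root_.map_zero]

theorem gradient_strictMono (hu : IsC2Plus u) {x y : E n} (hxy : x ≠ y) :
    0 < inner ℝ (gradient u y - gradient u x) (y - x) := by
  have hd : y - x ≠ 0 := sub_ne_zero.2 hxy.symm
  have hdiff : Differentiable ℝ (fderiv ℝ u) :=
    (hu.contDiff.fderiv_right (m := 1) (by norm_num)).differentiable (by norm_num)
  have h1 : ∀ t : ℝ, HasDerivAt (fun t : ℝ => fderiv ℝ u (x + t • (y - x)) (y - x))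
      (fderiv ℝ (fderiv ℝ u) (x + t • (y - x)) (y - x) (y - x)) t := fun t => by
    have h2 : HasDerivAt (fun t : ℝ => x + t • (y - x)) (y - x) t := by
      simpa using ((hasDerivAt_id t).smul_const (y - x)).const_add x
    have h3 := (hdiff (x + t • (y - x))).hasFDerivAt.comp_hasDerivAt t h2
    have h4 := h3.clm_apply (hasDerivAt_const t (y - x))
    simpa using h4
  have hmono : StrictMono fun t : ℝ => fderiv ℝ u (x + t • (y - x)) (y - x) :=
    strictMono_of_deriv_pos fun t => by
      rw [(h1 t).deriv]
      exact hu.hess_pos _ _ hd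
  have h2 := hmono (zero_lt_one (α := ℝ))
  simp only [zero_smul, add_zero, one_smul, add_sub_cancel] at h2
  rw [hu.fderiv_apply, hu.fderiv_apply] at h2
  rw [inner_sub_left]
  linarith

/-! ### The minimum point in a fibre of a projection -/

/-- Coercivity gives a minimum on the fibre, and stationarity along `Hᗮ` puts the gradient into `H`.
Both conditions are phrased by the projection alone, as closed conditions, so that they survive
limits of projections. -/
theorem exists_minPt (hu : IsC2Plus u) (H : Submodule ℝ (E n)) (x : E n) :
    ∃ w, H.starProjection w = H.starProjection x ∧
      H.starProjection (gradient u w) = gradient u w := by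
  have hc : Continuous fun z : Hᗮ => u (x + z) := hu.continuous.comp (by fun_prop)
  obtain ⟨B, hB⟩ := hu.superlinear 1
  have ht : Tendsto (fun z : Hᗮ => u (x + z)) (cocompact Hᗮ) atTop := by
    refine tendsto_atTop_mono (f := fun z : Hᗮ => ‖z‖ + (-‖x‖ - B)) (fun z => ?_) ?_
    · have h1 := hB (x + z)
      have h2 : ‖z‖ ≤ ‖x + z‖ + ‖x‖ := by
        have := norm_sub_le (x + (z : E n)) x
        rw [add_sub_cancel_left] at this
        exact this
      linarith
    · exact tendsto_atTop_add_const_right _ _ (tendsto_norm_cocompact_atTop (E := Hᗮ))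
  obtain ⟨z, hz⟩ := hc.exists_forall_le ht
  refine ⟨x + z, ?_, ?_⟩
  · rw [map_add, (Submodule.starProjection_apply_eq_zero_iff H).2 z.2, add_zero]
  · rw [Submodule.starProjection_eq_self_iff]
    suffices h : gradient u (x + z) ∈ Hᗮᗮ by rwa [Submodule.orthogonal_orthogonal] at h
    rw [Submodule.mem_orthogonal]
    intro d hd
    have h1 := hu.hasDerivAt_line (x + z) d 0
    simp only [zero_smul, add_zero] at h1
    have hmin : IsLocalMin (fun t : ℝ => u (x + z + t • d)) 0 := by
      refine Eventually.of_forall fun t => ?_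
      have := hz (z + t • ⟨d, hd⟩)
      simpa [add_assoc] using this
    rw [real_inner_comm]
    exact hmin.hasDerivAt_eq_zero h1

end IsC2Plus

/-- The point where `u` attains its minimum over the fibre of the projection `P` through `x`. -/
def minPt {n : ℕ} (u : E n → ℝ) (P : E n →L[ℝ] E n) (x : E n) : E n :=
  Classical.epsilon fun w => P w = P x ∧ P (gradient u w) = gradient u w

namespace IsC2Plus

variable {n : ℕ} {u : E n → ℝ}

theorem minPt_spec (hu : IsC2Plus u) (H : Submodule ℝ (E n)) (x : E n) :
    H.starProjection (minPt u H.starProjection x) = H.starProjection x ∧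
      H.starProjection (gradient u (minPt u H.starProjection x)) =
        gradient u (minPt u H.starProjection x) :=
  Classical.epsilon_spec (hu.exists_minPt H x)

theorem gradient_minPt_mem (hu : IsC2Plus u) (H : Submodule ℝ (E n)) (x : E n) :
    gradient u (minPt u H.starProjection x) ∈ H :=
  Submodule.starProjection_eq_self_iff.1 (hu.minPt_spec H x).2

theorem minPt_sub_mem (hu : IsC2Plus u) (H : Submodule ℝ (E n)) (x : E n) :
    minPt u H.starProjection x - x ∈ Hᗮ := by
  rw [← Submodule.starProjection_apply_eq_zero_iff, map_sub, (hu.minPt_spec H x).1, sub_self]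

/-- Two such points differ by a vector of `Hᗮ` and their gradients by a vector of `H`, which
contradicts strict monotonicity of the gradient. -/
theorem minPt_unique (hu : IsC2Plus u) (H : Submodule ℝ (E n)) (x : E n) {w : E n}
    (h1 : H.starProjection w = H.starProjection x)
    (h2 : H.starProjection (gradient u w) = gradient u w) : w = minPt u H.starProjection x := by
  by_contra hne
  refine (hu.gradient_strictMono hne).ne' ?_
  refine Submodule.inner_right_of_mem_orthogonal (K := H) ?_ ?_
  · exact H.sub_mem (hu.gradient_minPt_mem H x) (Submodule.starProjection_eq_self_iff.1 h2)
  · rw [← Submodule.starProjection_apply_eq_zero_iff, map_sub, (hu.minPt_spec H x).1, h1, sub_self]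

/-- The tangent plane of `u` at the minimum point has slope in `H`, so it is constant on fibres and
supports `u_H` from below. -/
theorem minPt_add_le (hu : IsC2Plus u) (H : Submodule ℝ (E n)) (x : E n) {y z : E n} (hz : z ∈ Hᗮ) :
    u (minPt u H.starProjection x) +
      inner ℝ (gradient u (minPt u H.starProjection x)) (y - x) ≤ u (y + z) := by
  have h1 := hu.gradient_le (minPt u H.starProjection x) (y + z)
  have h2 : y + z - minPt u H.starProjection x = (y - x) + (z - (minPt u H.starProjection x - x)) := by
    abel
  rw [h2, inner_add_right, Submodule.inner_right_of_mem_orthogonal (hu.gradient_minPt_mem H x)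
    (Hᗮ.sub_mem hz (hu.minPt_sub_mem H x)), add_zero] at h1
  exact h1

theorem minPt_le (hu : IsC2Plus u) (H : Submodule ℝ (E n)) (x : E n) {z : E n} (hz : z ∈ Hᗮ) :
    u (minPt u H.starProjection x) ≤ u (x + z) := by
  simpa using hu.minPt_add_le H x (y := x) hz

theorem norm_le_norm_minPt (hu : IsC2Plus u) (H : Submodule ℝ (E n)) (x : H) :
    ‖x‖ ≤ ‖minPt u H.starProjection x‖ := by
  have h1 := (hu.minPt_spec H x).1
  rw [Submodule.starProjection_eq_self_iff.2 x.2] at h1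
  calc ‖x‖ = ‖(x : E n)‖ := rfl
    _ = ‖H.starProjection (minPt u H.starProjection x)‖ := by rw [h1]
    _ ≤ _ := H.norm_starProjection_apply_le _

theorem projInf_eq (hu : IsC2Plus u) (H : Submodule ℝ (E n)) (x : H) :
    projInf (fun x => (u x : EReal)) H x = (u (minPt u H.starProjection x) : EReal) := by
  refine le_antisymm ?_ (le_iInf fun z => ?_)
  · refine (iInf_le _ ⟨_, hu.minPt_sub_mem H x⟩).trans (le_of_eq ?_)
    simp
  · exact EReal.coe_le_coe_iff.2 (hu.minPt_le H x z.2)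

/-- Envelope argument: the remainder of `u_H` at `x` is nonnegative by the supporting plane, and at
most the remainder of `u` at `w`, because `w + (z - x)` is a competitor in the fibre over `z`. No
differentiability of the minimum point is needed. -/
theorem gradient_projInf (hu : IsC2Plus u) (H : Submodule ℝ (E n)) (x : H) :
    ((gradient (fun z : H => (projInf (fun x => (u x : EReal)) H z).toReal) x : H) : E n) =
      gradient u (minPt u H.starProjection x) := by
  simp only [hu.projInf_eq, EReal.toReal_coe]
  set w := minPt u H.starProjection x with hw
  have h1 : HasGradientAt (fun z : H => u (minPt u H.starProjection z))
      ⟨gradient u w, hu.gradient_minPt_mem H x⟩ x := by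
    rw [hasGradientAt_iff_isLittleO]
    have h2 := (hasGradientAt_iff_isLittleO.1 (hu.hasGradientAt w))
    have h3 : Tendsto (fun z : H => w + ((z : E n) - x)) (𝓝 x) (𝓝 w) := by
      have : Continuous fun z : H => w + ((z : E n) - x) := by fun_prop
      simpa using this.tendsto x
    have h4 := h2.comp_tendsto h3
    refine Asymptotics.IsBigO.trans_isLittleO ?_ (h4.trans_isBigO ?_)
    · refine Asymptotics.isBigO_of_le _ fun z => ?_
      have h5 := hu.minPt_add_le H x (y := z) (hu.minPt_sub_mem H z)
      have h6 := hu.minPt_le H z (hu.minPt_sub_mem H x)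
      rw [add_sub_cancel, ← hw] at h5
      have h7 : (z : E n) + (minPt u H.starProjection x - x) = w + (z - x) := by
        rw [hw]; abel
      rw [h7] at h6
      simp only [Function.comp_def, add_sub_cancel_left]
      rw [Submodule.coe_inner]
      simp only [Submodule.coe_sub]
      rw [Real.norm_of_nonneg (by linarith), Real.norm_of_nonneg (by linarith)]
      linarith
    · refine Asymptotics.isBigO_of_le _ fun z => ?_
      simp
  rw [h1.gradient]

/-! ### Measurable dependence of the minimum point on the projection -/

end IsC2Plus

/-- The orthogonal projections of `ℝⁿ`. -/
def projSet (n : ℕ) : Set (E n →L[ℝ] E n) :=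
  {P | P ∘L P = P ∧ ContinuousLinearMap.adjoint P = P}

theorem isClosed_projSet (n : ℕ) : IsClosed (projSet n) := by
  refine IsClosed.inter (isClosed_eq ?_ continuous_id) (isClosed_eq ?_ continuous_id)
  · exact continuous_id.clm_comp continuous_id
  · exact ContinuousLinearMap.adjoint.continuous

theorem starProjection_mem_projSet {n : ℕ} (H : Submodule ℝ (E n)) :
    H.starProjection ∈ projSet n := by
  refine ⟨H.isIdempotentElem_starProjection, ?_⟩
  symm
  rw [ContinuousLinearMap.eq_adjoint_iff]
  exact fun x y => H.inner_starProjection_left_eq_right x y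

theorem exists_eq_starProjection {n : ℕ} {P : E n →L[ℝ] E n} (hP : P ∈ projSet n) :
    ∃ H : Submodule ℝ (E n), P = H.starProjection := by
  refine ⟨LinearMap.range P.toLinearMap, ?_⟩
  ext1 x
  symm
  refine Submodule.eq_starProjection_of_mem_orthogonal ⟨x, rfl⟩ ?_
  rw [Submodule.mem_orthogonal]
  rintro _ ⟨z, rfl⟩
  change inner ℝ (P z) (x - P x) = 0
  have h1 : P (P x) = P x := congrArg (fun L => L x) hP.1
  rw [← ContinuousLinearMap.adjoint_inner_right, hP.2, map_sub, h1, sub_self, inner_zero_right]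

namespace IsC2Plus

variable {n : ℕ} {u : E n → ℝ}

/-- Minimum points stay in a fixed ball since their value is at most `u(x)`; the defining conditions
are closed, and they determine the limit uniquely. -/
theorem continuousOn_minPt (hu : IsC2Plus u) :
    ContinuousOn (fun q : (E n →L[ℝ] E n) × E n => minPt u q.1 q.2) (projSet n ×ˢ Set.univ) := by
  rintro ⟨P, x⟩ ⟨hP, -⟩
  have hspec : ∀ q ∈ projSet n ×ˢ (Set.univ : Set (E n)), q.1 (minPt u q.1 q.2) = q.1 q.2 ∧
      q.1 (gradient u (minPt u q.1 q.2)) = gradient u (minPt u q.1 q.2) ∧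
      u (minPt u q.1 q.2) ≤ u q.2 := by
    rintro ⟨Q, y⟩ ⟨hQ, -⟩
    obtain ⟨H, rfl⟩ := exists_eq_starProjection hQ
    exact ⟨(hu.minPt_spec H y).1, (hu.minPt_spec H y).2, by
      simpa using hu.minPt_le H y Hᗮ.zero_mem⟩
  obtain ⟨B, hB⟩ := hu.superlinear 1
  refine (isCompact_closedBall (0 : E n) (u x + 1 + B)).tendsto_nhds_of_unique_mapClusterPt ?_ ?_
  · have h1 : ∀ᶠ q : (E n →L[ℝ] E n) × E n in 𝓝[projSet n ×ˢ Set.univ] (P, x),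
        u q.2 < u x + 1 :=
      nhdsWithin_le_nhds ((hu.continuous.comp continuous_snd).tendsto (P, x)
        |>.eventually_lt_const (by simp))
    filter_upwards [h1, self_mem_nhdsWithin] with q hq hqs
    rw [mem_closedBall_zero_iff]
    linarith [(hspec q hqs).2.2, hB (minPt u q.1 q.2)]
  · intro v _ hv
    rw [mapClusterPt_iff_ultrafilter] at hv
    obtain ⟨U, hU, hUv⟩ := hv
    have hlim : Tendsto (fun q : (E n →L[ℝ] E n) × E n => (q, minPt u q.1 q.2)) U
        (𝓝 ((P, x), v)) :=
      Tendsto.prodMk_nhds (Filter.tendsto_id.mono_left (hU.trans nhdsWithin_le_nhds)) hUv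
    have hclosed : IsClosed {z : ((E n →L[ℝ] E n) × E n) × E n |
        z.1.1 z.2 = z.1.1 z.1.2 ∧ z.1.1 (gradient u z.2) = gradient u z.2} := by
      have hg : Continuous fun z : ((E n →L[ℝ] E n) × E n) × E n => gradient u z.2 :=
        hu.continuous_gradient.comp continuous_snd
      exact (isClosed_eq (by fun_prop) (by fun_prop)).inter
        (isClosed_eq ((continuous_fst.comp continuous_fst).clm_apply hg) hg)
    have hmem := hclosed.mem_of_tendsto hlim (by
      have : projSet n ×ˢ (Set.univ : Set (E n)) ∈ (U : Filter _) := hU self_mem_nhdsWithin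
      filter_upwards [this] with q hq
      exact ⟨(hspec q hq).1, (hspec q hq).2.1⟩)
    obtain ⟨H, rfl⟩ := exists_eq_starProjection hP
    exact hu.minPt_unique H x hmem.1 hmem.2

-- Off the closed set of projections `minPt` is an arbitrary choice, so it is replaced there by a
-- constant.
open Classical in
theorem isMeasFamily_minPt (hu : IsC2Plus u) {f : E n → ℝ} (hf : Measurable f) :
    IsMeasFamily fun (H : Submodule ℝ (E n)) (x : H) => f (minPt u H.starProjection x) := by
  refine ⟨fun q => f ((projSet n ×ˢ Set.univ).piecewise
    (fun q : (E n →L[ℝ] E n) × E n => minPt u q.1 q.2) (fun _ => 0) q), ?_, fun H x => ?_⟩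
  · have hS : MeasurableSet (projSet n ×ˢ (Set.univ : Set (E n))) :=
      ((isClosed_projSet n).prod isClosed_univ).measurableSet
    exact hf.comp (hu.continuousOn_minPt.measurable_piecewise continuousOn_const hS)
  · beta_reduce
    rw [Set.piecewise_eq_of_mem]
    exact ⟨starProjection_mem_projSet H, trivial⟩

end IsC2Plus

/-! ### The Legendre transform of real functions -/

section LegendreReal

variable {n : ℕ} {f : E n → ℝ}

/-- The Legendre transform of a real function. -/
def legendreReal (f : E n → ℝ) (y : E n) : ℝ := ⨆ x, (inner ℝ y x - f x)

/-- The Legendre transform of `f` is finite. -/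
def LegendreBdd (f : E n → ℝ) : Prop := ∀ y, BddAbove (Set.range fun x => inner ℝ y x - f x)

theorem le_legendreReal (hf : LegendreBdd f) (y x : E n) :
    inner ℝ y x - f x ≤ legendreReal f y := le_ciSup (hf y) x

theorem legendreReal_le {y : E n} {c : ℝ} (h : ∀ x, inner ℝ y x - f x ≤ c) :
    legendreReal f y ≤ c := ciSup_le h

theorem legendre_coe (hf : LegendreBdd f) (y : E n) :
    legendre (fun x => (f x : EReal)) y = (legendreReal f y : EReal) := by
  unfold legendre
  have hle : ∀ x, (((inner ℝ y x : ℝ) : EReal) - f x) ≤ (legendreReal f y : EReal) := fun x => by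
    exact_mod_cast le_legendreReal hf y x
  refine le_antisymm (iSup_le hle) ?_
  set L : EReal := ⨆ x, (((inner ℝ y x : ℝ) : EReal) - f x) with hL
  have hge : ∀ x, ((inner ℝ y x - f x : ℝ) : EReal) ≤ L := fun x => by
    rw [EReal.coe_sub]
    exact le_iSup (fun x => (((inner ℝ y x : ℝ) : EReal) - f x)) x
  have hbot : L ≠ ⊥ := fun h => by
    have := hge 0
    rw [h, le_bot_iff] at this
    exact EReal.coe_ne_bot _ this
  have htop : L ≠ ⊤ := fun h => by
    have := iSup_le hle
    rw [← hL, h, top_le_iff] at this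
    exact EReal.coe_ne_top _ this
  lift L to ℝ using ⟨htop, hbot⟩ with l
  rw [EReal.coe_le_coe_iff]
  exact legendreReal_le fun x => by exact_mod_cast hge x

theorem convexOn_legendreReal (hf : LegendreBdd f) : ConvexOn ℝ Set.univ (legendreReal f) := by
  refine ⟨convex_univ, fun y _ z _ a b ha hb hab => legendreReal_le fun x => ?_⟩
  rw [inner_add_left, inner_smul_left, inner_smul_left]
  have h1 := mul_le_mul_of_nonneg_left (le_legendreReal hf y x) ha
  have h2 := mul_le_mul_of_nonneg_left (le_legendreReal hf z x) hb
  have h3 : f x = a * f x + b * f x := by rw [← add_mul, hab, one_mul]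
  simp only [smul_eq_mul, conj_trivial]
  linarith

theorem continuous_legendreReal (hf : LegendreBdd f) : Continuous (legendreReal f) := by
  rw [← continuousOn_univ]
  exact (convexOn_legendreReal hf).continuousOn isOpen_univ

/-- For `y ∈ H` the linear form `⟨y, ·⟩` is constant on the fibres of the projection, so the
supremum may be taken fibre by fibre. Finiteness of the value at `y` keeps the extended arithmetic
free of `∞ - ∞`. -/
theorem legendre_projInf {v : E n → EReal} {H : Submodule ℝ (E n)} {y : H} {c : ℝ}
    (h : legendre v (y : E n) = c) : legendre (projInf v H) y = c := by
  refine le_antisymm (iSup_le fun x => ?_) ?_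
  · rw [EReal.sub_le_iff_le_add (Or.inr (EReal.coe_ne_top c)) (Or.inr (EReal.coe_ne_bot c)),
      add_comm, ← EReal.sub_le_iff_le_add (Or.inl (EReal.coe_ne_bot c))
        (Or.inl (EReal.coe_ne_top c))]
    refine le_iInf fun z => ?_
    rw [EReal.sub_le_iff_le_add (Or.inl (EReal.coe_ne_bot c)) (Or.inl (EReal.coe_ne_top c)),
      add_comm, ← EReal.sub_le_iff_le_add (Or.inr (EReal.coe_ne_top c))
        (Or.inr (EReal.coe_ne_bot c)), ← h]
    have h1 : inner ℝ y x = inner ℝ (y : E n) ((x : E n) + z) := by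
      rw [inner_add_right, Submodule.inner_right_of_mem_orthogonal y.2 z.2, add_zero]
      rfl
    rw [h1]
    exact le_iSup (fun w : E n => (((inner ℝ (y : E n) w : ℝ) : EReal) - v w)) _
  · rw [← h]
    refine iSup_le fun w => ?_
    have hx := H.starProjection_apply_mem w
    have h1 : inner ℝ (y : E n) w = inner ℝ y (⟨H.starProjection w, hx⟩ : H) := by
      have h2 : inner ℝ (y : E n) (w - H.starProjection w) = 0 :=
        Submodule.inner_right_of_mem_orthogonal y.2 (H.sub_starProjection_mem_orthogonal w)
      rw [inner_sub_right] at h2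
      rw [Submodule.coe_inner]
      linarith
    rw [h1]
    refine le_trans ?_ (le_iSup (fun x : H => (((inner ℝ y x : ℝ) : EReal) - projInf v H x))
      ⟨H.starProjection w, hx⟩)
    refine EReal.sub_le_sub le_rfl ?_
    refine (iInf_le _ ⟨_, H.sub_starProjection_mem_orthogonal w⟩).trans (le_of_eq ?_)
    simp

end LegendreReal

namespace IsC2Plus

variable {n : ℕ} {u : E n → ℝ}

theorem legendreBdd (hu : IsC2Plus u) : LegendreBdd u := by
  intro y
  obtain ⟨B, hB⟩ := hu.superlinear ‖y‖
  refine ⟨B, ?_⟩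
  rintro _ ⟨x, rfl⟩
  have h1 := real_inner_le_norm y x
  have h2 := hB x
  simp only
  linarith

theorem legendreReal_gradient (hu : IsC2Plus u) (w : E n) :
    legendreReal u (gradient u w) = inner ℝ (gradient u w) w - u w := by
  refine le_antisymm (legendreReal_le fun x => ?_) (le_legendreReal hu.legendreBdd _ _)
  have h := hu.gradient_le w x
  rw [inner_sub_right] at h
  linarith

theorem legendreReal_nonneg (hu : IsC2Plus u) (y : E n) : 0 ≤ legendreReal u y := by
  simpa [hu.map_zero] using le_legendreReal hu.legendreBdd y 0

theorem legendreReal_zero (hu : IsC2Plus u) : legendreReal u 0 = 0 := by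
  have := hu.legendreReal_gradient 0
  simpa [hu.gradient_zero, hu.map_zero] using this

end IsC2Plus

/-! ### Comparison of `ψ` with the conjugate of `u` -/

theorem exists_quadratic_bound {n : ℕ} {f : E n → ℝ} (hf : ContDiff ℝ 2 f) (h0 : ∀ x, 0 ≤ f x)
    (hz : f 0 = 0) : ∃ D > 0, ∃ δ > 0, ∀ x, ‖x‖ ≤ δ → f x ≤ D * ‖x‖ ^ 2 := by
  have hmin : IsLocalMin f 0 := Eventually.of_forall fun x => by rw [hz]; exact h0 x
  obtain ⟨K, t, ht, hK⟩ := (hf.fderiv_right (m := 1) (by norm_num)).contDiffAt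
    (x := (0 : E n)).exists_lipschitzOnWith
  obtain ⟨δ, hδ, hδt⟩ := Metric.nhds_basis_closedBall.mem_iff.1 ht
  refine ⟨K + 1, by positivity, δ, hδ, fun x hx => ?_⟩
  -- The derivative vanishes at the minimum `0` and is Lipschitz near it.
  have hd : ∀ y ∈ Metric.closedBall (0 : E n) ‖x‖, ‖fderiv ℝ f y‖ ≤ K * ‖x‖ := fun y hy => by
    rw [mem_closedBall_zero_iff] at hy
    have h1 := hK.dist_le_mul y (hδt (by rw [mem_closedBall_zero_iff]; exact hy.trans hx)) 0
      (hδt (Metric.mem_closedBall_self hδ.le))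
    rw [hmin.fderiv_eq_zero, dist_zero_right, dist_zero_right] at h1
    exact h1.trans (mul_le_mul_of_nonneg_left hy K.2)
  have h2 := (convex_closedBall (0 : E n) ‖x‖).norm_image_sub_le_of_norm_fderiv_le
    (fun y _ => (hf.differentiable (by norm_num)) y) hd
    (Metric.mem_closedBall_self (norm_nonneg x)) (by simp : x ∈ Metric.closedBall (0 : E n) ‖x‖)
  rw [hz, sub_zero, sub_zero, Real.norm_of_nonneg (h0 x)] at h2
  nlinarith [sq_nonneg ‖x‖]

/-- The conjugate is tested at the point of length `r = min δ (‖y‖ / (2D))` in the direction of `y`;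
there the quadratic bound for `u` costs at most half of the gain `r ‖y‖`. The result is quadratic
for small `y` and linear for large `y`. -/
theorem IsC2Plus.exists_le_legendreReal {n : ℕ} {u : E n → ℝ} (hu : IsC2Plus u) :
    ∃ D > 0, ∃ δ > 0, ∀ y, ‖y‖ / 2 * min δ (‖y‖ / (2 * D)) ≤ legendreReal u y := by
  obtain ⟨D, hD, δ, hδ, h⟩ := exists_quadratic_bound hu.contDiff hu.nonneg hu.map_zero
  refine ⟨D, hD, δ, hδ, fun y => ?_⟩
  rcases eq_or_ne y 0 with rfl | hy
  · simpa using hu.legendreReal_nonneg 0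
  have hy0 : 0 < ‖y‖ := norm_pos_iff.2 hy
  set r := min δ (‖y‖ / (2 * D)) with hr
  have hr0 : 0 < r := lt_min hδ (by positivity)
  have h1 := le_legendreReal hu.legendreBdd y ((r / ‖y‖) • y)
  have h2 : ‖(r / ‖y‖) • y‖ = r := by
    rw [norm_smul, Real.norm_of_nonneg (by positivity)]
    field_simp
  have h3 := h ((r / ‖y‖) • y) (by rw [h2]; exact min_le_left _ _)
  rw [h2] at h3
  rw [inner_smul_right, real_inner_self_eq_norm_sq] at h1
  have h4 : r / ‖y‖ * ‖y‖ ^ 2 = r * ‖y‖ := by field_simp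
  have h5 : D * r ≤ ‖y‖ / 2 := by
    have := min_le_right δ (‖y‖ / (2 * D))
    rw [← hr, le_div_iff₀ (by positivity)] at this
    linarith
  nlinarith

theorem IsC2Plus.eq_zero_of_legendreReal {n : ℕ} {u : E n → ℝ} (hu : IsC2Plus u) {y : E n}
    (hy : legendreReal u y = 0) : y = 0 := by
  obtain ⟨D, hD, δ, hδ, h⟩ := hu.exists_le_legendreReal
  by_contra hne
  have hy0 : 0 < ‖y‖ := norm_pos_iff.2 hne
  have h1 := h y
  have : 0 < ‖y‖ / 2 * min δ (‖y‖ / (2 * D)) :=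
    mul_pos (by positivity) (lt_min hδ (by positivity))
  linarith

/-- Near the origin `ψ` is at most and the conjugate at least quadratic; farther out `ψ` is bounded
and the conjugate is bounded away from `0`. -/
theorem IsC2Plus.exists_le_mul_legendreReal {n : ℕ} {u : E n → ℝ} (hu : IsC2Plus u) {ψ : E n → ℝ}
    (hψ : ContDiff ℝ ∞ ψ) (hψc : HasCompactSupport ψ) (hψ0 : ∀ y, 0 ≤ ψ y) (hψo : ψ 0 = 0) :
    ∃ C > 0, ∀ y, ψ y ≤ C * legendreReal u y := by
  obtain ⟨D, hD, δ, hδ, h⟩ := hu.exists_le_legendreReal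
  obtain ⟨A, hA, η, hη, hq⟩ := exists_quadratic_bound (contDiff_infty.1 hψ 2) hψ0 hψo
  obtain ⟨M, hM⟩ := hψc.exists_bound_of_continuous hψ.continuous
  have hM' : ∀ y, ψ y ≤ M := fun y => (le_abs_self _).trans (hM y)
  have hM0 : 0 ≤ M := (hψ0 0).trans (hM' 0)
  set m := min η δ with hm
  have hm0 : 0 < m := lt_min hη hδ
  set c := min m (m / (2 * D)) with hc
  have hc0 : 0 < c := lt_min hm0 (by positivity)
  -- The first summand serves `‖y‖ ≤ m`, the second `‖y‖ ≥ m`.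
  refine ⟨(A + 1) / (min (1 / (4 * D)) (δ / (2 * m))) + 2 * M / (m * c), ?_, fun y => ?_⟩
  · have : 0 < min (1 / (4 * D)) (δ / (2 * m)) := lt_min (by positivity) (by positivity)
    positivity
  have hκ' : 0 < min (1 / (4 * D)) (δ / (2 * m)) := lt_min (by positivity) (by positivity)
  set κ' := min (1 / (4 * D)) (δ / (2 * m)) with hκ'd
  have hφ := hu.legendreReal_nonneg y
  rw [add_mul]
  rcases le_total ‖y‖ m with hy | hy
  · have h1 := hq y (hy.trans (min_le_left _ _))
    have h2 : κ' * ‖y‖ ^ 2 ≤ legendreReal u y := by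
      refine le_trans ?_ (h y)
      rcases le_total δ (‖y‖ / (2 * D)) with h3 | h3
      · rw [min_eq_left h3]
        have h4 : κ' ≤ δ / (2 * m) := min_le_right _ _
        have h5 : δ / (2 * m) * ‖y‖ ^ 2 ≤ ‖y‖ / 2 * δ := by
          rw [div_mul_eq_mul_div, div_le_iff₀ (by positivity)]
          nlinarith [mul_nonneg hδ.le (norm_nonneg y), norm_nonneg y]
        nlinarith [sq_nonneg ‖y‖]
      · rw [min_eq_right h3]
        have h4 : κ' ≤ 1 / (4 * D) := min_le_left _ _
        have h5 : ‖y‖ / 2 * (‖y‖ / (2 * D)) = 1 / (4 * D) * ‖y‖ ^ 2 := by field_simp; ring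
        rw [h5]
        exact mul_le_mul_of_nonneg_right h4 (sq_nonneg _)
    have h3 : ‖y‖ ^ 2 ≤ legendreReal u y / κ' := by rw [le_div_iff₀ hκ']; linarith
    have h4 : (A + 1) / κ' * legendreReal u y = (A + 1) * (legendreReal u y / κ') := by ring
    have h5 : 0 ≤ 2 * M / (m * c) * legendreReal u y := by positivity
    have h6 : A * ‖y‖ ^ 2 ≤ (A + 1) * (legendreReal u y / κ') :=
      mul_le_mul (by linarith) h3 (sq_nonneg _) (by linarith)
    linarith
  · have h1 : m / 2 * c ≤ legendreReal u y := by
      refine le_trans ?_ (h y)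
      refine mul_le_mul (by linarith) ?_ hc0.le (by positivity)
      refine le_min ((min_le_left _ _).trans (min_le_right _ _)) ((min_le_right _ _).trans ?_)
      exact div_le_div_of_nonneg_right hy (by positivity)
    have h2 : M ≤ 2 * M / (m * c) * legendreReal u y := by
      rw [div_mul_eq_mul_div, le_div_iff₀ (by positivity)]
      nlinarith
    have h3 : 0 ≤ (A + 1) / κ' * legendreReal u y := by positivity
    linarith [hM' y]

/-! ### The perturbation `(φ^p + ε ψ^p)^{1/p}` -/

section Scalar

variable {p a b : ℝ}

theorem le_rpow_add_rpow (hp : 1 ≤ p) (ha : 0 ≤ a) (hb : 0 ≤ b) {ε : ℝ} (hε : 0 ≤ ε) :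
    a ≤ (a ^ p + ε * b ^ p) ^ (1 / p) := by
  have h1 : a = (a ^ p) ^ (1 / p) := by
    rw [← Real.rpow_mul ha, mul_one_div_cancel (by linarith), Real.rpow_one]
  conv_lhs => rw [h1]
  refine Real.rpow_le_rpow (by positivity) ?_ (by positivity)
  have : 0 ≤ ε * b ^ p := by positivity
  linarith

/-- A chord inequality in `ε`: for `p ≥ 1` the power `1/p` is concave. -/
theorem rpow_add_rpow_concave (hp : 1 ≤ p) (ha : 0 ≤ a) (hb : 0 ≤ b) {ε ε₁ : ℝ} (hε : 0 ≤ ε)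
    (hε₁ : 0 < ε₁) (hle : ε ≤ ε₁) :
    a + ε / ε₁ * ((a ^ p + ε₁ * b ^ p) ^ (1 / p) - a) ≤ (a ^ p + ε * b ^ p) ^ (1 / p) := by
  have h1 : (a ^ p) ^ (1 / p) = a := by
    rw [← Real.rpow_mul ha, mul_one_div_cancel (by linarith), Real.rpow_one]
  have hx : a ^ p ∈ Set.Ici (0 : ℝ) := by simp only [Set.mem_Ici]; positivity
  have hy : a ^ p + ε₁ * b ^ p ∈ Set.Ici (0 : ℝ) := by simp only [Set.mem_Ici]; positivity
  have ht : 0 ≤ 1 - ε / ε₁ := by rw [sub_nonneg, div_le_one hε₁]; exact hle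
  have ht' : 0 ≤ ε / ε₁ := by positivity
  have h2 := (Real.concaveOn_rpow (p := 1 / p) (by positivity)
    (by rw [div_le_one (by linarith)]; exact hp)).2 hx hy ht ht' (by ring)
  simp only [smul_eq_mul] at h2
  rw [h1] at h2
  have h3 : (1 - ε / ε₁) * a ^ p + ε / ε₁ * (a ^ p + ε₁ * b ^ p) = a ^ p + ε * b ^ p := by
    field_simp
    ring
  rw [h3] at h2
  linarith

/-- If `a = 0 < b` and `p > 1`, the quotient `ε^(1/p-1) b` would diverge; `hab` excludes this, and
then `0 ^ p = 0` makes both sides vanish at `a = 0`. -/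
theorem tendsto_rpow_add_rpow (hp : 1 ≤ p) (ha : 0 ≤ a) (hab : a = 0 → b = 0) :
    Tendsto (fun ε : ℝ => ((a ^ p + ε * b ^ p) ^ (1 / p) - a) / ε) (𝓝[>] 0)
      (𝓝 (1 / p * b ^ p * a ^ (1 - p))) := by
  have hp0 : p ≠ 0 := by linarith
  rcases ha.eq_or_lt with h | h
  · have hb := hab h.symm
    subst h
    subst hb
    simp [Real.zero_rpow hp0, hp0]
  · have h1 : HasDerivAt (fun ε : ℝ => (a ^ p + ε * b ^ p) ^ (1 / p))
        (1 * b ^ p * (1 / p) * (a ^ p + 0 * b ^ p) ^ (1 / p - 1)) 0 :=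
      (((hasDerivAt_id (0 : ℝ)).mul_const (b ^ p)).const_add (a ^ p)).rpow_const
        (Or.inl (by simp only [id, zero_mul, add_zero]; positivity))
    have h2 := h1.hasDerivWithinAt (s := Set.Ioi 0)
    rw [hasDerivWithinAt_iff_tendsto_slope' (by simp)] at h2
    have h3 : (a ^ p) ^ (1 / p - 1) = a ^ (1 - p) := by
      rw [← Real.rpow_mul ha]
      congr 1
      field_simp
    have h4 : (a ^ p) ^ (1 / p) = a := by
      rw [← Real.rpow_mul ha, mul_one_div_cancel hp0, Real.rpow_one]
    rw [zero_mul, add_zero, h3, one_mul, mul_comm (b ^ p)] at h2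
    refine h2.congr fun ε => ?_
    rw [slope_def_field, zero_mul, add_zero, h4, sub_zero]

/-- By concavity the chord slopes decrease in `ε`, so each is at most the limit slope. -/
theorem rpow_add_rpow_le (hp : 1 ≤ p) (ha : 0 ≤ a) (hb : 0 ≤ b) (hab : a = 0 → b = 0) {ε : ℝ}
    (hε : 0 ≤ ε) : (a ^ p + ε * b ^ p) ^ (1 / p) ≤ a + ε * (1 / p * b ^ p * a ^ (1 - p)) := by
  rcases hε.eq_or_lt with rfl | hε
  · rw [zero_mul, zero_mul, add_zero, add_zero, ← Real.rpow_mul ha,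
      mul_one_div_cancel (by linarith), Real.rpow_one]
  have h1 : ((a ^ p + ε * b ^ p) ^ (1 / p) - a) / ε ≤ 1 / p * b ^ p * a ^ (1 - p) := by
    refine ge_of_tendsto (tendsto_rpow_add_rpow hp ha hab) ?_
    filter_upwards [Ioc_mem_nhdsGT hε] with t ht
    have h2 := rpow_add_rpow_concave hp ha hb ht.1.le hε ht.2
    rw [le_div_iff₀ ht.1]
    calc ((a ^ p + ε * b ^ p) ^ (1 / p) - a) / ε * t
        = t / ε * ((a ^ p + ε * b ^ p) ^ (1 / p) - a) := by ring
      _ ≤ _ := by linarith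
  rw [div_le_iff₀ hε] at h1
  linarith

end Scalar

section Perturbation

variable {n : ℕ} {p : ℝ} {u ψ : E n → ℝ}

/-- The perturbation `(φ^p + ε ψ^p)^{1/p}`. -/
def perturb (p : ℝ) (φ ψ : E n → ℝ) (ε : ℝ) (y : E n) : ℝ := (φ y ^ p + ε * ψ y ^ p) ^ (1 / p)

/-- The derivative of `(φ^p + ε ψ^p)^{1/p}` at `ε = 0`. -/
def perturbRate (p : ℝ) (φ ψ : E n → ℝ) (y : E n) : ℝ := 1 / p * ψ y ^ p * φ y ^ (1 - p)

theorem lpMean_coe (hp : 1 ≤ p) {φ : E n → ℝ} (hφ : ∀ y, 0 ≤ φ y) (hψ : ∀ y, 0 ≤ ψ y) {ε : ℝ}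
    (hε : 0 ≤ ε) (y : E n) :
    lpMean p 1 (fun y => (φ y : EReal)) ε (fun y => (ψ y : EReal)) y =
      (perturb p φ ψ ε y : EReal) := by
  have h1 : ∀ t : ℝ, (t : EReal).toENNReal = ENNReal.ofReal t := fun t => by
    rw [EReal.toENNReal_of_ne_top (EReal.coe_ne_top t), EReal.toReal_coe]
  have hp0 : 0 ≤ p := by linarith
  have h2 : 0 ≤ φ y ^ p := Real.rpow_nonneg (hφ y) p
  have h3 : 0 ≤ ψ y ^ p := Real.rpow_nonneg (hψ y) p
  unfold lpMean perturb
  rw [h1, h1, ENNReal.ofReal_rpow_of_nonneg (hφ y) hp0, ENNReal.ofReal_rpow_of_nonneg (hψ y) hp0,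
    ← ENNReal.ofReal_mul zero_le_one, ← ENNReal.ofReal_mul hε, one_mul,
    ← ENNReal.ofReal_add h2 (by positivity),
    ENNReal.ofReal_rpow_of_nonneg (by positivity) (by positivity), EReal.coe_ennreal_ofReal,
    max_eq_left (by positivity)]

theorem perturbRate_nonneg (hp : 1 ≤ p) (hu : IsC2Plus u) (hψ : ∀ y, 0 ≤ ψ y) (y : E n) :
    0 ≤ perturbRate p (legendreReal u) ψ y := by
  have h1 := hu.legendreReal_nonneg y
  have h2 := hψ y
  unfold perturbRate
  positivity

theorem perturbRate_eq_zero (hp : 1 ≤ p) {φ : E n → ℝ} {y : E n} (hy : ψ y = 0) :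
    perturbRate p φ ψ y = 0 := by
  unfold perturbRate
  rw [hy, Real.zero_rpow (by linarith)]
  simp

theorem le_perturb (hp : 1 ≤ p) (hu : IsC2Plus u) (hψ0 : ∀ y, 0 ≤ ψ y) {ε : ℝ} (hε : 0 ≤ ε)
    (y : E n) : legendreReal u y ≤ perturb p (legendreReal u) ψ ε y :=
  le_rpow_add_rpow hp (hu.legendreReal_nonneg y) (hψ0 y) hε

theorem IsC2Plus.psi_eq_zero (hu : IsC2Plus u) (hψo : ψ 0 = 0) (y : E n)
    (h : legendreReal u y = 0) : ψ y = 0 := by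
  rw [hu.eq_zero_of_legendreReal h, hψo]

theorem perturb_le (hp : 1 ≤ p) (hu : IsC2Plus u) (hψ0 : ∀ y, 0 ≤ ψ y) (hψo : ψ 0 = 0) {ε : ℝ}
    (hε : 0 ≤ ε) (y : E n) : perturb p (legendreReal u) ψ ε y ≤
      legendreReal u y + ε * perturbRate p (legendreReal u) ψ y :=
  rpow_add_rpow_le hp (hu.legendreReal_nonneg y) (hψ0 y) (hu.psi_eq_zero hψo y) hε

theorem inner_sub_legendreReal_le (hu : IsC2Plus u) (w y : E n) :
    inner ℝ w y - legendreReal u y ≤ u w := by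
  have := le_legendreReal hu.legendreBdd y w
  rw [real_inner_comm] at this
  linarith

theorem inner_sub_perturb_le (hp : 1 ≤ p) (hu : IsC2Plus u) (hψ0 : ∀ y, 0 ≤ ψ y) {ε : ℝ}
    (hε : 0 ≤ ε) (w y : E n) : inner ℝ w y - perturb p (legendreReal u) ψ ε y ≤ u w := by
  linarith [inner_sub_legendreReal_le hu w y, le_perturb hp hu hψ0 hε y]

theorem legendreBdd_perturb (hp : 1 ≤ p) (hu : IsC2Plus u) (hψ0 : ∀ y, 0 ≤ ψ y) {ε : ℝ}
    (hε : 0 ≤ ε) : LegendreBdd (perturb p (legendreReal u) ψ ε) := fun w =>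
  ⟨u w, by rintro _ ⟨y, rfl⟩; exact inner_sub_perturb_le hp hu hψ0 hε w y⟩

theorem legendreReal_perturb_le (hp : 1 ≤ p) (hu : IsC2Plus u) (hψ0 : ∀ y, 0 ≤ ψ y) {ε : ℝ}
    (hε : 0 ≤ ε) (w : E n) : legendreReal (perturb p (legendreReal u) ψ ε) w ≤ u w :=
  legendreReal_le (inner_sub_perturb_le hp hu hψ0 hε w)

theorem legendreReal_perturb_nonneg (hp : 1 ≤ p) (hu : IsC2Plus u) (hψ0 : ∀ y, 0 ≤ ψ y)
    (hψo : ψ 0 = 0) {ε : ℝ} (hε : 0 ≤ ε) (w : E n) :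
    0 ≤ legendreReal (perturb p (legendreReal u) ψ ε) w := by
  have h1 := le_legendreReal (legendreBdd_perturb hp hu hψ0 hε) w 0
  have h2 := perturb_le hp hu hψ0 hψo hε 0
  rw [perturbRate_eq_zero hp hψo, mul_zero, add_zero, hu.legendreReal_zero] at h2
  rw [inner_zero_right] at h1
  linarith

/-- The supremum is tested with `∇u(w)` only, where Young's inequality for `u` is an equality.
Allowing `w'` with `w' - w` orthogonal to the gradient gives the same bound on a whole fibre of the
projection. -/
theorem sub_le_legendreReal_perturb (hp : 1 ≤ p) (hu : IsC2Plus u) (hψ0 : ∀ y, 0 ≤ ψ y)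
    (hψo : ψ 0 = 0) {ε : ℝ} (hε : 0 ≤ ε) (w : E n) {w' : E n}
    (hw : inner ℝ (gradient u w) (w' - w) = 0) :
    u w - ε * perturbRate p (legendreReal u) ψ (gradient u w) ≤
      legendreReal (perturb p (legendreReal u) ψ ε) w' := by
  have h1 := le_legendreReal (legendreBdd_perturb hp hu hψ0 hε) w' (gradient u w)
  have h2 := perturb_le hp hu hψ0 hψo hε (gradient u w)
  have h3 := hu.legendreReal_gradient w
  rw [inner_sub_right] at hw
  rw [real_inner_comm] at h1
  linarith

/-- Differentiability of `u` at `w` isolates the maximiser `∇u(w)`: a step of length `r` from `w`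
towards `y - ∇u(w)` gains `r ‖y - ∇u(w)‖ ≥ rη` in Young's inequality and loses at most `rη/2` in the
linearisation. -/
theorem IsC2Plus.exists_gap (hu : IsC2Plus u) (w : E n) {η : ℝ} (hη : 0 < η) :
    ∃ c > 0, ∀ y, η ≤ ‖y - gradient u w‖ → inner ℝ w y - legendreReal u y ≤ u w - c := by
  have h1 := (hasGradientAt_iff_isLittleO.1 (hu.hasGradientAt w)).bound (half_pos hη)
  obtain ⟨r, hr, hrb⟩ := Metric.nhds_basis_closedBall.mem_iff.1 h1
  refine ⟨r * η / 2, by positivity, fun y hy => ?_⟩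
  set d := y - gradient u w with hd
  have hd0 : 0 < ‖d‖ := hη.trans_le hy
  have hv : ‖(r / ‖d‖) • d‖ = r := by
    rw [norm_smul, Real.norm_of_nonneg (by positivity)]
    field_simp
  have h2 : w + (r / ‖d‖) • d ∈ Metric.closedBall w r := by
    rw [mem_closedBall_iff_norm, add_sub_cancel_left, hv]
  have h3 := hrb h2
  simp only [Set.mem_ofPred_eq, add_sub_cancel_left, hv] at h3
  have h4 := (le_abs_self _).trans h3
  have h5 := le_legendreReal hu.legendreBdd y (w + (r / ‖d‖) • d)
  have h6 : inner ℝ y ((r / ‖d‖) • d) - inner ℝ (gradient u w) ((r / ‖d‖) • d) = r * ‖d‖ := by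
    rw [← inner_sub_left, ← hd, inner_smul_right, real_inner_self_eq_norm_sq]
    field_simp
  rw [inner_add_right, real_inner_comm w y] at h5
  have h7 := mul_le_mul_of_nonneg_left hy hr.le
  linarith

/-- Danskin's argument at the maximiser `y₀ = ∇u(w)`. One bound comes from testing with `y₀`. For
the other, slopes `y` far from `y₀` lose the fixed gap `c`, while near `y₀` concavity in `ε`
transfers a chord estimate at one `ε₁` to all smaller `ε`, uniformly in `y`. -/
theorem tendsto_legendreReal_perturb (hp : 1 ≤ p) (hu : IsC2Plus u) (hψ0 : ∀ y, 0 ≤ ψ y)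
    (hψo : ψ 0 = 0) (hψc : Continuous ψ) (w : E n) :
    Tendsto (fun ε => (legendreReal (perturb p (legendreReal u) ψ ε) w - u w) / ε) (𝓝[>] 0)
      (𝓝 (-perturbRate p (legendreReal u) ψ (gradient u w))) := by
  set y₀ := gradient u w with hy₀
  set h := perturbRate p (legendreReal u) ψ y₀ with hh
  have hφc : Continuous (legendreReal u) := continuous_legendreReal hu.legendreBdd
  rw [tendsto_order]
  constructor
  · intro a ha
    filter_upwards [self_mem_nhdsWithin] with ε hε
    have hε0 : (0 : ℝ) < ε := hε
    have h1 := sub_le_legendreReal_perturb hp hu hψ0 hψo hε0.le w (w' := w) (by simp)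
    rw [lt_div_iff₀ hε0]
    have h2 := mul_lt_mul_of_pos_right ha hε0
    rw [← hy₀, ← hh] at h1
    linarith
  · intro a ha
    -- Half of the distance from `-h` to `a`, so that the slope `-(h - δ)` still lies below `a`.
    set δ := (a + h) / 2 with hδ
    have hδ0 : 0 < δ := by rw [hδ]; linarith
    have h1 := tendsto_rpow_add_rpow hp (hu.legendreReal_nonneg y₀) (hu.psi_eq_zero hψo y₀)
    obtain ⟨ε₁, hε₁', hε₁⟩ := ((h1.eventually (lt_mem_nhds (by
      change h - δ < h; linarith))).and self_mem_nhdsWithin).exists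
    have hε₁0 : (0 : ℝ) < ε₁ := hε₁
    have hcont : Continuous fun y => perturb p (legendreReal u) ψ ε₁ y - legendreReal u y := by
      unfold perturb
      refine Continuous.sub (Continuous.rpow_const ?_ fun y => Or.inr (by positivity)) hφc
      exact (hφc.rpow_const fun y => Or.inr (by linarith)).add
        ((hψc.rpow_const fun y => Or.inr (by linarith)).const_mul ε₁)
    have h2 : ε₁ * (h - δ) < perturb p (legendreReal u) ψ ε₁ y₀ - legendreReal u y₀ := by
      rw [lt_div_iff₀ hε₁0] at hε₁'
      unfold perturb
      linarith
    have h3 := hcont.tendsto y₀ |>.eventually (lt_mem_nhds h2)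
    obtain ⟨η, hη, hηb⟩ := Metric.eventually_nhds_iff.1 h3
    obtain ⟨c, hc, hgap⟩ := hu.exists_gap w hη
    have hsmall : ∀ᶠ ε : ℝ in 𝓝[>] 0, ε * (h - δ) < c := by
      have : Tendsto (fun ε : ℝ => ε * (h - δ)) (𝓝[>] 0) (𝓝 (0 * (h - δ))) :=
        (tendsto_id.mul_const _).mono_left nhdsWithin_le_nhds
      rw [zero_mul] at this
      exact this.eventually (gt_mem_nhds hc)
    filter_upwards [Ioc_mem_nhdsGT hε₁0, hsmall] with ε hε hεc
    have hkey : legendreReal (perturb p (legendreReal u) ψ ε) w ≤ u w - ε * (h - δ) := by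
      refine legendreReal_le fun y => ?_
      rcases lt_or_ge ‖y - y₀‖ η with hy | hy
      · have h4 := hηb (by rwa [dist_eq_norm] : dist y y₀ < η)
        have h5 := rpow_add_rpow_concave hp (hu.legendreReal_nonneg y) (hψ0 y) hε.1.le hε₁0 hε.2
        have h6 : ε * (h - δ) ≤ ε / ε₁ * (perturb p (legendreReal u) ψ ε₁ y - legendreReal u y) := by
          rw [div_mul_eq_mul_div, le_div_iff₀ hε₁0]
          nlinarith [hε.1]
        have h7 := inner_sub_legendreReal_le hu w y
        change legendreReal u y + ε / ε₁ * (perturb p (legendreReal u) ψ ε₁ y - legendreReal u y) ≤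
          perturb p (legendreReal u) ψ ε y at h5
        linarith
      · have h4 := hgap y hy
        have h5 := le_perturb hp hu hψ0 hε.1.le y
        linarith
    rw [div_lt_iff₀ hε.1]
    have : -(h - δ) < a := by rw [hδ]; linarith
    have := mul_lt_mul_of_pos_right this hε.1
    linarith

/-- With `φ` the conjugate of `u`, `ψ^p φ^(1-p) = ψ (ψ/φ)^(p-1)`, where `ψ` is bounded and `ψ ≤ Cφ`.
-/
theorem exists_perturbRate_le (hp : 1 ≤ p) (hu : IsC2Plus u) (hψ : ContDiff ℝ ∞ ψ)
    (hψc : HasCompactSupport ψ) (hψ0 : ∀ y, 0 ≤ ψ y) (hψo : ψ 0 = 0) :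
    ∃ M > 0, ∀ y, perturbRate p (legendreReal u) ψ y ≤ M := by
  obtain ⟨C, hC, h⟩ := hu.exists_le_mul_legendreReal hψ hψc hψ0 hψo
  obtain ⟨M, hM⟩ := hψc.exists_bound_of_continuous hψ.continuous
  have hM' : ∀ y, ψ y ≤ M := fun y => (le_abs_self _).trans (hM y)
  have hM0 : 0 ≤ M := (hψ0 0).trans (hM' 0)
  refine ⟨1 / p * (M * C ^ (p - 1)) + 1, by positivity, fun y => ?_⟩
  rcases (hu.legendreReal_nonneg y).eq_or_lt with hy | hy
  · rw [perturbRate_eq_zero hp (hu.psi_eq_zero hψo y hy.symm)]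
    positivity
  · unfold perturbRate
    have h1 : ψ y ^ p * legendreReal u y ^ (1 - p) ≤ M * C ^ (p - 1) := by
      rcases (hψ0 y).eq_or_lt with h0 | h0
      · rw [← h0, Real.zero_rpow (by linarith), zero_mul]
        positivity
      have h2 : ψ y ^ p = ψ y * ψ y ^ (p - 1) := by
        rw [Real.rpow_sub h0, Real.rpow_one]
        field_simp
      have h3 : ψ y ^ (p - 1) ≤ C ^ (p - 1) * legendreReal u y ^ (p - 1) := by
        rw [← Real.mul_rpow hC.le hy.le]
        exact Real.rpow_le_rpow h0.le (h y) (by linarith)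
      have h4 : legendreReal u y ^ (p - 1) * legendreReal u y ^ (1 - p) = 1 := by
        rw [← Real.rpow_add hy]
        simp
      have h5 : 0 ≤ legendreReal u y ^ (1 - p) := Real.rpow_nonneg hy.le _
      calc ψ y ^ p * legendreReal u y ^ (1 - p)
          = ψ y * (ψ y ^ (p - 1) * legendreReal u y ^ (1 - p)) := by rw [h2]; ring
        _ ≤ M * (C ^ (p - 1) * legendreReal u y ^ (p - 1) * legendreReal u y ^ (1 - p)) := by
            refine mul_le_mul (hM' y) (mul_le_mul_of_nonneg_right h3 h5) (by positivity) hM0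
        _ = M * C ^ (p - 1) := by rw [mul_assoc (C ^ (p - 1)), h4, mul_one]
    have h6 : 0 ≤ 1 / p := by positivity
    rw [mul_assoc]
    linarith [mul_le_mul_of_nonneg_left h1 h6]

/-- A nonzero rate forces `‖∇u(w)‖ ≤ |R|`; then `0 ≤ ⟨∇u(w), w⟩ - u(w) ≤ |R| ‖w‖ - u(w)`, and growth
of `u` with slope `|R| + 1` bounds `‖w‖`. -/
theorem exists_perturbRate_support (hp : 1 ≤ p) (hu : IsC2Plus u) (hψc : HasCompactSupport ψ) :
    ∃ R > 0, ∀ w, R < ‖w‖ → perturbRate p (legendreReal u) ψ (gradient u w) = 0 := by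
  obtain ⟨R, hR⟩ := hψc.isCompact.isBounded.subset_closedBall 0
  obtain ⟨B, hB⟩ := hu.superlinear (|R| + 1)
  refine ⟨|B| + 1, by positivity, fun w hw => perturbRate_eq_zero hp ?_⟩
  by_contra hne
  have h1 := hR (subset_tsupport _ hne)
  rw [mem_closedBall_zero_iff] at h1
  have h2 := hu.legendreReal_gradient w
  have h3 := hu.legendreReal_nonneg (gradient u w)
  have h4 := real_inner_le_norm (gradient u w) w
  have h5 := mul_le_mul_of_nonneg_right (h1.trans (le_abs_self R)) (norm_nonneg w)
  have h6 := hB w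
  have h7 := le_abs_self B
  nlinarith

end Perturbation

/-! ### The functions `Ω_s` and `-Ω_s'` -/

section Omega

variable {s : ℝ}

/-- `Ω_s` on the reals. -/
def omegaR (s t : ℝ) : ℝ := omegaS s (t : EReal)

theorem omegaR_zero_left (t : ℝ) : omegaR 0 t = Real.exp (-t) := by simp [omegaR, omegaS]

theorem omegaR_of_ne (hs : s ≠ 0) (t : ℝ) : omegaR s t = max (1 - s * t) 0 ^ (1 / s) := by
  simp [omegaR, omegaS, hs]

theorem omegaR_of_pos (hs : s ≠ 0) {t : ℝ} (ht : 0 < 1 - s * t) :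
    omegaR s t = (1 - s * t) ^ (1 / s) := by
  rw [omegaR_of_ne hs, max_eq_left ht.le]

theorem omegaR_nonneg (s t : ℝ) : 0 ≤ omegaR s t := by
  rcases eq_or_ne s 0 with rfl | hs
  · rw [omegaR_zero_left]; positivity
  · rw [omegaR_of_ne hs]; positivity

theorem omegaR_pos {t : ℝ} (ht : 0 < 1 - s * t) : 0 < omegaR s t := by
  rcases eq_or_ne s 0 with rfl | hs
  · rw [omegaR_zero_left]; positivity
  · rw [omegaR_of_pos hs ht]; positivity

theorem omegaR_zero (s : ℝ) : omegaR s 0 = 1 := by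
  rcases eq_or_ne s 0 with rfl | hs
  · simp [omegaR_zero_left]
  · simp [omegaR_of_ne hs]

theorem omegaR_eq_zero (hs : 0 < s) {t : ℝ} (ht : 1 / s ≤ t) : omegaR s t = 0 := by
  have h : 1 - s * t ≤ 0 := by
    rw [div_le_iff₀ hs] at ht
    linarith
  rw [omegaR_of_ne hs.ne', max_eq_right h, Real.zero_rpow (by positivity)]

theorem omegaR_anti {a b : ℝ} (ha : 0 ≤ a) (hab : a ≤ b) : omegaR s b ≤ omegaR s a := by
  rcases lt_trichotomy s 0 with hs | rfl | hs
  · have h1 : 0 < 1 - s * a := by nlinarith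
    have h2 : 0 < 1 - s * b := by nlinarith
    rw [omegaR_of_pos hs.ne h1, omegaR_of_pos hs.ne h2]
    exact Real.rpow_le_rpow_of_nonpos h1 (by nlinarith) (one_div_nonpos.2 hs.le)
  · rw [omegaR_zero_left, omegaR_zero_left]
    exact Real.exp_le_exp.2 (by linarith)
  · rw [omegaR_of_ne hs.ne', omegaR_of_ne hs.ne']
    exact Real.rpow_le_rpow (le_max_right _ _) (max_le_max (by nlinarith) le_rfl) (by positivity)

theorem omegaR_le_one {t : ℝ} (ht : 0 ≤ t) : omegaR s t ≤ 1 :=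
  (omegaR_anti le_rfl ht).trans (omegaR_zero s).le

/-- The truncation matters for `s < 0`, where `Ω_s` blows up at the negative number `1/s`. -/
theorem continuous_omegaR_max (s : ℝ) : Continuous fun t => omegaR s (max t 0) := by
  rcases lt_trichotomy s 0 with hs | rfl | hs
  · simp only [omegaR_of_ne hs.ne]
    refine Continuous.rpow_const (by fun_prop) fun t => Or.inl ?_
    have : 0 ≤ max t 0 := le_max_right _ _
    have : 0 < 1 - s * max t 0 := by nlinarith
    rw [max_eq_left this.le]
    exact this.ne'
  · simp only [omegaR_zero_left]
    fun_prop
  · simp only [omegaR_of_ne hs.ne']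
    exact Continuous.rpow_const (by fun_prop) fun t => Or.inr (by positivity)

theorem continuous_omegaR_comp {X : Type*} [TopologicalSpace X] {b : X → ℝ} (hb : Continuous b)
    (h0 : ∀ x, 0 ≤ b x) : Continuous fun x => omegaR s (b x) := by
  have h := (continuous_omegaR_max s).comp hb
  simpa only [Function.comp_def, max_eq_left (h0 _)] using h

theorem measurable_omegaR_comp {X : Type*} [MeasurableSpace X] {b : X → ℝ} (hb : Measurable b)
    (h0 : ∀ x, 0 ≤ b x) : Measurable fun x => omegaR s (b x) := by
  have h := (continuous_omegaR_max s).measurable.comp hb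
  simpa only [Function.comp_def, max_eq_left (h0 _)] using h

theorem weightS_nonneg (s t : ℝ) : 0 ≤ weightS s t := by
  unfold weightS
  split_ifs <;> positivity

theorem weightS_eq_zero {t : ℝ} (h : 1 - s * t ≤ 0) : weightS s t = 0 := by
  have hs : s ≠ 0 := by
    rintro rfl
    linarith
  simp [weightS, hs, h.not_gt]

theorem weightS_of_pos (hs : s ≠ 0) {t : ℝ} (h : 0 < 1 - s * t) :
    weightS s t = (1 - s * t) ^ (1 / s - 1) := by
  simp [weightS, hs, h]

theorem measurable_weightS (s : ℝ) : Measurable (weightS s) := by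
  unfold weightS
  refine Measurable.ite (MeasurableSet.const _) (by fun_prop) (Measurable.ite ?_ ?_ measurable_const)
  · exact measurableSet_lt measurable_const (by fun_prop)
  · fun_prop

theorem hasDerivAt_omegaR {t : ℝ} (h : 0 < 1 - s * t) :
    HasDerivAt (omegaR s) (-weightS s t) t := by
  rcases eq_or_ne s 0 with rfl | hs
  · have h1 : omegaR 0 = fun t => Real.exp (-t) := funext omegaR_zero_left
    rw [h1]
    simpa [weightS] using (hasDerivAt_neg t).exp
  · have h1 : HasDerivAt (fun t : ℝ => 1 - s * t) (-s) t := by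
      simpa using ((hasDerivAt_id t).const_mul s).const_sub 1
    have h2 := h1.rpow_const (p := 1 / s) (Or.inl h.ne')
    rw [weightS_of_pos hs h]
    have h3 : -s * (1 / s) * (1 - s * t) ^ (1 / s - 1) = -(1 - s * t) ^ (1 / s - 1) := by
      field_simp
    rw [h3] at h2
    refine h2.congr_of_eventuallyEq ?_
    have hc : Continuous fun t : ℝ => 1 - s * t := by fun_prop
    filter_upwards [hc.tendsto t |>.eventually (lt_mem_nhds h)] with x hx
    exact omegaR_of_pos hs hx

theorem weightS_le_one (hs : s ≤ 1) {t : ℝ} (ht : 0 ≤ t) : weightS s t ≤ 1 := by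
  rcases le_or_gt (1 - s * t) 0 with h | h
  · rw [weightS_eq_zero h]; exact zero_le_one
  rcases lt_trichotomy s 0 with hs0 | rfl | hs0
  · rw [weightS_of_pos hs0.ne h]
    refine Real.rpow_le_one_of_one_le_of_nonpos (by nlinarith) ?_
    have := one_div_neg.2 hs0
    linarith
  · simpa [weightS] using ht
  · rw [weightS_of_pos hs0.ne' h]
    refine Real.rpow_le_one h.le (by nlinarith) ?_
    have := (one_le_div hs0).2 hs
    linarith

/-- For `s ≤ 1` the weight is at most 1; for `s > 1` it increases up to the edge `1/s`. -/
theorem weightS_le_max {t b : ℝ} (ht : 0 ≤ t) (htb : t ≤ b) (hb : 0 < 1 - s * b) :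
    weightS s t ≤ max 1 (weightS s b) := by
  rcases le_or_gt s 1 with hs | hs
  · exact (weightS_le_one hs ht).trans (le_max_left _ _)
  · have hs0 : s ≠ 0 := by linarith
    refine le_trans ?_ (le_max_right _ _)
    have h : 1 - s * b ≤ 1 - s * t := by nlinarith
    rw [weightS_of_pos hs0 hb, weightS_of_pos hs0 (hb.trans_le h)]
    refine Real.rpow_le_rpow_of_nonpos hb h ?_
    have := (div_le_one (by linarith : (0 : ℝ) < s)).2 hs.le
    linarith

theorem omegaR_sub_le {a b : ℝ} (ha : 0 ≤ a) (hab : a ≤ b) (hb : 0 < 1 - s * b) :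
    omegaR s a - omegaR s b ≤ max 1 (weightS s b) * (b - a) := by
  have hpos : ∀ t ∈ Set.Icc a b, 0 < 1 - s * t := fun t ht => by
    rcases le_total s 0 with hs | hs
    · nlinarith [ha.trans ht.1]
    · nlinarith [ht.2]
  have h := (convex_Icc a b).norm_image_sub_le_of_norm_hasDerivWithin_le
    (f := omegaR s) (f' := fun t => -weightS s t) (C := max 1 (weightS s b))
    (fun t ht => (hasDerivAt_omegaR (hpos t ht)).hasDerivWithinAt)
    (fun t ht => by
      rw [norm_neg, Real.norm_of_nonneg (weightS_nonneg s t)]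
      exact weightS_le_max (ha.trans ht.1) ht.2 hb)
    (Set.left_mem_Icc.2 hab) (Set.right_mem_Icc.2 hab)
  rw [Real.norm_of_nonneg (sub_nonneg.2 hab), ← norm_neg, neg_sub] at h
  exact (le_abs_self _).trans h

/-- The scaling argument controls only `t` times the weight. For `s > 1` the weight is at most 2
while `st ≤ 1/2`, and beyond that `1 ≤ 2st`. -/
theorem max_one_weightS_le {t : ℝ} (ht : 0 ≤ t) :
    max 1 (weightS s t) ≤ 2 + 2 * |s| * (t * weightS s t) := by
  have hw := weightS_nonneg s t
  have h0 : 0 ≤ 2 * |s| * (t * weightS s t) := by positivity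
  refine max_le (by linarith) ?_
  rcases le_or_gt s 1 with hs | hs
  · linarith [weightS_le_one hs ht]
  rcases le_or_gt (1 - s * t) 0 with h | h
  · rw [weightS_eq_zero h]; simp
  have hs0 : 0 < s := by linarith
  rcases le_total (s * t) (1 / 2) with h1 | h1
  · have : weightS s t ≤ 2 := by
      rw [weightS_of_pos hs0.ne' h]
      calc (1 - s * t) ^ (1 / s - 1) ≤ (1 / 2 : ℝ) ^ (1 / s - 1) := by
            refine Real.rpow_le_rpow_of_nonpos (by norm_num) (by linarith) ?_
            have := (div_le_one hs0).2 hs.le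
            linarith
        _ ≤ (1 / 2 : ℝ) ^ (-1 : ℝ) := by
            refine Real.rpow_le_rpow_of_exponent_ge (by norm_num) (by norm_num) ?_
            have : 0 < 1 / s := by positivity
            linarith
        _ = 2 := by rw [Real.rpow_neg_one]; norm_num
    linarith
  · rw [abs_of_pos hs0] at *
    nlinarith

end Omega

theorem pow_sub_one_le {m : ℝ} (h1 : 1 ≤ m) (h2 : m ≤ 2) (k : ℕ) :
    m ^ k - 1 ≤ k * 2 ^ k * (m - 1) := by
  induction k with
  | zero => simp
  | succ k ih =>
    have h3 : m ^ (k + 1) - 1 = m * (m ^ k - 1) + (m - 1) := by ring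
    have h4 : 1 ≤ m ^ k := one_le_pow₀ h1
    have h5 : (1 : ℝ) ≤ 2 ^ k := one_le_pow₀ (by norm_num)
    have h6 : m * (m ^ k - 1) ≤ 2 * (m ^ k - 1) := mul_le_mul_of_nonneg_right h2 (by linarith)
    have h7 : (m - 1) ≤ 2 * 2 ^ k * (m - 1) := by nlinarith
    rw [h3]
    push_cast
    calc m * (m ^ k - 1) + (m - 1) ≤ 2 * (k * 2 ^ k * (m - 1)) + 2 * 2 ^ k * (m - 1) := by linarith
      _ = (k + 1) * 2 ^ (k + 1) * (m - 1) := by ring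

/-! ### First variation of the integral over one subspace -/

section Variation

variable {V : Type*} [NormedAddCommGroup V] [InnerProductSpace ℝ V] [FiniteDimensional ℝ V]
  [MeasurableSpace V] [BorelSpace V]

theorem lintegral_comp_smul {f : V → ℝ≥0∞} (hf : Measurable f) {c : ℝ} (hc : 0 < c) :
    ∫⁻ x, f (c • x) = ENNReal.ofReal ((c ^ Module.finrank ℝ V)⁻¹) * ∫⁻ x, f x := by
  have h := Measure.map_addHaar_smul (volume : Measure V) hc.ne'
  rw [← lintegral_map (g := fun x : V => c • x) hf (measurable_const_smul c), h,
    lintegral_smul_measure, abs_of_nonneg (by positivity), smul_eq_mul]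

variable {s : ℝ} {v : V → ℝ}

/-- The scaling identity `∫ Ω_s(v(lx)) = l^(-k) ∫ Ω_s(v)` is differentiated at `l = 1`.
Starshapedness gives `Ω_s(l v) ≤ Ω_s(v(l ·))`, so the quotients of `l ↦ Ω_s(l v)` have bounded
integrals, and Fatou's lemma passes to the limit. -/
theorem lintegral_mul_weightS_le (hv : Measurable v) (hv0 : ∀ x, 0 ≤ v x)
    (hstar : ∀ (l : ℝ) x, 0 ≤ l → l ≤ 1 → v (l • x) ≤ l * v x)
    (hI : ∫⁻ x, ENNReal.ofReal (omegaR s (v x)) ≠ ⊤) :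
    ∫⁻ x, ENNReal.ofReal (v x * weightS s (v x)) ≤
      ENNReal.ofReal (Module.finrank ℝ V * 2 ^ (Module.finrank ℝ V + 1)) *
        ∫⁻ x, ENNReal.ofReal (omegaR s (v x)) := by
  set k := Module.finrank ℝ V with hk
  set I := ∫⁻ x, ENNReal.ofReal (omegaR s (v x)) with hIdef
  have hΩm : Measurable fun x => omegaR s (v x) := measurable_omegaR_comp hv hv0
  -- The shift by 2 keeps `l m ≥ 1/2`, so that `pow_sub_one_le` applies to `(l m)⁻¹ ≤ 2`.
  let l : ℕ → ℝ := fun m => 1 - 1 / ((m : ℝ) + 2)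
  have hl : ∀ m, 1 / 2 ≤ l m ∧ l m < 1 := fun m => by
    have h0 : (0 : ℝ) < (m : ℝ) + 2 := by positivity
    have h1 : 1 / ((m : ℝ) + 2) ≤ 1 / 2 :=
      one_div_le_one_div_of_le (by norm_num) (by linarith [(Nat.cast_nonneg m : (0 : ℝ) ≤ m)])
    have h2 : 0 < 1 / ((m : ℝ) + 2) := by positivity
    constructor <;> simp only [l] <;> linarith
  have hlt : Tendsto l atTop (𝓝 1) := by
    have h1 : Tendsto (fun m : ℕ => 1 / ((m : ℝ) + 2)) atTop (𝓝 0) := by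
      have := tendsto_one_div_add_atTop_nhds_zero_nat (𝕜 := ℝ)
      have h2 := this.comp (tendsto_add_atTop_nat 1)
      refine h2.congr fun m => ?_
      simp only [Function.comp_apply]
      push_cast
      ring
    simpa [l] using h1.const_sub 1
  let F : ℕ → V → ℝ≥0∞ := fun m x =>
    ENNReal.ofReal ((omegaR s (l m * v x) - omegaR s (v x)) / (1 - l m))
  have hFm : ∀ m, Measurable (F m) := fun m => by
    refine Measurable.ennreal_ofReal (Measurable.div_const (Measurable.sub ?_ hΩm) _)
    exact measurable_omegaR_comp (hv.const_mul _)
      fun x => mul_nonneg (by linarith [(hl m).1]) (hv0 x)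
  have hle : ∀ m, ∫⁻ x, F m x ≤ ENNReal.ofReal (k * 2 ^ (k + 1)) * I := fun m => by
    obtain ⟨hl1, hl2⟩ := hl m
    have hl0 : 0 < l m := by linarith
    have hd : ∀ x, omegaR s (v x) ≤ omegaR s (v (l m • x)) := fun x =>
      omegaR_anti (hv0 _) ((hstar _ x hl0.le hl2.le).trans
        (mul_le_of_le_one_left (hv0 x) hl2.le))
    have hA : ∫⁻ x, ENNReal.ofReal (omegaR s (v (l m • x)) - omegaR s (v x)) ≤
        ENNReal.ofReal ((l m ^ k)⁻¹ - 1) * I := by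
      have h1 : (∫⁻ x, ENNReal.ofReal (omegaR s (v (l m • x)) - omegaR s (v x))) + I =
          ENNReal.ofReal ((l m ^ k)⁻¹ - 1) * I + I := by
        calc (∫⁻ x, ENNReal.ofReal (omegaR s (v (l m • x)) - omegaR s (v x))) + I
            = ∫⁻ x, (ENNReal.ofReal (omegaR s (v (l m • x)) - omegaR s (v x)) +
                ENNReal.ofReal (omegaR s (v x))) := by
              rw [lintegral_add_right _ hΩm.ennreal_ofReal]
          _ = ∫⁻ x, ENNReal.ofReal (omegaR s (v (l m • x))) := by
              refine lintegral_congr fun x => ?_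
              rw [← ENNReal.ofReal_add (by linarith [hd x]) (omegaR_nonneg _ _), sub_add_cancel]
          _ = ENNReal.ofReal ((l m ^ k)⁻¹) * I :=
              lintegral_comp_smul (f := fun x => ENNReal.ofReal (omegaR s (v x)))
                hΩm.ennreal_ofReal hl0
          _ = ENNReal.ofReal ((l m ^ k)⁻¹ - 1) * I + I := by
              have h2 : 1 ≤ (l m ^ k)⁻¹ := (one_le_inv₀ (by positivity)).2 (pow_le_one₀ hl0.le hl2.le)
              conv_lhs => rw [← sub_add_cancel ((l m ^ k)⁻¹) 1,
                ENNReal.ofReal_add (by linarith) zero_le_one, ENNReal.ofReal_one, add_mul, one_mul]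
      exact ((ENNReal.add_left_inj hI).1 h1).le
    calc ∫⁻ x, F m x
        ≤ ∫⁻ x, ENNReal.ofReal (1 / (1 - l m)) *
            ENNReal.ofReal (omegaR s (v (l m • x)) - omegaR s (v x)) := by
          refine lintegral_mono fun x => ?_
          rw [← ENNReal.ofReal_mul (one_div_nonneg.2 (by linarith)), one_div_mul_eq_div]
          refine ENNReal.ofReal_le_ofReal (div_le_div_of_nonneg_right ?_ (by linarith))
          have := omegaR_anti (s := s) (hv0 _) (hstar _ x hl0.le hl2.le)
          linarith
      _ = ENNReal.ofReal (1 / (1 - l m)) *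
            ∫⁻ x, ENNReal.ofReal (omegaR s (v (l m • x)) - omegaR s (v x)) := by
          rw [lintegral_const_mul' _ _ ENNReal.ofReal_ne_top]
      _ ≤ ENNReal.ofReal (1 / (1 - l m)) * (ENNReal.ofReal ((l m ^ k)⁻¹ - 1) * I) := by
          gcongr
      _ = ENNReal.ofReal (1 / (1 - l m) * ((l m ^ k)⁻¹ - 1)) * I := by
          rw [← mul_assoc, ← ENNReal.ofReal_mul (one_div_nonneg.2 (by linarith))]
      _ ≤ _ := by
          refine mul_le_mul' (ENNReal.ofReal_le_ofReal ?_) le_rfl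
          have h1 := pow_sub_one_le ((one_le_inv₀ hl0).2 hl2.le)
            (by rw [inv_le_comm₀ hl0 (by norm_num)]; linarith) k
          rw [inv_pow] at h1
          have h2 : (l m)⁻¹ - 1 ≤ 2 * (1 - l m) := by
            have h3 : (l m)⁻¹ - 1 = (l m)⁻¹ * (1 - l m) := by field_simp
            rw [h3]
            refine mul_le_mul_of_nonneg_right ?_ (by linarith)
            rw [inv_le_comm₀ hl0 (by norm_num)]
            linarith
          have h4 : (0 : ℝ) ≤ k * 2 ^ k := by positivity
          rw [one_div_mul_eq_div, div_le_iff₀ (by linarith)]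
          calc (l m ^ k)⁻¹ - 1 ≤ k * 2 ^ k * ((l m)⁻¹ - 1) := h1
            _ ≤ k * 2 ^ k * (2 * (1 - l m)) := mul_le_mul_of_nonneg_left h2 h4
            _ = k * 2 ^ (k + 1) * (1 - l m) := by ring
  have hlim : ∀ x, ENNReal.ofReal (v x * weightS s (v x)) ≤ liminf (fun m => F m x) atTop := by
    intro x
    rcases le_or_gt (1 - s * v x) 0 with h | h
    · rw [weightS_eq_zero h]; simp
    have h1 : HasDerivAt (fun t : ℝ => omegaR s (t * v x)) (-weightS s (v x) * v x) 1 := by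
      have h2 : HasDerivAt (fun t : ℝ => t * v x) (v x) 1 := by
        simpa using (hasDerivAt_id (1 : ℝ)).mul_const (v x)
      have h3 : HasDerivAt (omegaR s) (-weightS s (v x)) (1 * v x) := by
        rw [one_mul]; exact hasDerivAt_omegaR h
      exact h3.comp (1 : ℝ) h2
    rw [hasDerivAt_iff_tendsto_slope] at h1
    have h4 : Tendsto l atTop (𝓝[≠] 1) :=
      tendsto_nhdsWithin_iff.2 ⟨hlt, Eventually.of_forall fun m => (hl m).2.ne⟩
    have h5 := (h1.comp h4).neg
    have h6 : Tendsto (fun m => (omegaR s (l m * v x) - omegaR s (v x)) / (1 - l m)) atTop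
        (𝓝 (v x * weightS s (v x))) := by
      have h7 : -(-weightS s (v x) * v x) = v x * weightS s (v x) := by ring
      rw [h7] at h5
      refine h5.congr fun m => ?_
      rw [Function.comp_apply, slope_def_field, one_mul, ← div_neg, neg_sub]
    exact ((ENNReal.continuous_ofReal.tendsto _).comp h6).liminf_eq.ge
  calc ∫⁻ x, ENNReal.ofReal (v x * weightS s (v x))
      ≤ ∫⁻ x, liminf (fun m => F m x) atTop := lintegral_mono hlim
    _ ≤ liminf (fun m => ∫⁻ x, F m x) atTop := lintegral_liminf_le hFm
    _ ≤ liminf (fun _ : ℕ => ENNReal.ofReal (k * 2 ^ (k + 1)) * I) atTop :=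
        liminf_le_liminf (Eventually.of_forall hle)
    _ = _ := liminf_const _

/-- By starshapedness the sublevel set at `1/s + δ` lies in the dilate by `m = 1 + sδ` of the one at
`1/s`; the volumes differ by a factor of at most `m^k`. -/
theorem volume_shell_le (hv : Measurable v)
    (hstar : ∀ (l : ℝ) x, 0 ≤ l → l ≤ 1 → v (l • x) ≤ l * v x) (hs : 0 < s) {δ : ℝ}
    (hδ : 0 ≤ δ) (hδ1 : s * δ ≤ 1) (hL : volume {x | v x < 1 / s} ≠ ⊤) :
    volume {x | 1 / s ≤ v x ∧ v x < 1 / s + δ} ≤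
      ENNReal.ofReal (Module.finrank ℝ V * 2 ^ Module.finrank ℝ V * (s * δ)) *
        volume {x | v x < 1 / s} := by
  set k := Module.finrank ℝ V with hk
  set L := {x | v x < 1 / s} with hLd
  set A := {x | 1 / s ≤ v x ∧ v x < 1 / s + δ} with hA
  have hLm : MeasurableSet L := measurableSet_lt hv measurable_const
  set m := 1 + s * δ with hm
  have hm1 : 1 ≤ m := by rw [hm]; have := mul_nonneg hs.le hδ; linarith
  have hm0 : 0 < m := by linarith
  have hdisj : Disjoint A L := by
    rw [Set.disjoint_left]
    intro x hx hxL
    exact absurd hxL (not_lt.2 hx.1)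
  have hsub : A ∪ L ⊆ (m⁻¹ • ·) ⁻¹' L := by
    intro x hx
    have hx' : v x < 1 / s + δ := by
      rcases hx with hx | hx
      · exact hx.2
      · exact lt_of_lt_of_le hx (by linarith)
    change v (m⁻¹ • x) < 1 / s
    refine (hstar m⁻¹ x (by positivity) (inv_le_one_of_one_le₀ hm1)).trans_lt ?_
    rw [inv_mul_lt_iff₀ hm0]
    have : m * (1 / s) = 1 / s + δ := by rw [hm]; field_simp
    rwa [this]
  have h1 : volume A + volume L ≤ ENNReal.ofReal (m ^ k) * volume L := by
    rw [← measure_union hdisj hLm]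
    refine (measure_mono hsub).trans (le_of_eq ?_)
    rw [Measure.addHaar_preimage_smul _ (inv_ne_zero hm0.ne'), inv_pow, inv_inv,
      abs_of_nonneg (by positivity)]
  have h2 : volume A + volume L ≤ ENNReal.ofReal (m ^ k - 1) * volume L + volume L := by
    refine h1.trans (le_of_eq ?_)
    have h3 : 1 ≤ m ^ k := one_le_pow₀ hm1
    conv_lhs => rw [← sub_add_cancel (m ^ k) 1,
      ENNReal.ofReal_add (by linarith) zero_le_one, ENNReal.ofReal_one, add_mul, one_mul]
  refine (ENNReal.le_of_add_le_add_right hL h2).trans ?_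
  gcongr
  have := pow_sub_one_le hm1 (by rw [hm]; linarith) k
  rwa [show m - 1 = s * δ by rw [hm]; ring] at this

end Variation

set_option linter.unusedSectionVars false

section Variation

variable {V : Type*} [NormedAddCommGroup V] [InnerProductSpace ℝ V] [FiniteDimensional ℝ V]
  [MeasurableSpace V] [BorelSpace V]

/-- A one-parameter family `Q ε` of functions that lies between `Ω_s(v)` and `Ω_s(v - ε ρ)`, up to
first order at the upper end, where `v` is starshaped and `ρ` is bounded with bounded support. -/
structure IsVariation (s M R : ℝ) (v ρ : V → ℝ) (Q : ℝ → V → ℝ) : Prop where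
  measurable : Measurable v
  nonneg : ∀ x, 0 ≤ v x
  star : ∀ (l : ℝ) x, 0 ≤ l → l ≤ 1 → v (l • x) ≤ l * v x
  level : 0 < s → ∀ x, v x < 1 / s → ‖x‖ ≤ R
  rate_nonneg : ∀ x, 0 ≤ ρ x
  rate_le : ∀ x, ρ x ≤ M
  rate_support : ∀ x, R < ‖x‖ → ρ x = 0
  family_measurable : ∀ ε, 0 < ε → Measurable (Q ε)
  le_family : ∀ ε, 0 < ε → ∀ x, omegaR s (v x) ≤ Q ε x
  family_le : ∀ ε, 0 < ε → ∀ x, Q ε x ≤ omegaR s (max (v x - ε * ρ x) 0)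
  tendsto : ∀ x, 0 < 1 - s * v x →
    Tendsto (fun ε => (Q ε x - omegaR s (v x)) / ε) (𝓝[>] 0) (𝓝 (weightS s (v x) * ρ x))

namespace IsVariation

variable {s M R : ℝ} {v ρ : V → ℝ} {Q : ℝ → V → ℝ}

theorem bound_nonneg (h : IsVariation s M R v ρ Q) : 0 ≤ M := (h.rate_nonneg 0).trans (h.rate_le 0)

theorem measurable_omega (h : IsVariation s M R v ρ Q) : Measurable fun x => omegaR s (v x) :=
  measurable_omegaR_comp h.measurable h.nonneg

theorem family_eq (h : IsVariation s M R v ρ Q) {ε : ℝ} (hε : 0 < ε) {x : V} (hx : R < ‖x‖) :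
    Q ε x = omegaR s (v x) := by
  refine le_antisymm ?_ (h.le_family ε hε x)
  have := h.family_le ε hε x
  rwa [h.rate_support x hx, mul_zero, sub_zero, max_eq_left (h.nonneg x)] at this

theorem family_le_one (h : IsVariation s M R v ρ Q) {ε : ℝ} (hε : 0 < ε) (x : V) : Q ε x ≤ 1 :=
  (h.family_le ε hε x).trans (omegaR_le_one (le_max_right _ _))

theorem sub_le_indicator (h : IsVariation s M R v ρ Q) {ε : ℝ} (hε : 0 < ε) (x : V) :
    Q ε x - omegaR s (v x) ≤ (Metric.closedBall (0 : V) R).indicator 1 x := by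
  by_cases hx : x ∈ Metric.closedBall (0 : V) R
  · rw [Set.indicator_of_mem hx]
    have := h.family_le_one hε x
    have := omegaR_nonneg s (v x)
    simp only [Pi.one_apply]
    linarith
  · rw [Set.indicator_of_notMem hx, h.family_eq hε (by simpa using hx), sub_self]

theorem lintegral_family_le (h : IsVariation s M R v ρ Q) {ε : ℝ} (hε : 0 < ε) :
    ∫⁻ x, ENNReal.ofReal (Q ε x) ≤
      volume (Metric.closedBall (0 : V) R) + ∫⁻ x, ENNReal.ofReal (omegaR s (v x)) := by
  calc ∫⁻ x, ENNReal.ofReal (Q ε x)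
      ≤ ∫⁻ x, ((Metric.closedBall (0 : V) R).indicator 1 x + ENNReal.ofReal (omegaR s (v x))) := by
        refine lintegral_mono fun x => ?_
        have h1 := h.sub_le_indicator hε x
        by_cases hx : x ∈ Metric.closedBall (0 : V) R
        · rw [Set.indicator_of_mem hx]
          refine le_add_right ?_
          simpa using h.family_le_one hε x
        · rw [Set.indicator_of_notMem hx, h.family_eq hε (by simpa using hx), zero_add]
    _ = _ := by
        rw [lintegral_add_right _ h.measurable_omega.ennreal_ofReal,
          lintegral_indicator_one measurableSet_closedBall]

/-- The dominating function. -/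
def dom (s M R : ℝ) (v : V → ℝ) (x : V) : ℝ :=
  (Metric.closedBall (0 : V) R).indicator (fun x => M * (2 + 2 * |s| * (v x * weightS s (v x)))) x

theorem dom_nonneg (h : IsVariation s M R v ρ Q) (x : V) : 0 ≤ dom s M R v x := by
  refine Set.indicator_nonneg (fun x _ => ?_) x
  have := h.bound_nonneg
  have := mul_nonneg (h.nonneg x) (weightS_nonneg s (v x))
  positivity

theorem measurable_dom (h : IsVariation s M R v ρ Q) : Measurable (dom s M R v) := by
  refine Measurable.indicator ?_ measurableSet_closedBall
  exact (((h.measurable.mul ((measurable_weightS s).comp h.measurable)).const_mul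
    (2 * |s|)).const_add 2).const_mul M

theorem max_mul_le_dom (h : IsVariation s M R v ρ Q) (x : V) :
    max 1 (weightS s (v x)) * ρ x ≤ dom s M R v x := by
  by_cases hx : x ∈ Metric.closedBall (0 : V) R
  · rw [dom, Set.indicator_of_mem hx, mul_comm M]
    refine mul_le_mul (max_one_weightS_le (h.nonneg x)) (h.rate_le x) (h.rate_nonneg x) ?_
    exact (zero_le_one.trans (le_max_left _ _)).trans (max_one_weightS_le (h.nonneg x))
  · rw [dom, Set.indicator_of_notMem hx, h.rate_support x (by simpa using hx), mul_zero]

/-- A bound for the integral of the dominating function, in terms of the dimension `k`, the volume `K`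
of the ball that contains the support, and the integral `I` of `Ω_s(v)`. -/
def domBound (s M : ℝ) (k : ℕ) (K I : ℝ≥0∞) : ℝ≥0∞ :=
  ENNReal.ofReal (M * 2) * K +
    ENNReal.ofReal (M * (2 * |s|)) * (ENNReal.ofReal (k * 2 ^ (k + 1)) * I)

theorem domBound_ne_top (s M : ℝ) (k : ℕ) {K I : ℝ≥0∞} (hK : K ≠ ⊤) (hI : I ≠ ⊤) :
    domBound s M k K I ≠ ⊤ :=
  ENNReal.add_ne_top.2 ⟨ENNReal.mul_ne_top ENNReal.ofReal_ne_top hK,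
    ENNReal.mul_ne_top ENNReal.ofReal_ne_top (ENNReal.mul_ne_top ENNReal.ofReal_ne_top hI)⟩

theorem domBound_mono (s M : ℝ) (k : ℕ) {K I K' I' : ℝ≥0∞} (hK : K ≤ K') (hI : I ≤ I') :
    domBound s M k K I ≤ domBound s M k K' I' := by
  unfold domBound
  gcongr

theorem lintegral_dom_le (h : IsVariation s M R v ρ Q)
    (hI : ∫⁻ x, ENNReal.ofReal (omegaR s (v x)) ≠ ⊤) :
    ∫⁻ x, ENNReal.ofReal (dom s M R v x) ≤ domBound s M (Module.finrank ℝ V)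
      (volume (Metric.closedBall (0 : V) R)) (∫⁻ x, ENNReal.ofReal (omegaR s (v x))) := by
  have hM := h.bound_nonneg
  have hvm : Measurable fun x => ENNReal.ofReal (v x * weightS s (v x)) :=
    (h.measurable.mul ((measurable_weightS s).comp h.measurable)).ennreal_ofReal
  have hle : ∀ x, ENNReal.ofReal (dom s M R v x) ≤
      ENNReal.ofReal (M * 2) * (Metric.closedBall (0 : V) R).indicator 1 x +
        ENNReal.ofReal (M * (2 * |s|)) * ENNReal.ofReal (v x * weightS s (v x)) := fun x => by
    have h1 := mul_nonneg (h.nonneg x) (weightS_nonneg s (v x))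
    by_cases hx : x ∈ Metric.closedBall (0 : V) R
    · rw [dom, Set.indicator_of_mem hx, Set.indicator_of_mem hx, Pi.one_apply, mul_one,
        ← ENNReal.ofReal_mul (by positivity), ← ENNReal.ofReal_add (by positivity) (by positivity)]
      refine ENNReal.ofReal_le_ofReal (le_of_eq ?_)
      ring
    · rw [dom, Set.indicator_of_notMem hx, ENNReal.ofReal_zero]
      exact zero_le
  calc ∫⁻ x, ENNReal.ofReal (dom s M R v x)
      ≤ ∫⁻ x, (ENNReal.ofReal (M * 2) * (Metric.closedBall (0 : V) R).indicator 1 x +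
        ENNReal.ofReal (M * (2 * |s|)) * ENNReal.ofReal (v x * weightS s (v x))) :=
        lintegral_mono hle
    _ = ENNReal.ofReal (M * 2) * volume (Metric.closedBall (0 : V) R) +
        ENNReal.ofReal (M * (2 * |s|)) * ∫⁻ x, ENNReal.ofReal (v x * weightS s (v x)) := by
        rw [lintegral_add_right _ (hvm.const_mul _), lintegral_const_mul _ hvm,
          lintegral_const_mul' _ _ ENNReal.ofReal_ne_top,
          lintegral_indicator_one measurableSet_closedBall]
    _ ≤ _ := by
        unfold domBound
        gcongr
        exact lintegral_mul_weightS_le h.measurable h.nonneg h.star hI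

theorem rate_le_dom (h : IsVariation s M R v ρ Q) (x : V) :
    weightS s (v x) * ρ x ≤ dom s M R v x :=
  (mul_le_mul_of_nonneg_right (le_max_right _ _) (h.rate_nonneg x)).trans (h.max_mul_le_dom x)

theorem quotient_le_dom (h : IsVariation s M R v ρ Q) {ε : ℝ} (hε : 0 < ε) {x : V}
    (hx : 0 < 1 - s * v x) : (Q ε x - omegaR s (v x)) / ε ≤ dom s M R v x := by
  refine le_trans ?_ (h.max_mul_le_dom x)
  rw [div_le_iff₀ hε]
  have hρ := mul_nonneg hε.le (h.rate_nonneg x)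
  have h1 : max (v x - ε * ρ x) 0 ≤ v x := max_le (by linarith) (h.nonneg x)
  have h2 := omegaR_sub_le (le_max_right (v x - ε * ρ x) 0) h1 hx
  have h3 : v x - max (v x - ε * ρ x) 0 ≤ ε * ρ x := by
    linarith [le_max_left (v x - ε * ρ x) 0]
  have h4 : (0 : ℝ) ≤ max 1 (weightS s (v x)) := zero_le_one.trans (le_max_left _ _)
  have h5 := mul_le_mul_of_nonneg_left h3 h4
  linarith [h.family_le ε hε x]

/-- The part of the space on which the weight lives. -/
def inside (s : ℝ) (v : V → ℝ) : Set V := {x | 0 < 1 - s * v x}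

theorem measurableSet_inside (h : IsVariation s M R v ρ Q) : MeasurableSet (inside s v) :=
  measurableSet_lt measurable_const ((h.measurable.const_mul s).const_sub 1)

theorem quotient_nonneg (h : IsVariation s M R v ρ Q) {ε : ℝ} (hε : 0 < ε) (x : V) :
    0 ≤ (Q ε x - omegaR s (v x)) / ε :=
  div_nonneg (sub_nonneg.2 (h.le_family ε hε x)) hε.le

theorem quotient_measurable (h : IsVariation s M R v ρ Q) {ε : ℝ} (hε : 0 < ε) :
    Measurable fun x => (Q ε x - omegaR s (v x)) / ε :=
  ((h.family_measurable ε hε).sub h.measurable_omega).div_const ε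

/-- A bound for the difference quotient outside. -/
def shellBound (s M : ℝ) (k : ℕ) (ε : ℝ) : ℝ :=
  k * 2 ^ k * (|s| * M) * (|s| * (ε * M)) ^ (1 / |s|)

theorem shellBound_le (s : ℝ) {M : ℝ} (k : ℕ) (hM : 0 ≤ M) {ε : ℝ} (hε : 0 ≤ ε)
    (h1 : |s| * (ε * M) ≤ 1) : shellBound s M k ε ≤ k * 2 ^ k * (|s| * M) := by
  unfold shellBound
  exact mul_le_of_le_one_right (by positivity)
    (Real.rpow_le_one (by positivity) h1 (by positivity))

theorem tendsto_shellBound (s M : ℝ) (k : ℕ) : Tendsto (shellBound s M k) (𝓝[>] 0) (𝓝 0) := by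
  refine Tendsto.mono_left ?_ nhdsWithin_le_nhds
  unfold shellBound
  rcases eq_or_ne s 0 with rfl | hs
  · simp
  · have hs' : 0 < 1 / |s| := by positivity
    have hc : Continuous fun ε : ℝ => k * 2 ^ k * (|s| * M) * (|s| * (ε * M)) ^ (1 / |s|) :=
      continuous_const.mul (Continuous.rpow_const (by fun_prop) fun ε => Or.inr hs'.le)
    have := hc.tendsto 0
    simpa [Real.zero_rpow hs'.ne', Real.zero_rpow (inv_ne_zero (abs_ne_zero.2 hs))] using this

/-- For `s ≤ 0` there is no outside. For `s > 0`, `Ω_s(v)` vanishes there and `Q ε` lives on the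
shell `v < 1/s + εM`, where it is at most `(sεM)^(1/s)`. The shell has volume `O(ε)`, which absorbs
the division by `ε`. -/
theorem lintegral_outside_le (h : IsVariation s M R v ρ Q) {ε : ℝ} (hε : 0 < ε)
    (h1 : |s| * (ε * M) ≤ 1) :
    ∫⁻ x in (inside s v)ᶜ, ENNReal.ofReal ((Q ε x - omegaR s (v x)) / ε) ≤
      ENNReal.ofReal (shellBound s M (Module.finrank ℝ V) ε) *
        volume (Metric.closedBall (0 : V) R) := by
  have hM := h.bound_nonneg
  rcases le_or_gt s 0 with hs | hs
  · have : (inside s v)ᶜ = ∅ := by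
      rw [Set.compl_empty_iff, Set.eq_univ_iff_forall]
      intro x
      have := mul_nonpos_of_nonpos_of_nonneg hs (h.nonneg x)
      change 0 < 1 - s * v x
      linarith
    simp [this]
  rw [abs_of_pos hs] at h1
  set k := Module.finrank ℝ V
  set A := {x | 1 / s ≤ v x ∧ v x < 1 / s + ε * M} with hA
  have hAm : MeasurableSet A := (measurableSet_le measurable_const h.measurable).inter
    (measurableSet_lt h.measurable measurable_const)
  have hL : volume {x | v x < 1 / s} ≤ volume (Metric.closedBall (0 : V) R) :=
    measure_mono fun x hx => mem_closedBall_zero_iff.2 (h.level hs x hx)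
  have hball : volume (Metric.closedBall (0 : V) R) ≠ ⊤ := measure_closedBall_lt_top.ne
  set c := (s * (ε * M)) ^ (1 / s) / ε with hc
  have hle : ∀ x ∈ (inside s v)ᶜ, ENNReal.ofReal ((Q ε x - omegaR s (v x)) / ε) ≤
      A.indicator (fun _ => ENNReal.ofReal c) x := fun x hx => by
    have hx1 : 1 / s ≤ v x := by
      rw [div_le_iff₀ hs]
      have : ¬ 0 < 1 - s * v x := hx
      linarith
    have h2 : v x - ε * M ≤ v x - ε * ρ x := by
      have := mul_le_mul_of_nonneg_left (h.rate_le x) hε.le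
      linarith
    have h3 : Q ε x ≤ omegaR s (max (v x - ε * M) 0) :=
      (h.family_le ε hε x).trans (omegaR_anti (le_max_right _ _) (max_le_max h2 le_rfl))
    rw [omegaR_eq_zero hs hx1, sub_zero]
    by_cases hxA : x ∈ A
    · rw [Set.indicator_of_mem hxA]
      refine ENNReal.ofReal_le_ofReal (div_le_div_of_nonneg_right ?_ hε.le)
      have h4 : 0 ≤ 1 / s - ε * M := by
        rw [sub_nonneg, le_div_iff₀ hs]
        linarith
      have h5 : 1 / s - ε * M ≤ max (v x - ε * M) 0 :=
        le_trans (by linarith) (le_max_left _ _)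
      refine h3.trans ((omegaR_anti h4 h5).trans (le_of_eq ?_))
      have h6 : 1 - s * (1 / s - ε * M) = s * (ε * M) := by field_simp; ring
      rw [omegaR_of_ne hs.ne', h6, max_eq_left (by positivity)]
    · have h4 : 1 / s ≤ v x - ε * M := by
        by_contra hcon
        exact hxA ⟨hx1, by linarith⟩
      rw [omegaR_eq_zero hs (h4.trans (le_max_left _ _))] at h3
      rw [ENNReal.ofReal_of_nonpos (div_nonpos_of_nonpos_of_nonneg h3 hε.le)]
      exact zero_le
  calc ∫⁻ x in (inside s v)ᶜ, ENNReal.ofReal ((Q ε x - omegaR s (v x)) / ε)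
      ≤ ∫⁻ x in (inside s v)ᶜ, A.indicator (fun _ => ENNReal.ofReal c) x :=
        setLIntegral_mono (measurable_const.indicator hAm) hle
    _ ≤ ∫⁻ x, A.indicator (fun _ => ENNReal.ofReal c) x := setLIntegral_le_lintegral _ _
    _ = ENNReal.ofReal c * volume A := by rw [lintegral_indicator_const hAm]
    _ ≤ ENNReal.ofReal c * (ENNReal.ofReal (k * 2 ^ k * (s * (ε * M))) *
          volume (Metric.closedBall (0 : V) R)) := by
        gcongr
        refine (volume_shell_le h.measurable h.star hs (by positivity) h1
          (ne_top_of_le_ne_top hball hL)).trans ?_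
        gcongr
    _ = _ := by
        rw [← mul_assoc, ← ENNReal.ofReal_mul (by positivity), shellBound, abs_of_pos hs, hc]
        congr 2
        field_simp

theorem integrable_dom (h : IsVariation s M R v ρ Q)
    (hI : ∫⁻ x, ENNReal.ofReal (omegaR s (v x)) ≠ ⊤) : Integrable (dom s M R v) := by
  refine ⟨h.measurable_dom.aestronglyMeasurable, ?_⟩
  rw [hasFiniteIntegral_iff_ofReal (Eventually.of_forall h.dom_nonneg)]
  exact (h.lintegral_dom_le hI).trans_lt
    (domBound_ne_top _ _ _ measure_closedBall_lt_top.ne hI).lt_top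

theorem integrable_quotient (h : IsVariation s M R v ρ Q) {ε : ℝ} (hε : 0 < ε) :
    Integrable fun x => (Q ε x - omegaR s (v x)) / ε := by
  refine Integrable.div_const ?_ ε
  have h1 : Integrable ((Metric.closedBall (0 : V) R).indicator (1 : V → ℝ)) :=
    (integrableOn_const (measure_closedBall_lt_top.ne)).integrable_indicator measurableSet_closedBall
  refine h1.mono' ((h.family_measurable ε hε).sub h.measurable_omega).aestronglyMeasurable
    (Eventually.of_forall fun x => ?_)
  rw [Real.norm_of_nonneg (sub_nonneg.2 (h.le_family ε hε x))]
  exact h.sub_le_indicator hε x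

theorem lintegral_quotient_le (h : IsVariation s M R v ρ Q)
    (hI : ∫⁻ x, ENNReal.ofReal (omegaR s (v x)) ≠ ⊤) {ε : ℝ} (hε : 0 < ε)
    (h1 : |s| * (ε * M) ≤ 1) :
    ∫⁻ x, ENNReal.ofReal ((Q ε x - omegaR s (v x)) / ε) ≤
      domBound s M (Module.finrank ℝ V) (volume (Metric.closedBall (0 : V) R))
        (∫⁻ x, ENNReal.ofReal (omegaR s (v x))) +
      ENNReal.ofReal (Module.finrank ℝ V * 2 ^ Module.finrank ℝ V * (|s| * M)) *
        volume (Metric.closedBall (0 : V) R) := by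
  rw [← lintegral_add_compl _ h.measurableSet_inside]
  refine add_le_add ?_ ?_
  · refine le_trans ?_ (h.lintegral_dom_le hI)
    refine (setLIntegral_mono h.measurable_dom.ennreal_ofReal fun x hx => ?_).trans
      (setLIntegral_le_lintegral _ _)
    exact ENNReal.ofReal_le_ofReal (h.quotient_le_dom hε hx)
  · refine (h.lintegral_outside_le hε h1).trans ?_
    gcongr
    exact shellBound_le s _ h.bound_nonneg hε.le h1

theorem lintegral_rate_le (h : IsVariation s M R v ρ Q)
    (hI : ∫⁻ x, ENNReal.ofReal (omegaR s (v x)) ≠ ⊤) :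
    ∫⁻ x, ENNReal.ofReal (weightS s (v x) * ρ x) ≤
      domBound s M (Module.finrank ℝ V) (volume (Metric.closedBall (0 : V) R))
        (∫⁻ x, ENNReal.ofReal (omegaR s (v x))) :=
  (lintegral_mono fun x => ENNReal.ofReal_le_ofReal (h.rate_le_dom x)).trans (h.lintegral_dom_le hI)

theorem eventually_small (s M : ℝ) : ∀ᶠ ε : ℝ in 𝓝[>] 0, 0 < ε ∧ |s| * (ε * M) ≤ 1 := by
  have hc : Continuous fun ε : ℝ => |s| * (ε * M) := by fun_prop
  have h1 : ∀ᶠ ε : ℝ in 𝓝 0, |s| * (ε * M) < 1 :=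
    hc.tendsto 0 |>.eventually (gt_mem_nhds (by simp))
  filter_upwards [self_mem_nhdsWithin, nhdsWithin_le_nhds h1] with ε h2 h3
  exact ⟨h2, h3.le⟩

/-- Dominated convergence works only inside: for `s > 1` the shell bound `(sεM)^(1/s) / ε` on the
quotients outside blows up as `ε → 0`, but their integral still tends to `0`. -/
theorem tendsto_integral (h : IsVariation s M R v ρ Q)
    (hI : ∫⁻ x, ENNReal.ofReal (omegaR s (v x)) ≠ ⊤) :
    Tendsto (fun ε => ∫ x, (Q ε x - omegaR s (v x)) / ε) (𝓝[>] 0)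
      (𝓝 (∫ x, weightS s (v x) * ρ x)) := by
  have hin : Tendsto (fun ε => ∫ x in inside s v, (Q ε x - omegaR s (v x)) / ε) (𝓝[>] 0)
      (𝓝 (∫ x in inside s v, weightS s (v x) * ρ x)) := by
    refine tendsto_integral_filter_of_dominated_convergence (dom s M R v) ?_ ?_
      (h.integrable_dom hI).integrableOn ?_
    · filter_upwards [self_mem_nhdsWithin] with ε hε
      exact (h.quotient_measurable hε).aestronglyMeasurable
    · filter_upwards [self_mem_nhdsWithin] with ε hε
      filter_upwards [ae_restrict_mem h.measurableSet_inside] with x hx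
      rw [Real.norm_of_nonneg (h.quotient_nonneg hε x)]
      exact h.quotient_le_dom hε hx
    · filter_upwards [ae_restrict_mem h.measurableSet_inside] with x hx
      exact h.tendsto x hx
  have hout : Tendsto (fun ε => ∫ x in (inside s v)ᶜ, (Q ε x - omegaR s (v x)) / ε) (𝓝[>] 0)
      (𝓝 0) := by
    have hb : Tendsto (fun ε => (ENNReal.ofReal (shellBound s M (Module.finrank ℝ V) ε) *
        volume (Metric.closedBall (0 : V) R)).toReal) (𝓝[>] 0) (𝓝 0) := by
      have h1 := (ENNReal.continuous_ofReal.tendsto _).comp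
        (tendsto_shellBound s M (Module.finrank ℝ V))
      have h2 := ENNReal.Tendsto.mul_const (b := volume (Metric.closedBall (0 : V) R)) h1
        (Or.inr measure_closedBall_lt_top.ne)
      rw [ENNReal.ofReal_zero, zero_mul] at h2
      exact (ENNReal.tendsto_toReal ENNReal.zero_ne_top).comp h2
    refine tendsto_of_tendsto_of_tendsto_of_le_of_le' tendsto_const_nhds hb ?_ ?_
    · filter_upwards [self_mem_nhdsWithin] with ε hε
      exact integral_nonneg (h.quotient_nonneg hε)
    · filter_upwards [eventually_small s M] with ε hε
      rw [integral_eq_lintegral_of_nonneg_ae (Eventually.of_forall (h.quotient_nonneg hε.1))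
        (h.quotient_measurable hε.1).aestronglyMeasurable]
      exact ENNReal.toReal_mono
        (ENNReal.mul_ne_top ENNReal.ofReal_ne_top measure_closedBall_lt_top.ne)
        (h.lintegral_outside_le hε.1 hε.2)
  have hw : ∫ x in inside s v, weightS s (v x) * ρ x = ∫ x, weightS s (v x) * ρ x := by
    refine setIntegral_eq_integral_of_forall_compl_eq_zero fun x hx => ?_
    rw [weightS_eq_zero (not_lt.1 hx), zero_mul]
  have hsum := hin.add hout
  rw [hw, add_zero] at hsum
  refine hsum.congr' ?_
  filter_upwards [self_mem_nhdsWithin] with ε hε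
  exact integral_add_compl h.measurableSet_inside (h.integrable_quotient hε)

end IsVariation

end Variation

/-! ### Projections of functions with given base function -/

section Projection

variable {n : ℕ} {s : ℝ} {b : E n → ℝ}

theorem bddAbove_omegaR (hb0 : ∀ x, 0 ≤ b x) {ι : Sort*} (x : ι → E n) :
    BddAbove (Set.range fun i => omegaR s (b (x i))) :=
  ⟨1, by rintro _ ⟨i, rfl⟩; exact omegaR_le_one (hb0 _)⟩

theorem le_projSup (hb0 : ∀ x, 0 ≤ b x) (H : Submodule ℝ (E n)) (x : H) {z : E n} (hz : z ∈ Hᗮ) :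
    omegaR s (b (x + z)) ≤ projSup (ofBase s fun x => (b x : EReal)) H x :=
  le_ciSup (f := fun z : Hᗮ => omegaR s (b ((x : E n) + z)))
    (bddAbove_omegaR hb0 fun z : Hᗮ => (x : E n) + z) ⟨z, hz⟩

theorem projSup_le (H : Submodule ℝ (E n)) (x : H) {c : ℝ}
    (h : ∀ z ∈ Hᗮ, omegaR s (b (x + z)) ≤ c) :
    projSup (ofBase s fun x => (b x : EReal)) H x ≤ c :=
  ciSup_le fun z => h z z.2

theorem projSup_nonneg (H : Submodule ℝ (E n)) (x : H) :
    0 ≤ projSup (ofBase s fun x => (b x : EReal)) H x :=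
  Real.iSup_nonneg fun _ => omegaR_nonneg _ _

/-- Parametrising `Hᗮ` by `w - P w` with `w ∈ ℝⁿ` makes the index set independent of `H`; a supremum
of continuous functions of `(P, x)` is lower semicontinuous. -/
theorem isMeasFamily_projSup (hb : Continuous b) (hb0 : ∀ x, 0 ≤ b x) :
    IsMeasFamily (projSup (ofBase s fun x => (b x : EReal))) := by
  refine ⟨fun q => ⨆ w : E n, omegaR s (b (q.2 + (w - q.1 w))), ?_, fun H x => ?_⟩
  · refine LowerSemicontinuous.measurable ?_
    refine lowerSemicontinuous_ciSup
      (fun q => bddAbove_omegaR hb0 fun w : E n => q.2 + (w - q.1 w)) fun w => ?_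
    refine Continuous.lowerSemicontinuous (continuous_omegaR_comp (hb.comp ?_) fun q => hb0 _)
    fun_prop
  · have hsurj : Function.Surjective fun w : E n =>
        (⟨w - H.starProjection w, H.sub_starProjection_mem_orthogonal w⟩ : Hᗮ) := by
      rintro ⟨z, hz⟩
      refine ⟨z, Subtype.ext ?_⟩
      simp [(Submodule.starProjection_apply_eq_zero_iff H).2 hz]
    exact (hsurj.iSup_comp fun z : Hᗮ => omegaR s (b ((x : E n) + z))).symm

end Projection

/-! ### Bounds for the projections of `f`, uniform over the subspaces -/

section Base

variable {n : ℕ} {s : ℝ} {u : E n → ℝ}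

theorem IsC2Plus.projSup_eq (hu : IsC2Plus u) (H : Submodule ℝ (E n)) (x : H) :
    projSup (ofBase s fun x => (u x : EReal)) H x = omegaR s (u (minPt u H.starProjection x)) := by
  refine le_antisymm (projSup_le H x fun z hz => omegaR_anti (hu.nonneg _) (hu.minPt_le H x hz)) ?_
  have h := le_projSup (s := s) hu.nonneg H x (hu.minPt_sub_mem H x)
  rwa [add_sub_cancel] at h

theorem IsC2Plus.measurable_minPt (hu : IsC2Plus u) {f : E n → ℝ} (hf : Measurable f)
    (H : Submodule ℝ (E n)) : Measurable fun x : H => f (minPt u H.starProjection x) :=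
  (hu.isMeasFamily_minPt hf).measurable H

theorem IsC2Plus.minPt_smul_le (hu : IsC2Plus u) (H : Submodule ℝ (E n)) (x : E n) {l : ℝ}
    (h0 : 0 ≤ l) (h1 : l ≤ 1) :
    u (minPt u H.starProjection (l • x)) ≤ l * u (minPt u H.starProjection x) := by
  have h2 := hu.minPt_le H (l • x) (Hᗮ.smul_mem l (hu.minPt_sub_mem H x))
  rw [← smul_add, add_sub_cancel] at h2
  have h3 := hu.convexOn.2 (Set.mem_univ (0 : E n)) (Set.mem_univ (minPt u H.starProjection x))
    (sub_nonneg.2 h1) h0 (by ring)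
  rw [smul_zero, zero_add, hu.map_zero, smul_zero, zero_add, smul_eq_mul] at h3
  exact h2.trans h3

theorem lintegral_eq_lintegral_prod (H : Submodule ℝ (E n)) {f : E n → ℝ≥0∞} (hf : Measurable f) :
    ∫⁻ y, f y = ∫⁻ x : H, ∫⁻ z : Hᗮ, f ((x : E n) + z) := by
  have hmp : MeasurePreserving (fun y : E n => WithLp.ofLp (H.orthogonalDecomposition y))
      volume volume :=
    (WithLp.volume_preserving_ofLp H Hᗮ).comp H.orthogonalDecomposition.measurePreserving
  have hG : Measurable fun q : H × Hᗮ => f ((q.1 : E n) + q.2) := by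
    refine hf.comp ?_
    exact (measurable_subtype_coe.comp measurable_fst).add
      (measurable_subtype_coe.comp measurable_snd)
  have h := hmp.lintegral_comp hG
  rw [Measure.volume_eq_prod, lintegral_prod _ hG.aemeasurable] at h
  rw [← h]
  refine lintegral_congr fun y => ?_
  congr 1
  simp

/-- Let `w` be the minimum point over `2x`, and let `u ≤ m₀` on the ball of radius `r`. Midpoints of
`w` with that ball cover a ball of radius `r/2` in the fibre over `x`, and there convexity gives `u
≤ max (u w) m₀`. So each fibre integral of `f` dominates a constant times `P_H f(2x)`; Tonelli and
the scaling by 2 finish the proof. -/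
theorem exists_lintegral_projection_le (hu : IsC2Plus u)
    (hf : Integrable (ofBase s fun x => (u x : EReal)) volume) (k : ℕ) :
    ∃ C : ℝ≥0∞, C ≠ ⊤ ∧ ∀ H : Gr n k,
      ∫⁻ x : H.sub, ENNReal.ofReal (omegaR s (u (minPt u H.sub.starProjection x))) ≤ C := by
  -- Small enough that `Ω_s(m₀) > 0` for either sign of `s`.
  set m₀ : ℝ := 1 / (2 * (|s| + 1)) with hm₀
  have hm0 : 0 < m₀ := by positivity
  have hsm : 0 < 1 - s * m₀ := by
    have h1 : s * m₀ ≤ |s| * m₀ := mul_le_mul_of_nonneg_right (le_abs_self s) hm0.le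
    have h2 : |s| * m₀ < 1 := by
      rw [hm₀, mul_one_div, div_lt_one (by positivity)]
      linarith [abs_nonneg s]
    linarith
  have hc0 : 0 < omegaR s m₀ := omegaR_pos hsm
  obtain ⟨r, hr, hrb⟩ := Metric.nhds_basis_closedBall.mem_iff.1
    (hu.continuous.tendsto 0 |>.eventually (ge_mem_nhds (by rw [hu.map_zero]; exact hm0) :
      ∀ᶠ t in 𝓝 (u 0), t ≤ m₀))
  set β : ℝ≥0∞ := volume (Metric.ball (0 : E (n - k)) (r / 2)) with hβ
  have hβ0 : β ≠ 0 := (Metric.measure_ball_pos volume _ (half_pos hr)).ne'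
  have hβt : β ≠ ⊤ := measure_ball_lt_top.ne
  set J : ℝ≥0∞ := ∫⁻ y : E n, ENNReal.ofReal (omegaR s (u y)) with hJ
  have hJt : J ≠ ⊤ := by
    have h : HasFiniteIntegral (fun y : E n => omegaR s (u y)) volume := hf.2
    rw [hasFiniteIntegral_iff_ofReal (Eventually.of_forall fun y => omegaR_nonneg s (u y))] at h
    exact h.ne
  set D : ℝ≥0∞ := β * ENNReal.ofReal (omegaR s m₀) * ENNReal.ofReal (((2 : ℝ) ^ k)⁻¹) with hD
  have hD0 : D ≠ 0 := mul_ne_zero (mul_ne_zero hβ0 (ENNReal.ofReal_pos.2 hc0).ne')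
    (ENNReal.ofReal_pos.2 (by positivity)).ne'
  have hDt : D ≠ ⊤ := ENNReal.mul_ne_top (ENNReal.mul_ne_top hβt ENNReal.ofReal_ne_top)
    ENNReal.ofReal_ne_top
  refine ⟨J / D, ENNReal.div_ne_top hJt hD0, fun H => ?_⟩
  have hfm : Measurable fun y : E n => ENNReal.ofReal (omegaR s (u y)) :=
    (measurable_omegaR_comp hu.continuous.measurable hu.nonneg).ennreal_ofReal
  have hvm : Measurable fun x : H.sub =>
      ENNReal.ofReal (omegaR s (u (minPt u H.sub.starProjection x))) :=
    hu.measurable_minPt (measurable_omegaR_comp hu.continuous.measurable hu.nonneg) H.sub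
      |>.ennreal_ofReal
  have hball : ∀ z₀ : H.subᗮ, volume (Metric.ball z₀ (r / 2)) = β := fun z₀ => by
    rw [Measure.addHaar_ball_center]
    refine volume_ball_eq_of_finrank_eq ?_ _
    have h1 := H.sub.finrank_add_finrank_orthogonal
    rw [H.finrank_eq, finrank_euclideanSpace_fin] at h1
    rw [finrank_euclideanSpace_fin]
    omega
  have hinner : ∀ x : H.sub, β * ENNReal.ofReal (omegaR s m₀) *
      ENNReal.ofReal (omegaR s (u (minPt u H.sub.starProjection ((2 : ℝ) • x : H.sub)))) ≤
        ∫⁻ z : H.subᗮ, ENNReal.ofReal (omegaR s (u ((x : E n) + z))) := fun x => by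
    set w := minPt u H.sub.starProjection ((2 : ℝ) • x : H.sub) with hw
    have hwm : w - (2 : ℝ) • (x : E n) ∈ H.subᗮ := hu.minPt_sub_mem H.sub ((2 : ℝ) • (x : E n))
    let z₀ : H.subᗮ := (1 / 2 : ℝ) • ⟨w - (2 : ℝ) • (x : E n), hwm⟩
    have hz₀ : (z₀ : E n) = (1 / 2 : ℝ) • (w - (2 : ℝ) • (x : E n)) := rfl
    have hle : ∀ z ∈ Metric.ball z₀ (r / 2), omegaR s m₀ * omegaR s (u w) ≤
        omegaR s (u ((x : E n) + z)) := fun z hz => by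
      rw [mem_ball_iff_norm] at hz
      have hb : ‖(2 : ℝ) • ((z : E n) - z₀)‖ ≤ r := by
        rw [norm_smul, Real.norm_ofNat]
        have : ‖(z : E n) - z₀‖ = ‖z - z₀‖ := rfl
        rw [this]
        linarith
      have hub : u ((2 : ℝ) • ((z : E n) - z₀)) ≤ m₀ := hrb (mem_closedBall_zero_iff.2 hb)
      have hconv := hu.convexOn.2 (Set.mem_univ w) (Set.mem_univ ((2 : ℝ) • ((z : E n) - z₀)))
        (by norm_num : (0 : ℝ) ≤ 1 / 2) (by norm_num : (0 : ℝ) ≤ 1 / 2) (by norm_num)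
      have hxz : (1 / 2 : ℝ) • w + (1 / 2 : ℝ) • (2 : ℝ) • ((z : E n) - z₀) = (x : E n) + z := by
        rw [hz₀]
        module
      rw [hxz, smul_eq_mul, smul_eq_mul] at hconv
      have h1 := omegaR_nonneg s (u w)
      have h2 := omegaR_le_one (s := s) (hu.nonneg w)
      have h3 := omegaR_le_one (s := s) hm0.le
      -- Both factors are at most 1, so their product is at most the one belonging to the larger
      -- argument.
      rcases le_total (u w) m₀ with h | h
      · have h4 := omegaR_anti (s := s) (hu.nonneg ((x : E n) + z)) (by linarith :
          u ((x : E n) + z) ≤ m₀)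
        exact (mul_le_of_le_one_right hc0.le h2).trans h4
      · have h4 := omegaR_anti (s := s) (hu.nonneg ((x : E n) + z)) (by linarith :
          u ((x : E n) + z) ≤ u w)
        exact (mul_le_of_le_one_left h1 h3).trans h4
    calc β * ENNReal.ofReal (omegaR s m₀) * ENNReal.ofReal (omegaR s (u w))
        = ENNReal.ofReal (omegaR s m₀ * omegaR s (u w)) * volume (Metric.ball z₀ (r / 2)) := by
          rw [hball, ENNReal.ofReal_mul hc0.le]
          ring
      _ = ∫⁻ _ in Metric.ball z₀ (r / 2), ENNReal.ofReal (omegaR s m₀ * omegaR s (u w)) := by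
          rw [setLIntegral_const]
      _ ≤ ∫⁻ z in Metric.ball z₀ (r / 2), ENNReal.ofReal (omegaR s (u ((x : E n) + z))) := by
          refine setLIntegral_mono ?_ fun z hz => ENNReal.ofReal_le_ofReal (hle z hz)
          exact hfm.comp (measurable_subtype_coe.const_add _)
      _ ≤ _ := setLIntegral_le_lintegral _ _
  rw [ENNReal.le_div_iff_mul_le (Or.inl hD0) (Or.inl hDt)]
  calc (∫⁻ x : H.sub, ENNReal.ofReal (omegaR s (u (minPt u H.sub.starProjection x)))) * D
      = β * ENNReal.ofReal (omegaR s m₀) * (ENNReal.ofReal (((2 : ℝ) ^ k)⁻¹) *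
          ∫⁻ x : H.sub, ENNReal.ofReal (omegaR s (u (minPt u H.sub.starProjection x)))) := by
        rw [hD]; ring
    _ = β * ENNReal.ofReal (omegaR s m₀) * ∫⁻ x : H.sub,
          ENNReal.ofReal (omegaR s (u (minPt u H.sub.starProjection ((2 : ℝ) • x : H.sub)))) := by
        have h := lintegral_comp_smul hvm (zero_lt_two (α := ℝ))
        rw [H.finrank_eq] at h
        rw [← h]
    _ = ∫⁻ x : H.sub, β * ENNReal.ofReal (omegaR s m₀) *
          ENNReal.ofReal (omegaR s (u (minPt u H.sub.starProjection ((2 : ℝ) • x : H.sub)))) := by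
        rw [lintegral_const_mul' _ _ (ENNReal.mul_ne_top hβt ENNReal.ofReal_ne_top)]
    _ ≤ ∫⁻ x : H.sub, ∫⁻ z : H.subᗮ, ENNReal.ofReal (omegaR s (u ((x : E n) + z))) :=
        lintegral_mono hinner
    _ = J := (lintegral_eq_lintegral_prod H.sub hfm).symm

end Base

/-! ### The first variation of the quermassintegrals -/

section FirstVariation

variable {n : ℕ} {p s : ℝ} {u ψ : E n → ℝ}

/-- The conjugate of the perturbation `(φ^p + ε ψ^p)^{1/p}` of the conjugate `φ` of `u`. -/
def perturbBase (p : ℝ) (u ψ : E n → ℝ) (ε : ℝ) : E n → ℝ :=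
  legendreReal (perturb p (legendreReal u) ψ ε)

/-- The projection of `f_ε` is bounded below by its value at the minimum point of the unperturbed
`u`, and above by the tangent estimate on the fibre. That `M` and `R` do not depend on `H` is what
later permits averaging over subspaces. -/
theorem exists_isVariation (hp : 1 ≤ p) (hu : IsC2Plus u) (hψ : ContDiff ℝ ∞ ψ)
    (hψc : HasCompactSupport ψ) (hψ0 : ∀ y, 0 ≤ ψ y) (hψo : ψ 0 = 0) (s : ℝ) :
    ∃ M R : ℝ, ∀ H : Submodule ℝ (E n), IsVariation s M R
      (fun x : H => u (minPt u H.starProjection x))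
      (fun x : H => perturbRate p (legendreReal u) ψ (gradient u (minPt u H.starProjection x)))
      (fun ε => projSup (ofBase s fun x => (perturbBase p u ψ ε x : EReal)) H) := by
  obtain ⟨M, hM, hMb⟩ := exists_perturbRate_le hp hu hψ hψc hψ0 hψo
  obtain ⟨R₀, hR₀, hR₀b⟩ := exists_perturbRate_support hp hu hψc
  obtain ⟨B, hB⟩ := hu.superlinear 1
  have hnn : ∀ ε, 0 < ε → ∀ w, 0 ≤ perturbBase p u ψ ε w := fun ε hε w =>
    legendreReal_perturb_nonneg hp hu hψ0 hψo hε.le w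
  -- `R₀` covers the support of the rate, and `1 / s + B` the level set, where `‖w‖ - B ≤ u w < 1 /
  -- s`.
  refine ⟨M, max R₀ (1 / s + B), fun H => ?_⟩
  have hlow : ∀ ε, 0 < ε → ∀ x : H, omegaR s (perturbBase p u ψ ε (minPt u H.starProjection x)) ≤
      projSup (ofBase s fun x => (perturbBase p u ψ ε x : EReal)) H x := fun ε hε x => by
    have h := le_projSup (s := s) (hnn ε hε) H x (hu.minPt_sub_mem H x)
    rwa [add_sub_cancel] at h
  have hupp : ∀ ε, 0 < ε → ∀ x : H,
      projSup (ofBase s fun x => (perturbBase p u ψ ε x : EReal)) H x ≤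
        omegaR s (max (u (minPt u H.starProjection x) - ε *
          perturbRate p (legendreReal u) ψ (gradient u (minPt u H.starProjection x))) 0) :=
    fun ε hε x => projSup_le H x fun z hz => by
      refine omegaR_anti (le_max_right _ _) (max_le ?_ (hnn ε hε _))
      refine sub_le_legendreReal_perturb hp hu hψ0 hψo hε.le _ ?_
      have h1 : (x : E n) + z - minPt u H.starProjection x =
          z - (minPt u H.starProjection x - x) := by abel
      rw [h1]
      exact Submodule.inner_right_of_mem_orthogonal (hu.gradient_minPt_mem H x)
        (Hᗮ.sub_mem hz (hu.minPt_sub_mem H x))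
  refine
    { measurable := hu.measurable_minPt hu.continuous.measurable H
      nonneg := fun x => hu.nonneg _
      star := fun l x h0 h1 => hu.minPt_smul_le H x h0 h1
      level := fun hs x hx => ?_
      rate_nonneg := fun x => perturbRate_nonneg hp hu hψ0 _
      rate_le := fun x => hMb _
      rate_support := fun x hx => hR₀b _ ?_
      family_measurable := fun ε hε => (isMeasFamily_projSup
        (continuous_legendreReal (legendreBdd_perturb hp hu hψ0 hε.le)) (hnn ε hε)).measurable H
      le_family := fun ε hε x => (omegaR_anti (hnn ε hε _)
        (legendreReal_perturb_le hp hu hψ0 hε.le _)).trans (hlow ε hε x)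
      family_le := hupp
      tendsto := fun x hx => ?_ }
  · have h1 := hB (minPt u H.starProjection x)
    have h2 := hu.norm_le_norm_minPt H x
    have h3 : u (minPt u H.starProjection x) < 1 / s := hx
    exact le_trans (by linarith) (le_max_right _ _)
  · exact ((le_max_left _ _).trans_lt hx).trans_le (hu.norm_le_norm_minPt H x)
  · set w := minPt u H.starProjection x with hw
    set h := perturbRate p (legendreReal u) ψ (gradient u w) with hh
    have hΩ := hasDerivAt_omegaR hx
    have hchain : ∀ t : ℝ → ℝ, Tendsto (fun ε => (t ε - u w) / ε) (𝓝[>] 0) (𝓝 (-h)) →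
        Tendsto (fun ε => (omegaR s (t ε) - omegaR s (u w)) / ε) (𝓝[>] 0)
          (𝓝 (weightS s (u w) * h)) := fun t ht => by
      -- The value at `ε = 0` is prescribed so that the one-sided limit becomes a derivative and the
      -- chain rule applies.
      let t' : ℝ → ℝ := fun ε => if ε = 0 then u w else t ε
      have ht' : HasDerivWithinAt t' (-h) (Set.Ioi 0) 0 := by
        rw [hasDerivWithinAt_iff_tendsto_slope' (by simp)]
        refine ht.congr' ?_
        filter_upwards [self_mem_nhdsWithin] with ε hε
        have hε0 : ε ≠ 0 := (ne_of_gt hε)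
        simp [slope_def_field, t', hε0]
      have hΩ' : HasDerivAt (omegaR s) (-weightS s (u w)) (t' 0) := by simpa [t'] using hΩ
      have h2 := hΩ'.comp_hasDerivWithinAt 0 ht'
      rw [hasDerivWithinAt_iff_tendsto_slope' (by simp), neg_mul_neg] at h2
      refine h2.congr' ?_
      filter_upwards [self_mem_nhdsWithin] with ε hε
      have hε0 : ε ≠ 0 := (ne_of_gt hε)
      simp [slope_def_field, t', hε0]
    have hl := hchain _ (tendsto_legendreReal_perturb hp hu hψ0 hψo hψ.continuous w)
    have hr : Tendsto (fun ε => (max (u w - ε * h) 0 - u w) / ε) (𝓝[>] 0) (𝓝 (-h)) := by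
      refine tendsto_const_nhds.congr' ?_
      -- The positive part is inactive for small `ε`: where `u w = 0`, the gradient and hence the
      -- rate vanish.
      have hev : ∀ᶠ ε : ℝ in 𝓝[>] 0, 0 ≤ u w - ε * h := by
        rcases (hu.nonneg w).eq_or_lt with h0 | h0
        · have hgrad : gradient u w = 0 := by
            have hmin : IsLocalMin u w := Eventually.of_forall fun y => by
              rw [← h0]; exact hu.nonneg y
            unfold gradient
            rw [hmin.fderiv_eq_zero, _root_.map_zero]
          have : h = 0 := by rw [hh, hgrad]; exact perturbRate_eq_zero hp hψo
          refine Eventually.of_forall fun ε => ?_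
          rw [← h0, this]; simp
        · have hc : Continuous fun ε : ℝ => u w - ε * h := by fun_prop
          have := hc.tendsto 0 |>.eventually (lt_mem_nhds (by simpa using h0) :
            ∀ᶠ t in 𝓝 (u w - 0 * h), 0 < t)
          filter_upwards [nhdsWithin_le_nhds this] with ε hε
          exact hε.le
      filter_upwards [hev, self_mem_nhdsWithin] with ε h1 hε
      have hε0 : ε ≠ 0 := (ne_of_gt hε)
      rw [max_eq_left h1]
      field_simp
      ring
    have hr' := hchain _ hr
    refine tendsto_of_tendsto_of_tendsto_of_le_of_le' hl hr' ?_ ?_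
    · filter_upwards [self_mem_nhdsWithin] with ε hε
      exact div_le_div_of_nonneg_right (sub_le_sub_right (hlow ε hε x) _) (le_of_lt hε)
    · filter_upwards [self_mem_nhdsWithin] with ε hε
      exact div_le_div_of_nonneg_right (sub_le_sub_right (hupp ε hε x) _) (le_of_lt hε)

theorem mixedIntegrand_eq (hp : 1 ≤ p) (hu : IsC2Plus u)
    {Ψ : (H : Submodule ℝ (E n)) → H → EReal}
    (hΨ : ∀ (H : Submodule ℝ (E n)) (y : H), Ψ H y = (ψ (y : E n) : EReal))
    (H : Submodule ℝ (E n)) (x : H) : mixedIntegrand p s (fun x => (u x : EReal)) Ψ H x =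
      p * (weightS s (u (minPt u H.starProjection x)) *
        perturbRate p (legendreReal u) ψ (gradient u (minPt u H.starProjection x))) := by
  have h1 : legendre (projInf (fun x => (u x : EReal)) H)
      (gradient (fun z : H => (projInf (fun x => (u x : EReal)) H z).toReal) x) =
        (legendreReal u (gradient u (minPt u H.starProjection x)) : EReal) := by
    rw [← hu.gradient_projInf H x]
    exact legendre_projInf (legendre_coe hu.legendreBdd _)
  unfold mixedIntegrand
  rw [h1, hΨ, hu.gradient_projInf, hu.projInf_eq, EReal.toReal_coe, EReal.toReal_coe,
    EReal.toReal_coe, perturbRate]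
  have hp0 : p ≠ 0 := by linarith
  field_simp

theorem isMeasFamily_mixedIntegrand (hp : 1 ≤ p) (hu : IsC2Plus u) (hψ : Continuous ψ)
    {Ψ : (H : Submodule ℝ (E n)) → H → EReal}
    (hΨ : ∀ (H : Submodule ℝ (E n)) (y : H), Ψ H y = (ψ (y : E n) : EReal)) :
    IsMeasFamily (mixedIntegrand p s (fun x => (u x : EReal)) Ψ) := by
  have h1 : Measurable fun w => ψ (gradient u w) := (hψ.comp hu.continuous_gradient).measurable
  have h2 : Measurable fun w => legendreReal u (gradient u w) :=
    ((continuous_legendreReal hu.legendreBdd).comp hu.continuous_gradient).measurable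
  have h3 : Measurable fun w => weightS s (u w) :=
    (measurable_weightS s).comp hu.continuous.measurable
  have h4 : Measurable fun w => p * (weightS s (u w) *
      perturbRate p (legendreReal u) ψ (gradient u w)) :=
    (h3.mul (((h1.pow_const p).const_mul (1 / p)).mul (h2.pow_const (1 - p)))).const_mul p
  obtain ⟨Φ, hΦ, h⟩ := hu.isMeasFamily_minPt h4
  exact ⟨Φ, hΦ, fun H x => (mixedIntegrand_eq hp hu hΨ H x).trans (h H x)⟩

/-- Dominated convergence over the Grassmannian with a constant majorant. The family `Ψ` is kept
abstract because `ψ|_H` appears both as a restriction and as the conjugate of `v_H`. -/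
theorem exists_isFirstVariation {j : ℕ} (hj : j < n) (hp : 1 ≤ p) (hu : IsC2Plus u)
    (hf : Integrable (ofBase s fun x => (u x : EReal)) volume) (hψ : ContDiff ℝ ∞ ψ)
    (hψc : HasCompactSupport ψ) (hψ0 : ∀ y, 0 ≤ ψ y) (hψo : ψ 0 = 0)
    {Ψ : (H : Submodule ℝ (E n)) → H → EReal}
    (hΨ : ∀ (H : Submodule ℝ (E n)) (y : H), Ψ H y = (ψ (y : E n) : EReal)) :
    ∃ W : ℝ, IsFirstVariation n j p (ofBase s fun x => (u x : EReal))
        (fun ε => ofBase s (legendre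
          (lpMean p 1 (legendre fun x => (u x : EReal)) ε fun y => (ψ y : EReal)))) W ∧
      IsRepresentedBy n j (mixedIntegrand p s (fun x => (u x : EReal)) Ψ) W := by
  have hbase : ∀ ε, 0 < ε → ofBase s (legendre
      (lpMean p 1 (legendre fun x => (u x : EReal)) ε fun y => (ψ y : EReal))) =
        ofBase s fun x => (perturbBase p u ψ ε x : EReal) := fun ε hε => by
    have h1 : (legendre fun x => (u x : EReal)) = fun y => (legendreReal u y : EReal) :=
      funext (legendre_coe hu.legendreBdd)
    have h2 : lpMean p 1 (legendre fun x => (u x : EReal)) ε (fun y => (ψ y : EReal)) =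
        fun y => (perturb p (legendreReal u) ψ ε y : EReal) := by
      rw [h1]
      exact funext (lpMean_coe hp hu.legendreReal_nonneg hψ0 hε.le)
    rw [h2]
    congr 1
    exact funext (legendre_coe (legendreBdd_perturb hp hu hψ0 hε.le))
  set k := n - j with hk
  have hkn : k ≤ n := Nat.sub_le n j
  obtain ⟨C, hC, hCb⟩ := exists_lintegral_projection_le hu hf k
  obtain ⟨M, R, hvar⟩ := exists_isVariation hp hu hψ hψc hψ0 hψo s
  -- A ball in a fixed model space, so that the bound is the same for every `H`; the open ball of
  -- radius `R + 1` contains the closed one of radius `R`.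
  set K : ℝ≥0∞ := volume (Metric.ball (0 : E k) (R + 1)) with hK
  have hKt : K ≠ ⊤ := measure_ball_lt_top.ne
  have hKb : ∀ H : Gr n k, volume (Metric.closedBall (0 : H.sub) R) ≤ K := fun H => by
    rw [hK, ← volume_ball_eq_of_finrank_eq (V := H.sub) (by
      rw [H.finrank_eq, finrank_euclideanSpace_fin])]
    exact measure_mono (Metric.closedBall_subset_ball (by linarith))
  have hI : ∀ H : Gr n k, ∫⁻ x : H.sub,
      ENNReal.ofReal (omegaR s (u (minPt u H.sub.starProjection x))) ≠ ⊤ := fun H =>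
    ne_top_of_le_ne_top hC (hCb H)
  have hdom : ∀ H : Gr n k, IsVariation.domBound s M (Module.finrank ℝ H.sub)
      (volume (Metric.closedBall (0 : H.sub) R)) (∫⁻ x : H.sub,
        ENNReal.ofReal (omegaR s (u (minPt u H.sub.starProjection x)))) ≤
      IsVariation.domBound s M k K C := fun H => by
    rw [H.finrank_eq]
    exact IsVariation.domBound_mono s M k (hKb H) (hCb H)
  have hdomt := IsVariation.domBound_ne_top s M k hKt hC
  set P₀ := projSup (ofBase s fun x => (u x : EReal)) with hP₀
  set P : ℝ → (H : Submodule ℝ (E n)) → H → ℝ :=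
    fun ε => projSup (ofBase s fun x => (perturbBase p u ψ ε x : EReal)) with hP
  set F := mixedIntegrand p s (fun x => (u x : EReal)) Ψ with hF
  have hP₀eq : ∀ (H : Submodule ℝ (E n)) (x : H), P₀ H x =
      omegaR s (u (minPt u H.starProjection x)) := fun H x => hu.projSup_eq H x
  have hFeq : ∀ (H : Submodule ℝ (E n)) (x : H), F H x =
      p * (weightS s (u (minPt u H.starProjection x)) * perturbRate p (legendreReal u) ψ
        (gradient u (minPt u H.starProjection x))) := fun H x =>
    mixedIntegrand_eq hp hu hΨ H x
  have hp0 : 0 < p := by linarith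
  have hF0 : ∀ H x, 0 ≤ F H x := fun H x => by
    rw [hFeq]
    exact mul_nonneg hp0.le (mul_nonneg (weightS_nonneg _ _) (perturbRate_nonneg hp hu hψ0 _))
  have hFb : ∀ H : Gr n k, ∫⁻ x : H.sub, ENNReal.ofReal (F H.sub x) ≤
      ENNReal.ofReal p * IsVariation.domBound s M k K C := fun H => by
    simp only [hFeq, ENNReal.ofReal_mul hp0.le]
    rw [lintegral_const_mul' _ _ ENNReal.ofReal_ne_top]
    gcongr
    exact ((hvar H.sub).lintegral_rate_le (hI H)).trans (hdom H)
  have hrep := (isMeasFamily_mixedIntegrand (s := s) hp hu hψ.continuous hΨ).isRepresentedBy hj hF0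
    (ENNReal.mul_ne_top ENNReal.ofReal_ne_top hdomt) hFb
  have hgr₀ : GrIntegrable n k P₀ := by
    refine ((isMeasFamily_projSup hu.continuous hu.nonneg).grIntegrable hkn projSup_nonneg hC
      fun H => ?_).1
    simp only [← hP₀, hP₀eq]
    exact hCb H
  have hgr : ∀ ε, 0 < ε → GrIntegrable n k (P ε) := fun ε hε => by
    refine ((isMeasFamily_projSup (continuous_legendreReal (legendreBdd_perturb hp hu hψ0 hε.le))
      (legendreReal_perturb_nonneg hp hu hψ0 hψo hε.le)).grIntegrable hkn projSup_nonneg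
        (ENNReal.add_ne_top.2 ⟨hKt, hC⟩) fun H => ?_).1
    exact ((hvar H.sub).lintegral_family_le hε).trans (add_le_add (hKb H) (hCb H))
  have hquot : ∀ ε, 0 < ε → ∀ H : Gr n k,
      ∫ x : H.sub, (P ε H.sub x - P₀ H.sub x) / ε =
        ((∫ x : H.sub, P ε H.sub x) - ∫ x : H.sub, P₀ H.sub x) / ε := fun ε hε H => by
    rw [integral_div, integral_sub ((hgr ε hε).1 H) (hgr₀.1 H)]
  have hprob := isProbabilityMeasure_grMeasure hkn
  set D : ℝ≥0∞ := IsVariation.domBound s M k K C +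
    ENNReal.ofReal (k * 2 ^ k * (|s| * M)) * K with hD
  have hDt : D ≠ ⊤ := ENNReal.add_ne_top.2
    ⟨hdomt, ENNReal.mul_ne_top ENNReal.ofReal_ne_top hKt⟩
  have hlim : Tendsto (fun ε => ∫ H : Gr n k, (∫ x : H.sub, (P ε H.sub x - P₀ H.sub x) / ε)
      ∂(grMeasure n k)) (𝓝[>] 0) (𝓝 (1 / p * grIntegral n k F)) := by
    have hF1 : 1 / p * grIntegral n k F =
        ∫ H : Gr n k, (1 / p * ∫ x : H.sub, F H.sub x) ∂(grMeasure n k) :=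
      (integral_const_mul _ _).symm
    rw [hF1]
    refine tendsto_integral_filter_of_dominated_convergence (fun _ => D.toReal) ?_ ?_
      (integrable_const _) (Eventually.of_forall fun H => ?_)
    · filter_upwards [self_mem_nhdsWithin] with ε hε
      simp only [hquot ε hε]
      exact (((hgr ε hε).2.sub hgr₀.2).div_const ε).aestronglyMeasurable
    · filter_upwards [IsVariation.eventually_small s M] with ε hε
      refine Eventually.of_forall fun H => ?_
      have hv := hvar H.sub
      simp only [hP₀eq]
      rw [Real.norm_of_nonneg (integral_nonneg (hv.quotient_nonneg hε.1)),
        integral_eq_lintegral_of_nonneg_ae (Eventually.of_forall (hv.quotient_nonneg hε.1))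
          (hv.quotient_measurable hε.1).aestronglyMeasurable]
      refine ENNReal.toReal_mono hDt ((hv.lintegral_quotient_le (hI H) hε.1 hε.2).trans ?_)
      refine add_le_add (hdom H) ?_
      rw [H.finrank_eq]
      gcongr
      exact hKb H
    · have h := (hvar H.sub).tendsto_integral (hI H)
      simp only [hP₀eq, hFeq]
      rw [integral_const_mul, ← mul_assoc, one_div_mul_cancel hp0.ne', one_mul]
      exact h
  refine ⟨_, ⟨hgr₀, fun ε hε => ?_, ?_⟩, hrep⟩
  · have h := hgr ε hε
    simp only [hP, ← hbase ε hε] at h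
    exact h
  · have h := hlim.const_mul (p / ((n : ℝ) - j) * cConst n j)
    have hval : p / ((n : ℝ) - j) * cConst n j * (1 / p * grIntegral n k F) =
        cConst n j / ((n : ℝ) - j) * grIntegral n (n - j) F := by
      rw [← hk]
      field_simp
    rw [hval] at h
    refine h.congr' ?_
    filter_upwards [self_mem_nhdsWithin] with ε hε
    simp only [hquot ε hε, hbase ε hε]
    rw [integral_div, integral_sub (hgr ε hε).2 hgr₀.2]
    simp only [quermass, grIntegral, ← hP₀, hP]
    ring

end FirstVariation

end

theorem mainTheorem6 (n j : ℕ) (hj : j < n) (p s : ℝ) (hp : 1 ≤ p)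
    (u : E n → ℝ) (hu : IsC2Plus u) (hf : IsF s (ofBase s fun x => (u x : EReal)))
    (ψ : E n → ℝ) (hψ : ContDiff ℝ ∞ ψ) (hψc : HasCompactSupport ψ)
    (hψ0 : ∀ y, 0 ≤ ψ y) (hψo : ψ 0 = 0) :
    -- the mixed quermassintegral of `f` and `g`, where `ψ = v*` and `g = (1 - s v)_+^{1/s}`
    (∀ v : E n → EReal, IsBase v → IsF s (ofBase s v) → (∀ y, legendre v y = (ψ y : EReal)) →
      ∃ W : ℝ, IsMixedQuermass n j p s (fun x => (u x : EReal)) v W ∧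
        IsRepresentedBy n j
          (mixedIntegrand p s (fun x => (u x : EReal)) fun H => legendre (projInf v H)) W) ∧
    -- the first variation under the perturbation `φ_ε = (φ^p + ε ψ^p)^{1/p}` of `φ = u*`
    (∃ W : ℝ,
      IsFirstVariation n j p (ofBase s fun x => (u x : EReal))
        (fun ε => ofBase s (legendre
          (lpMean p 1 (legendre fun x => (u x : EReal)) ε fun y => (ψ y : EReal)))) W ∧
        IsRepresentedBy n j
          (mixedIntegrand p s (fun x => (u x : EReal)) fun _ y => (ψ (y : E n) : EReal)) W) := by
  refine ⟨fun v _ _ hv => ?_, ?_⟩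
  -- Only the conjugate of `v` enters the Asplund sum, so this is the perturbation of `φ` by `ψ`,
  -- and `(v_H)* = ψ|_H`.
  · have hlv : legendre v = fun y => (ψ y : EReal) := funext hv
    have h := exists_isFirstVariation hj hp hu hf.integrable hψ hψc hψ0 hψo
      (Ψ := fun H => legendre (projInf v H)) fun H y => legendre_projInf (hv y)
    unfold IsMixedQuermass asplund lpAdd
    rwa [hlv]
  · exact exists_isFirstVariation hj hp hu hf.integrable hψ hψc hψ0 hψo fun H y => rfl
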